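/- **Setting.** Let $\mathcal M=(\mathcal S,\mathcal A,\mathbb P,r,H,d_1)$ be a finite-horizon time-inhomogeneous MDP whose initial distribution has density $d_1$ and whose transition kernels $\mathbb P_h(\cdot\mid s,a)$ have densities $p_h(\cdot\mid s,a)$ with respect to a $\sigma$-finite reference measure $\rho$ on $\mathcal S$ (e.g. Lebesgue or counting measure), with mean rewards $r_h(s,a)\in[0,1]$, $h\in[H]$. A policy $\pi=\{\pi_h\}$ has discrete action probabilities $\pi_h(a\mid s)$. $V^\pi_h,Q^\pi_h$ are its value functions ($Q^\pi_h(s,a)=r_h(s,a)+\mathbb E_{s'\sim\mathbb P_h(\cdot\mid s,a)}V^\pi_{h+1}(s')$, $V^\pi_h(s)=\mathbb E_{a\sim\pi_h(\cdot\mid s)}Q^\pi_h(s,a)$, $V^\pi_{H+1}=0$), $d^\pi_h(s)$ is the density of the state visited at step $h$, $d^\pi_h(s,a)=d^\pi_h(s)\pi_h(a\mid s)$, $\mathcal S^\pi_h=\{s:d^\pi_h(s)>0\}$ and $\mathcal S_h=\bigcup_\pi\mathcal S_h^\pi$. It is assumed that $d^\pi_h(s,a)\le 1$ for all $\pi,h,s,a$.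 The MDP is linear: for known features $\phi_h:\mathcal S\times\mathcal A\to\mathbb R^d$ with $\|\phi_h(s,a)\|_2\le1$ there are $\theta_h\in\mathbb R^d$ and $\nu_h:\mathcal S\to\mathbb R^d$ with $r_h(s,a)=\phi_h(s,a)^T\theta_h$, $p_h(s'\mid s,a)=\phi_h(s,a)^T\nu_h(s')$, $\|\theta_h\|_2\le\sqrt d$, and $\|\int\nu_h v\,d\rho\|_2\le\sqrt d\,\|v\|_\infty$ for all bounded measurable $v$. Let $\pi^*$ be a deterministic policy that is optimal ($V^\pi_h(s)\le V^{\pi^*}_h(s)$ for all $\pi,h,s$), $V^*=V^{\pi^*}$, $Q^*=Q^{\pi^*}$, $\mathcal S_h^*=\mathcal S_h^{\pi^*}$, $\phi_h^*(s)=\phi_h(s,\pi_h^*(s))$, $\mathrm{SubOpt}(\pi)=\mathbb E_{s\sim d_1}[V^*_1(s)-V^\pi_1(s)]$, and $\Delta_h(s,a)=V_h^*(s)-Q_h^*(s,a)$. **Data.** $K\ge1$ episodes $(s^t_h,a^t_h,r^t_h)_{h\in[H]}$, $t\in[K]$, are collected adaptively from $\mathcal M$ by a behaviour policy $\mu$: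 in episode $t$ the action at step $h$ is drawn from $\mu^t_h(\cdot\mid s^t_h)$, where $\mu^t$ may depend on the episodes $1,\dots,t-1$ (a fixed $\mu$ being a special case); the observed rewards lie in $[0,1]$ and have conditional mean $r_h(s_h^t,a_h^t)$. Below, $\mathrm{supp}(\mu_h(\cdot\mid s))$ and $\mathcal S_h^\mu$ are the sets of actions, respectively states, that have positive probability, respectively positive density at step $h$, under some $\mu^t$ (for some past), and a condition on $d^\mu_h$ is required of $d^{\mu^t}_h$ for every $t$ and every past. **Algorithm (BCP-VI).** For $k=1,\dots,K+1$: put $\hat V^k_{H+1}=0$ and for $h=H,\dots,1$ let $\Sigma_h^k=I+\sum_{t=1}^{k-1}\phi_h(s_h^t,a_h^t)\phi_h(s_h^t,a_h^t)^T$, $\hat w^k_h=(\Sigma_h^k)^{-1}\sum_{t=1}^{k-1}\phi_h(s^t_h,a^t_h)\,(r_h^t+\hat V^k_{h+1}(s^t_{h+1}))$, $\hat Q_h^k=\max\{0,\min\{\langle\phi_h,\hat w_h^k\rangle-\beta_k\|\phi_h\|_{(\Sigma_h^k)^{-1}},\,H-h+1\}\}$, $\hat\pi^k_h\in\arg\max_{\pi_h\in\Pi_h(\mu)}\langle\hat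 Q_h^k,\pi_h\rangle$ and $\hat V_h^k=\langle\hat Q_h^k,\hat\pi_h^k\rangle$. Here $\Pi_h(\mu)$ is the set of all $\pi_h$ with $\mathrm{supp}(\pi_h(\cdot\mid s))\subseteq\mathrm{supp}(\mu_h(\cdot\mid s))$ for all $s\in\mathcal S_h$, and $\beta_k=c_1\,dH\log(dHk/\delta)$. **Assumptions.** 1. (Optimal-policy concentrability) $d_h^{\pi^*}(s,a)>0\Rightarrow d_h^\mu(s,a)>0$ for all $h,s,a$. 2. $\kappa_h^{-1}:=\inf\{d^\mu_h(s,a):d_h^\mu(s,a)>0\}>0$ for all $h$. 3. $\Delta_{\min}:=\inf\{\Delta_h(s,a):\Delta_h(s,a)\ne0\}>0$ (in particular, some gap is nonzero). 4. (Unique optimality) For all $h$ and $s\in\mathcal S_h^*$ exactly one action $a$ has $\Delta_h(s,a)=0$. (Spanning features) $\mathrm{span}\{\phi_h^*(s):s\in\mathcal S_h^\mu\}\subseteq\mathrm{span}\{\phi^*_h(s):s\in\mathcal S_h^*\}$ for all $h$. **Threshold.** Let $\lambda_h^+$ be the smallest positive eigenvalue of $\Sigma_h^*=\mathbb E_{(s,a)\sim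 d^{\pi^*}_h}[\phi_h(s,a)\phi_h(s,a)^T]$, $\kappa=\sum_{h=1}^H\kappa_h$, $\kappa_{1:h}=\prod_{i=1}^h\kappa_i$, and $k^*=\max_{h\in[H]}\max\{\bar k_h,\tilde k_h\}$ with $$\bar k_h=\min\Big\{\tilde\Omega_h\Big(\tfrac{d^6H^4\kappa^6}{\Delta_{\min}^4(\lambda_h^+)^2}+\tfrac{\kappa_{1:h}}{\lambda_h^+}\Big),\ \tilde\Omega_h\Big(\tfrac{\kappa_{1:h}^2\kappa^2H^2d^3}{(\lambda_h^+)^2}\Big)\Big\},\qquad \tilde k_h=\tilde\Omega_h\Big(\tfrac{d^2H^4\kappa_{1:h}}{\Delta_{\min}^2(\lambda_h^+)^3}\Big),$$ where $\tilde\Omega_h(x)=C\,x\,\log^p\!\Big(e+\tfrac{dH\kappa\,\kappa_{1:h}}{\delta\,\Delta_{\min}\lambda_h^+}\Big)$. **Theorem.** There are absolute constants $c_1,C>0$ and $p\in\mathbb N$ such that, for all data as above satisfying Assumptions 1–4 and all $\delta\in(0,1]$, with probability at least $1-4\delta$: $\mathrm{SubOpt}(\hat\pi^k)=0$ for every $k\in\{1,\dots,K+1\}$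 with $k\ge k^*$ (for every choice of the maximizers $\hat\pi^k_h$). -/

import Mathlib

open MeasureTheory

namespace BCPVI

noncomputable section

/-! Steps `h` and episodes `t`, `k` are numbered from `1`, as natural numbers; values of the objects
below at indices outside the stated ranges play no role. -/

/-- A finite-horizon time-inhomogeneous MDP with initial state density `init`, transition densities
`dens h s a s'` (both with respect to the reference measure `ρ` on the state space) and mean rewards
`rew h s a ∈ [0,1]`, for the steps `h = 1, …, H`. -/
structure MDP (S A : Type*) [MeasurableSpace S] [MeasurableSpace A] (ρ : Measure S) where
  H : ℕ
  init : S → ℝ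
  init_meas : Measurable init
  init_nonneg : ∀ s, 0 ≤ init s
  init_mass : ∫⁻ s, ENNReal.ofReal (init s) ∂ρ = 1
  dens : ℕ → S → A → S → ℝ
  dens_meas : ∀ h ∈ Finset.Icc 1 H, Measurable fun x : (S × A) × S => dens h x.1.1 x.1.2 x.2
  dens_nonneg : ∀ h ∈ Finset.Icc 1 H, ∀ s a s', 0 ≤ dens h s a s'
  dens_mass : ∀ h ∈ Finset.Icc 1 H, ∀ s a, ∫⁻ s', ENNReal.ofReal (dens h s a s') ∂ρ = 1
  rew : ℕ → S → A → ℝ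
  rew_meas : ∀ h ∈ Finset.Icc 1 H, Measurable fun x : S × A => rew h x.1 x.2
  rew_mem : ∀ h ∈ Finset.Icc 1 H, ∀ s a, rew h s a ∈ Set.Icc (0 : ℝ) 1

/-- A one-step (randomized) decision rule: `act s a` is the probability `π_h(a | s)` of action `a`
in state `s`, measurably in `s`. -/
structure DecisionRule (S A : Type*) [MeasurableSpace S] [MeasurableSpace A] where
  act : S → PMF A
  meas : ∀ B : Set A, MeasurableSet B → Measurable fun s => (act s).toMeasure B

/-- A (Markov, randomized) policy: one decision rule for every step. -/
abbrev Policy (S A : Type*) [MeasurableSpace S] [MeasurableSpace A] := ℕ → DecisionRule S A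

section

variable {S A : Type*} [MeasurableSpace S] [MeasurableSpace A] {ρ : Measure S}

/-- `⟨f, π⟩(s) = 𝔼_{a ∼ π(· | s)} f(s, a)`. -/
def DecisionRule.avg (π : DecisionRule S A) (f : S → A → ℝ) (s : S) : ℝ :=
  ∫ a, f s a ∂(π.act s).toMeasure

/-- The deterministic policy playing the action `f h s` in state `s` at step `h`. -/
def detPolicy (f : ℕ → S → A) (hf : ∀ h, Measurable (f h)) : Policy S A := fun h =>
  { act := fun s => PMF.pure (f h s)
    meas := by
      intro B hB
      simp only [PMF.toMeasure_pure, Measure.dirac_apply' _ hB]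
      exact (measurable_one.indicator hB).comp (hf h) }

namespace MDP

variable (M : MDP S A ρ)

/-- The initial state distribution `d₁`. -/
def initMeasure : Measure S := ρ.withDensity fun s => ENNReal.ofReal (M.init s)

/-- The next-state distribution `ℙ_h(· | s, a)`. -/
def transMeasure (h : ℕ) (s : S) (a : A) : Measure S :=
  ρ.withDensity fun s' => ENNReal.ofReal (M.dens h s a s')

/-- `(T_h V)(s, a) = r_h(s, a) + 𝔼_{s' ∼ ℙ_h(· | s, a)} V(s')`. -/
def bellman (h : ℕ) (V : S → ℝ) (s : S) (a : A) : ℝ :=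
  M.rew h s a + ∫ s', V s' ∂(M.transMeasure h s a)

/-- The value of `π` with `n` steps to go; with `n + 1` steps to go the current step is `H - n`. -/
def valueToGo (π : Policy S A) : ℕ → S → ℝ
  | 0 => fun _ => 0
  | n + 1 => (π (M.H - n)).avg (M.bellman (M.H - n) (valueToGo π n))

/-- `V^π_h`, for `h = 1, …, H + 1` (with `V^π_{H+1} = 0`). -/
def V (π : Policy S A) (h : ℕ) : S → ℝ := M.valueToGo π (M.H + 1 - h)

/-- `Q^π_h = T_h V^π_{h+1}`. -/
def Q (π : Policy S A) (h : ℕ) : S → A → ℝ := M.bellman h (M.V π (h + 1))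

/-- `π` is an optimal policy: its value is maximal at every step and state. -/
def IsOptimal (π : Policy S A) : Prop :=
  ∀ π' : Policy S A, ∀ h ∈ Finset.Icc 1 M.H, ∀ s, M.V π' h s ≤ M.V π h s

/-- The marginal state-visitation density `d^π_h(s)`: `d^π_1 = d₁` and
`d^π_{h+1}(s') = ∫ 𝔼_{a ∼ π_h(· | s)} [d^π_h(s) p_h(s' | s, a)] ρ(ds)`. -/
def stateDens (π : Policy S A) : ℕ → S → ENNReal
  | 0 => fun _ => 0
  | 1 => fun s => ENNReal.ofReal (M.init s)
  | h + 2 => fun s' =>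
      ∫⁻ s, ∫⁻ a, stateDens π (h + 1) s * ENNReal.ofReal (M.dens (h + 1) s a s')
        ∂((π (h + 1)).act s).toMeasure ∂ρ

/-- The state-action visitation density `d^π_h(s, a) = d^π_h(s) π_h(a | s)`. -/
def saDens (π : Policy S A) (h : ℕ) (s : S) (a : A) : ENNReal :=
  M.stateDens π h s * (π h).act s a

/-- The set `𝒮_h` of states that are feasible at step `h` under some policy. -/
def feasible (h : ℕ) : Set S := {s | ∃ π : Policy S A, 0 < M.stateDens π h s}

/-- `SubOpt(π) = 𝔼_{s₁ ∼ d₁} [V^{π*}_1(s₁) - V^π_1(s₁)]`. -/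
def subOpt (πstar π : Policy S A) : ℝ := ∫ s, (M.V πstar 1 s - M.V π 1 s) ∂M.initMeasure

/-- The gap `Δ_h(s, a) = V*_h(s) - Q*_h(s, a)`, for an optimal policy `πstar`. -/
def gap (πstar : Policy S A) (h : ℕ) (s : S) (a : A) : ℝ := M.V πstar h s - M.Q πstar h s a

/-- The minimal sub-optimality gap `Δ_min`: the infimum of the nonzero gaps. -/
def gapMin (πstar : Policy S A) : ℝ :=
  sInf {x : ℝ | x ≠ 0 ∧ ∃ h ∈ Finset.Icc 1 M.H, ∃ s a, x = M.gap πstar h s a}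

/-- Linear MDP with feature maps `φ_h : S × A → ℝ^d`. -/
def IsLinear {d : ℕ} (φ : ℕ → S → A → EuclideanSpace ℝ (Fin d)) : Prop :=
  ∀ h ∈ Finset.Icc 1 M.H,
    (Measurable fun x : S × A => φ h x.1 x.2) ∧ (∀ s a, ‖φ h s a‖ ≤ 1) ∧
    ∃ (θ : EuclideanSpace ℝ (Fin d)) (m : S → EuclideanSpace ℝ (Fin d)),
      (∀ s a, M.rew h s a = inner ℝ (φ h s a) θ) ∧
      (∀ s a s', M.dens h s a s' = inner ℝ (φ h s a) (m s')) ∧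
      ‖θ‖ ≤ Real.sqrt d ∧ Integrable m ρ ∧
      ∀ (v : S → ℝ) (B : ℝ), Measurable v → (∀ s, |v s| ≤ B) →
        ‖∫ s, v s • m s ∂ρ‖ ≤ Real.sqrt d * B

/-- The matrix `𝔼_{(s,a) ∼ d^π_h} [φ_h(s, a) φ_h(s, a)ᵀ]`. -/
def featureCov {d : ℕ} (φ : ℕ → S → A → EuclideanSpace ℝ (Fin d)) (π : Policy S A) (h : ℕ) :
    Matrix (Fin d) (Fin d) ℝ :=
  Matrix.of fun i j => ∫ s, (π h).avg (fun s a => φ h s a i * φ h s a j) s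
    ∂(ρ.withDensity (M.stateDens π h))

end MDP

/-- The smallest positive eigenvalue of a matrix. -/
def minPosEigenvalue {d : ℕ} (B : Matrix (Fin d) (Fin d) ℝ) : ℝ :=
  sInf {x : ℝ | 0 < x ∧ Module.End.HasEigenvalue (Matrix.toLin' B) x}

/-! ### The offline data -/

section Data

variable {Ω : Type*}

/-- The σ-algebra generated by `(s_h^t, a_h^t, r_h^t)`. -/
@[reducible] def stepInfo (st : ℕ → ℕ → Ω → S) (ac : ℕ → ℕ → Ω → A) (rw : ℕ → ℕ → Ω → ℝ) (t h : ℕ) :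
    MeasurableSpace Ω :=
  MeasurableSpace.comap (st t h) inferInstance ⊔ MeasurableSpace.comap (ac t h) inferInstance ⊔
    MeasurableSpace.comap (rw t h) inferInstance

/-- The σ-algebra generated by the complete episodes `1, …, t - 1` and the steps `1, …, h - 1` of
episode `t`. For `h = 1` it is the σ-algebra `ℱ_{t-1}` of the first `t - 1` episodes. -/
@[reducible] def history (H : ℕ) (st : ℕ → ℕ → Ω → S) (ac : ℕ → ℕ → Ω → A) (rw : ℕ → ℕ → Ω → ℝ) (t h : ℕ) :
    MeasurableSpace Ω :=
  (⨆ t' ∈ Finset.Ico 1 t, ⨆ h' ∈ Finset.Icc 1 H, stepInfo st ac rw t' h') ⊔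
    ⨆ h' ∈ Finset.Ico 1 h, stepInfo st ac rw t h'

/-- `K` episodes `(s_h^t, a_h^t, r_h^t)` of the MDP, collected adaptively: in episode `t` actions are
drawn from a policy `μ^t` that may depend on the episodes `1, …, t - 1` (it is `ℱ_{t-1}`-measurable);
observed rewards lie in `[0,1]` and have conditional mean `r_h`. A fixed behaviour policy is the case
where `μ t ω` depends neither on `t` nor on `ω`. -/
structure IsAdaptiveData [MeasurableSpace Ω] (P : Measure Ω) (M : MDP S A ρ) (K : ℕ)
    (st : ℕ → ℕ → Ω → S) (ac : ℕ → ℕ → Ω → A) (rw : ℕ → ℕ → Ω → ℝ)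
    (μ : ℕ → Ω → Policy S A) : Prop where
  st_meas : ∀ t ∈ Finset.Icc 1 K, ∀ h ∈ Finset.Icc 1 M.H, Measurable (st t h)
  ac_meas : ∀ t ∈ Finset.Icc 1 K, ∀ h ∈ Finset.Icc 1 M.H, Measurable (ac t h)
  rw_meas : ∀ t ∈ Finset.Icc 1 K, ∀ h ∈ Finset.Icc 1 M.H, Measurable (rw t h)
  /-- `μ^t` is determined measurably by the previous episodes. -/
  policy_meas : ∀ t ∈ Finset.Icc 1 K, ∀ h ∈ Finset.Icc 1 M.H, ∀ B : Set A, MeasurableSet B →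
    Measurable[(history M.H st ac rw t 1).prod inferInstance]
      fun x : Ω × S => ((μ t x.1 h).act x.2).toMeasure B
  /-- `s_1^t ∼ d₁` given the previous episodes. -/
  init_law : ∀ t ∈ Finset.Icc 1 K, 1 ≤ M.H → ∀ B : Set S, MeasurableSet B →
    P[(st t 1 ⁻¹' B).indicator (fun _ => (1 : ℝ)) | history M.H st ac rw t 1]
      =ᵐ[P] fun _ => (M.initMeasure B).toReal
  /-- `a_h^t ∼ μ^t_h(· | s_h^t)` given the past and `s_h^t`. -/
  action_law : ∀ t ∈ Finset.Icc 1 K, ∀ h ∈ Finset.Icc 1 M.H, ∀ B : Set A, MeasurableSet B →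
    P[(ac t h ⁻¹' B).indicator (fun _ => (1 : ℝ)) |
        history M.H st ac rw t h ⊔ MeasurableSpace.comap (st t h) inferInstance]
      =ᵐ[P] fun ω => (((μ t ω h).act (st t h ω)).toMeasure B).toReal
  reward_mem : ∀ t ∈ Finset.Icc 1 K, ∀ h ∈ Finset.Icc 1 M.H,
    ∀ᵐ ω ∂P, rw t h ω ∈ Set.Icc (0 : ℝ) 1
  /-- `r_h^t` has mean `r_h(s_h^t, a_h^t)` given the past, `s_h^t` and `a_h^t`. -/
  reward_mean : ∀ t ∈ Finset.Icc 1 K, ∀ h ∈ Finset.Icc 1 M.H,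
    P[rw t h | history M.H st ac rw t h ⊔ MeasurableSpace.comap (st t h) inferInstance ⊔
        MeasurableSpace.comap (ac t h) inferInstance]
      =ᵐ[P] fun ω => M.rew h (st t h ω) (ac t h ω)
  /-- `s_{h+1}^t ∼ ℙ_h(· | s_h^t, a_h^t)` given the past, `s_h^t` and `a_h^t`. -/
  trans_law : ∀ t ∈ Finset.Icc 1 K, ∀ h ∈ Finset.Ico 1 M.H, ∀ B : Set S, MeasurableSet B →
    P[(st t (h + 1) ⁻¹' B).indicator (fun _ => (1 : ℝ)) |
        history M.H st ac rw t h ⊔ MeasurableSpace.comap (st t h) inferInstance ⊔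
          MeasurableSpace.comap (ac t h) inferInstance]
      =ᵐ[P] fun ω => (M.transMeasure h (st t h ω) (ac t h ω) B).toReal

/-- `supp(μ_h(· | s))`: the actions to which the behaviour policy can give positive probability. -/
def behaviourSupp (K : ℕ) (μ : ℕ → Ω → Policy S A) (h : ℕ) (s : S) : Set A :=
  {a | ∃ t ∈ Finset.Icc 1 K, ∃ ω, a ∈ ((μ t ω h).act s).support}

/-- `𝒮^μ_h`: the states that are feasible at step `h` under the behaviour policy. -/
def behaviourStates (M : MDP S A ρ) (K : ℕ) (μ : ℕ → Ω → Policy S A) (h : ℕ) : Set S :=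
  {s | ∃ t ∈ Finset.Icc 1 K, ∃ ω, 0 < M.stateDens (μ t ω) h s}

/-- `κ_h⁻¹`: the infimum of the positive values of the state-action visitation density of the
behaviour policy at step `h`. -/
def invKappa (M : MDP S A ρ) (K : ℕ) (μ : ℕ → Ω → Policy S A) (h : ℕ) : ENNReal :=
  sInf {x | 0 < x ∧ ∃ t ∈ Finset.Icc 1 K, ∃ ω s a, x = M.saDens (μ t ω) h s a}

/-- `κ_h`. -/
def kappa (M : MDP S A ρ) (K : ℕ) (μ : ℕ → Ω → Policy S A) (h : ℕ) : ℝ :=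
  ((invKappa M K μ h)⁻¹).toReal

end Data

/-! ### The algorithm BCP-VI

The data are `st t h`, `ac t h`, `rw t h`; `supp h s` is the support of the behaviour policy, `lam`
the regularization parameter, `β k` the uncertainty parameter. -/

section Algorithm

variable {d : ℕ} (M : MDP S A ρ) (φ : ℕ → S → A → EuclideanSpace ℝ (Fin d))
  (lam : ℝ) (β : ℕ → ℝ) (supp : ℕ → S → Set A)
  (st : ℕ → ℕ → S) (ac : ℕ → ℕ → A) (rw : ℕ → ℕ → ℝ)

/-- `Σ_h^k = ∑_{t=1}^{k-1} φ_h(s_h^t, a_h^t) φ_h(s_h^t, a_h^t)ᵀ + λ I`. -/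
def gram (k h : ℕ) : Matrix (Fin d) (Fin d) ℝ :=
  ∑ t ∈ Finset.Ico 1 k,
    Matrix.vecMulVec (φ h (st t h) (ac t h)).ofLp (φ h (st t h) (ac t h)).ofLp +
  lam • (1 : Matrix (Fin d) (Fin d) ℝ)

/-- `ŵ_h^k`, computed from `Vnext = V̂^k_{h+1}`. -/
def weight (k h : ℕ) (Vnext : S → ℝ) : Fin d → ℝ :=
  Matrix.mulVec (gram φ lam st ac k h)⁻¹
    (∑ t ∈ Finset.Ico 1 k,
      (rw t h + Vnext (st t (h + 1))) • (φ h (st t h) (ac t h)).ofLp)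

/-- The bonus `b_h^k(s, a) = β_k ‖φ_h(s, a)‖_{(Σ_h^k)⁻¹}`. -/
def bonus (k h : ℕ) (s : S) (a : A) : ℝ :=
  β k * Real.sqrt (dotProduct (φ h s a).ofLp
    (Matrix.mulVec (gram φ lam st ac k h)⁻¹ (φ h s a).ofLp))

/-- `Q̂_h^k = min{⟨φ_h, ŵ_h^k⟩ - b_h^k, H - h + 1}⁺`, computed from `Vnext = V̂^k_{h+1}`. -/
def qHatOf (k h : ℕ) (Vnext : S → ℝ) (s : S) (a : A) : ℝ :=
  max (min (dotProduct (φ h s a).ofLp (weight φ lam st ac rw k h Vnext) -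
    bonus φ lam β st ac k h s a) ((M.H : ℝ) - h + 1)) 0

/-- `V̂^k` with `n` steps to go, when the policy extracted in round `k` is `π`. -/
def vHatToGo (k : ℕ) (π : Policy S A) : ℕ → S → ℝ
  | 0 => fun _ => 0
  | n + 1 => (π (M.H - n)).avg
      (qHatOf M φ lam β st ac rw k (M.H - n) (vHatToGo k π n))

/-- `V̂_h^k` (with `V̂_{H+1}^k = 0`). -/
def vHat (k : ℕ) (π : Policy S A) (h : ℕ) : S → ℝ :=
  vHatToGo M φ lam β st ac rw k π (M.H + 1 - h)

/-- `Q̂_h^k`. -/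
def qHat (k : ℕ) (π : Policy S A) (h : ℕ) : S → A → ℝ :=
  qHatOf M φ lam β st ac rw k h (vHat M φ lam β st ac rw k π (h + 1))

/-- The class `Π_h(μ)` of decision rules supported in the support of the behaviour policy at all
feasible states. -/
def supportedRules (h : ℕ) : Set (DecisionRule S A) :=
  {π | ∀ s ∈ M.feasible h, (π.act s).support ⊆ supp h s}

/-- `π` is a possible `k`-th ensemble policy `π̂^k` of BCP-VI on the given data (for some choice of
maximizers): `π_h ∈ argmax_{π' ∈ Π_h(μ)} ⟨Q̂_h^k, π'⟩` for all `h`. -/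
def IsEnsemblePolicy (k : ℕ) (π : Policy S A) : Prop :=
  ∀ h ∈ Finset.Icc 1 M.H, π h ∈ supportedRules M supp h ∧
    ∀ π' ∈ supportedRules M supp h, ∀ s,
      π'.avg (qHat M φ lam β st ac rw k π h) s ≤ (π h).avg (qHat M φ lam β st ac rw k π h) s

end Algorithm

end

/-! ### The threshold `k*`

`C` and `p` are the absolute constant and the power of the logarithm hidden in `Ω̃`; `κ h = κ_h`,
`lamPlus h = λ_h^+`, `Δ = Δ_min`. -/

section Threshold

variable (C : ℝ) (p d H : ℕ) (κ lamPlus : ℕ → ℝ) (Δ δ : ℝ)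

/-- `κ = ∑_{h=1}^H κ_h`. -/
def kappaSum : ℝ := ∑ h ∈ Finset.Icc 1 H, κ h

/-- `κ_{1:h} = ∏_{i=1}^h κ_i`. -/
def kappaProd (h : ℕ) : ℝ := ∏ i ∈ Finset.Icc 1 h, κ i

/-- The logarithmic factor hidden in `Ω̃` at step `h`. -/
def logFactor (h : ℕ) : ℝ :=
  Real.log (Real.exp 1 + d * H * kappaSum H κ * kappaProd κ h / (δ * Δ * lamPlus h))

/-- `Ω̃(x) = C x log^p(…)`. -/
def omegaTilde (h : ℕ) (x : ℝ) : ℝ := C * x * logFactor d H κ lamPlus Δ δ h ^ p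

/-- `k̄_h`. -/
def kBar (h : ℕ) : ℝ :=
  min
    (omegaTilde C p d H κ lamPlus Δ δ h
      ((d : ℝ) ^ 6 * (H : ℝ) ^ 4 * kappaSum H κ ^ 6 / (Δ ^ 4 * lamPlus h ^ 2) +
        kappaProd κ h / lamPlus h))
    (omegaTilde C p d H κ lamPlus Δ δ h
      (kappaProd κ h ^ 2 * kappaSum H κ ^ 2 * (H : ℝ) ^ 2 * (d : ℝ) ^ 3 / lamPlus h ^ 2))

/-- `k̃_h`. -/
def kTilde (h : ℕ) : ℝ :=
  omegaTilde C p d H κ lamPlus Δ δ h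
    ((d : ℝ) ^ 2 * (H : ℝ) ^ 4 * kappaProd κ h / (Δ ^ 2 * lamPlus h ^ 3))

/-- `k* = max_{h ∈ [H]} (k̄_h ∨ k̃_h)`. -/
def kStar : ℝ :=
  ⨆ h : Finset.Icc 1 H,
    max (kBar C p d H κ lamPlus Δ δ h) (kTilde C p d H κ lamPlus Δ δ h)

end Threshold

end

end BCPVI

open BCPVI

/-!
Write `Σ` for the regularized Gram matrix `Σ_h^k`, `b = β_k ‖φ‖_{Σ⁻¹}` for the bonus and `L` for
`log (d H k / δ)`. The theorem rests on two concentration events and on a deterministic argument.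

*Regression.* Because the MDP is linear, `T_h V` is linear in `φ_h` for every `V`, and the error of the
regression of `V̂_{h+1}` is a self-normalized sum of martingale differences. Testing it against one
direction `x` with `∑ ⟨x, φ⟩² ≤ 1` (`abs_ridge_prediction_sub_le`) replaces the usual determinant
argument by an exponential supermartingale for fixed `(x, V)`. As `V̂_{h+1}` depends on the data, a
union bound is taken over all values of `(x, ŵ, β² Σ⁻¹)` up to a polynomially fine grid; `V̂_{h+1}` is
a Hölder continuous function of `(ŵ, β² Σ⁻¹)`, the maximum of the truncated linear functions over the allowed
actions (`IsEnvelope`, `exists_regression_event`). The cells of the grid need not be measurable: in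
each cell that contains an admissible triple one is chosen in advance (`exists_grid_cover`). Hence
`|⟨φ, ŵ⟩ - T_h V̂_{h+1}| ≤ b` at all states and actions (`isAccurate_of_noise_le`).

*Coverage.* At a state visited by the optimal policy, concentrability makes the data contain the optimal
action with density at least `1 / κ_h`, while the optimal density is at most `1`. So for each direction
`x` the data with optimal actions have `∑ ⟨x, φ⟩² ≥ (k - 1) / (2 κ_h) xᵀ Σ* x - O(d² L)`
(`exists_coverage_event`); only these terms of `Σ` are used. Almost surely the features concerned are
orthogonal to the kernel of `Σ*`, where the smallest positive eigenvalue `λ` is the relevant one, and so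
`‖φ*‖²_{Σ⁻¹} ≤ 4 κ_h / ((k - 1) λ)` along the optimal policy (`ae_ridge_inv_quadratic_le`).

*Conclusion.* By the first event the computed values are pessimistic, `Q̂_h ≤ Q*_h` everywhere, and by
both `V*_h - V̂_h` is at most `H` times twice the largest bonus along the optimal policy
(`IsAccurate.V_sub_vHat_le`). Once this is below the minimal gap, an action played by `π̂^k` at an
optimally visited state has gap `0`, since `Q̂ = V̂` there; by uniqueness it is the optimal action
(`IsAccurate.ae_act_eq_pure`). Thus `π̂^k` agrees with the optimal policy almost everywhere along the
optimal trajectories, which is exact optimality from the initial distribution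
(`subOpt_eq_zero_of_ae_act_eq_pure`). The bonus is that small as soon as `k ≥ k̃_h` for all `h`
(`log_sq_mul_le_of_threshold_le`).
-/

namespace BCPVI

/-! ### Conditional laws and exponential moments -/

/-- If `κ (Y ω)` is the conditional law of `X` given `Y`, then the joint law of `(Y, X)` integrates as
expected. -/
theorem lintegral_of_conditional_law {Ω Z E : Type*} [MeasurableSpace Ω] [MeasurableSpace Z]
    [MeasurableSpace E] (P : Measure Ω) [IsProbabilityMeasure P] {Y : Ω → Z} (hY : Measurable Y)
    {X : Ω → E} (hX : Measurable X) {κ : Z → Measure E} (hκ : Measurable κ)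
    (hκ1 : ∀ z, IsProbabilityMeasure (κ z))
    (h : ∀ D : Set Z, MeasurableSet D → ∀ B : Set E, MeasurableSet B →
      P (Y ⁻¹' D ∩ X ⁻¹' B) = ∫⁻ ω in Y ⁻¹' D, κ (Y ω) B ∂P)
    {F : Z × E → ENNReal} (hF : Measurable F) :
    ∫⁻ ω, F (Y ω, X ω) ∂P = ∫⁻ ω, ∫⁻ x, F (Y ω, x) ∂(κ (Y ω)) ∂P := by
  let k : ProbabilityTheory.Kernel Z E := ⟨κ, hκ⟩
  have : ProbabilityTheory.IsMarkovKernel k := ⟨hκ1⟩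
  have : IsProbabilityMeasure (P.map Y) := Measure.isProbabilityMeasure_map hY.aemeasurable
  have hYX : Measurable fun ω => (Y ω, X ω) := hY.prodMk hX
  have key : P.map (fun ω => (Y ω, X ω)) = (P.map Y).compProd k := by
    have : IsProbabilityMeasure (P.map (fun ω => (Y ω, X ω))) :=
      Measure.isProbabilityMeasure_map hYX.aemeasurable
    refine Measure.ext_prod fun {D B} hD hB => ?_
    rw [Measure.map_apply hYX (hD.prod hB), Measure.compProd_apply_prod hD hB,
      setLIntegral_map hD (k.measurable_coe hB) hY]
    exact h D hD B hB
  rw [← lintegral_map hF hYX, key, Measure.lintegral_compProd hF,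
    lintegral_map (hF.lintegral_kernel_prod_right') hY]
  rfl

/-- The law of `X` given a sub-σ-algebra `m`, in the form of an integration rule. -/
theorem lintegral_of_condExp_indicator {Ω E : Type*} {m m0 : MeasurableSpace Ω} (hm : m ≤ m0)
    [MeasurableSpace E] (P : Measure Ω) [IsProbabilityMeasure P]
    {X : Ω → E} (hX : Measurable X) {κ : Ω → Measure E} (hκ : Measurable[m] κ)
    (hκ1 : ∀ z, IsProbabilityMeasure (κ z))
    (h : ∀ B : Set E, MeasurableSet B →
      P[(X ⁻¹' B).indicator (fun _ => (1 : ℝ)) | m] =ᵐ[P] fun ω => (κ ω B).toReal)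
    {F : Ω × E → ENNReal} (hF : Measurable[m.prod inferInstance] F) :
    ∫⁻ ω, F (ω, X ω) ∂P = ∫⁻ ω, ∫⁻ x, F (ω, x) ∂(κ ω) ∂P := by
  refine @lintegral_of_conditional_law Ω Ω E m0 m _ P _ id (measurable_id'' hm) X hX κ hκ hκ1 ?_ F hF
  intro D hD B hB
  have hD0 := hm D hD
  have hint : Integrable ((X ⁻¹' B).indicator (fun _ => (1 : ℝ))) P :=
    (integrable_const 1).indicator (hX hB)
  have h1 := setIntegral_condExp hm hint hD
  rw [setIntegral_congr_ae (g := fun ω => (κ ω B).toReal) hD0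
    ((h B hB).mono fun ω hω _ => hω)] at h1
  have h2 : ∫ ω in D, (X ⁻¹' B).indicator (fun _ => (1 : ℝ)) ω ∂P = (P (D ∩ X ⁻¹' B)).toReal := by
    rw [setIntegral_indicator (hX hB), setIntegral_const]
    simp [Measure.real]
  have hmeas : Measurable[m0] fun ω => κ ω B :=
    ((Measure.measurable_coe hB).comp hκ).mono hm le_rfl
  rw [h2, integral_toReal hmeas.aemeasurable
    (Filter.Eventually.of_forall fun ω => by
      have := hκ1 ω; exact measure_lt_top _ _)] at h1
  have hfin : ∫⁻ ω in D, κ ω B ∂P ≠ ⊤ := by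
    refine ne_of_lt (lt_of_le_of_lt (lintegral_mono (g := fun _ => 1) fun ω => ?_) ?_)
    · have := hκ1 ω; exact prob_le_one
    · simp
  simpa using ((ENNReal.toReal_eq_toReal_iff' hfin (measure_ne_top _ _)).1 h1).symm

/-- Conditional expectation of a bounded function of a random element whose conditional law is known. -/
theorem condExp_comp_of_law {Ω E : Type*} {m m0 : MeasurableSpace Ω} (hm : m ≤ m0)
    [MeasurableSpace E] (P : Measure Ω) [IsProbabilityMeasure P]
    {X : Ω → E} (hX : Measurable X) {κ : Ω → Measure E} (hκ : Measurable[m] κ)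
    (hκ1 : ∀ z, IsProbabilityMeasure (κ z))
    (h : ∀ B : Set E, MeasurableSet B →
      P[(X ⁻¹' B).indicator (fun _ => (1 : ℝ)) | m] =ᵐ[P] fun ω => (κ ω B).toReal)
    {V : E → ℝ} (hV : Measurable V) (hV0 : ∀ x, 0 ≤ V x) {C : ℝ} (hVC : ∀ x, V x ≤ C) :
    P[fun ω => V (X ω) | m] =ᵐ[P] fun ω => ∫ x, V x ∂(κ ω) := by
  have hVm : Measurable fun x => ENNReal.ofReal (V x) := hV.ennreal_ofReal
  have hmeasL : Measurable[m] fun ω => ∫⁻ x, ENNReal.ofReal (V x) ∂(κ ω) :=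
    (Measure.measurable_lintegral hVm).comp hκ
  have hintV : ∀ ω, ∫ x, V x ∂(κ ω) = (∫⁻ x, ENNReal.ofReal (V x) ∂(κ ω)).toReal := fun ω =>
    integral_eq_lintegral_of_nonneg_ae (Filter.Eventually.of_forall hV0) hV.aestronglyMeasurable
  have hmeas : Measurable[m] fun ω => ∫ x, V x ∂(κ ω) := by
    simp_rw [hintV]; exact hmeasL.ennreal_toReal
  have hle : ∀ ω, ∫⁻ x, ENNReal.ofReal (V x) ∂(κ ω) ≤ ENNReal.ofReal C := fun ω => by
    have := hκ1 ω
    calc ∫⁻ x, ENNReal.ofReal (V x) ∂(κ ω) ≤ ∫⁻ _, ENNReal.ofReal C ∂(κ ω) :=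
          lintegral_mono fun x => ENNReal.ofReal_le_ofReal (hVC x)
      _ = _ := by simp
  have hfin : ∀ ω, ∫⁻ x, ENNReal.ofReal (V x) ∂(κ ω) < ⊤ := fun ω =>
    lt_of_le_of_lt (hle ω) ENNReal.ofReal_lt_top
  have hb : ∀ ω, |∫ x, V x ∂(κ ω)| ≤ |C| := fun ω => by
    rw [hintV, abs_of_nonneg ENNReal.toReal_nonneg]
    refine (ENNReal.toReal_mono ENNReal.ofReal_ne_top (hle ω)).trans ?_
    rw [ENNReal.toReal_ofReal']
    exact max_le (le_abs_self C) (abs_nonneg C)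
  have hi : Integrable (fun ω => V (X ω)) P := by
    refine Integrable.of_bound (hV.comp hX).aestronglyMeasurable |C|
      (Filter.Eventually.of_forall fun ω => ?_)
    rw [Real.norm_eq_abs, abs_of_nonneg (hV0 _)]
    exact (hVC _).trans (le_abs_self C)
  have hi2 : Integrable (fun ω => ∫ x, V x ∂(κ ω)) P :=
    Integrable.of_bound (hmeas.mono hm le_rfl).aestronglyMeasurable |C|
      (Filter.Eventually.of_forall hb)
  refine (ae_eq_condExp_of_forall_setIntegral_eq hm hi (fun D _ _ => hi2.integrableOn) ?_
    hmeas.stronglyMeasurable.aestronglyMeasurable).symm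
  classical
  intro D hD _
  have hD0 := hm D hD
  have hF : Measurable[m.prod inferInstance]
      fun x : Ω × E => D.indicator (fun _ => (1 : ENNReal)) x.1 * ENNReal.ofReal (V x.2) := by
    refine Measurable.mul ?_ (hVm.comp (@measurable_snd _ _ m _))
    exact (Measurable.indicator (measurable_const) hD).comp (@measurable_fst _ _ m _)
  have := lintegral_of_condExp_indicator hm P hX hκ hκ1 h hF
  simp only [Set.indicator_apply, ite_mul, one_mul, zero_mul] at this
  have e1 : ∀ g : Ω → ENNReal, ∫⁻ ω, (if ω ∈ D then g ω else 0) ∂P = ∫⁻ ω in D, g ω ∂P := fun g => by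
    rw [← lintegral_indicator hD0]; simp only [Set.indicator_apply]
  have e2 : ∀ ω, ∫⁻ x, (if ω ∈ D then ENNReal.ofReal (V x) else 0) ∂(κ ω)
      = if ω ∈ D then ∫⁻ x, ENNReal.ofReal (V x) ∂(κ ω) else 0 := fun ω => by
    split_ifs <;> simp
  simp_rw [e2] at this
  rw [e1, e1] at this
  rw [integral_eq_lintegral_of_nonneg_ae (Filter.Eventually.of_forall fun ω => hV0 _)
    (hV.comp hX).aestronglyMeasurable, this]
  simp_rw [hintV]
  exact integral_toReal (hmeasL.mono hm le_rfl).aemeasurable (Filter.Eventually.of_forall hfin)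

/-- One step of the exponential supermartingale for bounded martingale differences: the exponential
is dominated by its chord on `[-B, B]`, the linear part integrates to `0`, and
`cosh x ≤ exp (x² / 2)`. -/
theorem integral_mul_exp_le {Ω : Type*} {m m0 : MeasurableSpace Ω} (hm : m ≤ m0)
    (P : Measure Ω) [IsProbabilityMeasure P] {W z η : Ω → ℝ} {C Z B : ℝ}
    (hW : Measurable[m] W) (hW0 : ∀ ω, 0 ≤ W ω) (hWC : ∀ᵐ ω ∂P, W ω ≤ C)
    (hz : Measurable[m] z) (hzZ : ∀ ω, |z ω| ≤ Z) (hη : AEStronglyMeasurable η P)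
    (hB : 0 < B) (hηB : ∀ᵐ ω ∂P, |η ω| ≤ B) (hη0 : P[η | m] =ᵐ[P] 0) :
    ∫ ω, W ω * Real.exp (z ω * η ω - (z ω * B) ^ 2 / 2) ∂P ≤ ∫ ω, W ω ∂P := by
  set Y : Ω → ℝ := fun ω => W ω * Real.exp (-((z ω * B) ^ 2 / 2)) * (Real.sinh (z ω * B) / B) with hY
  have hYm : Measurable[m] Y := by
    refine (hW.mul (Real.measurable_exp.comp ?_)).mul ((Real.measurable_sinh.comp ?_).div_const B)
    · exact (((hz.mul_const B).pow_const 2).div_const 2).neg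
    · exact hz.mul_const B
  have hηi : Integrable η P := Integrable.of_bound hη B hηB
  have hWi : Integrable W P := Integrable.of_bound (hW.mono hm le_rfl).aestronglyMeasurable C
    (hWC.mono fun ω hω => by rwa [Real.norm_eq_abs, abs_of_nonneg (hW0 ω)])
  have hYb : ∀ᵐ ω ∂P, |Y ω| ≤ C * 1 * (Real.sinh (Z * B) / B) := by
    filter_upwards [hWC] with ω hω
    have hC : 0 ≤ C := (hW0 ω).trans hω
    have hZ : 0 ≤ Z := (abs_nonneg _).trans (hzZ ω)
    rw [hY]
    simp only [abs_mul, abs_of_nonneg (hW0 ω), Real.abs_exp, abs_div, abs_of_pos hB, Real.abs_sinh]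
    have hs : Real.sinh (|z ω| * B) ≤ Real.sinh (Z * B) :=
      Real.sinh_le_sinh.2 (by gcongr; exact hzZ ω)
    have hs0 : 0 ≤ Real.sinh (|z ω| * B) := Real.sinh_nonneg_iff.2 (by positivity)
    have he : Real.exp (-((z ω * B) ^ 2 / 2)) ≤ 1 := Real.exp_le_one_iff.2 (by
      have := sq_nonneg (z ω * B); linarith)
    gcongr
  have hYηi : Integrable (Y * η) P := by
    exact hηi.bdd_mul (hYm.mono hm le_rfl).aestronglyMeasurable hYb
  have h0 : ∫ ω, Y ω * η ω ∂P = 0 := by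
    have h1 : P[Y * η | m] =ᵐ[P] 0 := by
      filter_upwards [condExp_mul_of_stronglyMeasurable_left hYm.stronglyMeasurable hYηi hηi, hη0]
        with ω h1 h2
      rw [h1]; simp [h2]
    have h2 := integral_condExp hm (f := Y * η) (μ := P)
    rw [integral_congr_ae h1] at h2
    simpa using h2.symm
  have hpt : ∀ᵐ ω ∂P, W ω * Real.exp (z ω * η ω - (z ω * B) ^ 2 / 2) ≤ W ω + Y ω * η ω := by
    filter_upwards [hηB] with ω hω
    obtain ⟨hl, hu⟩ := abs_le.1 hω
    have hchord : Real.exp (z ω * η ω) ≤ Real.cosh (z ω * B) + η ω / B * Real.sinh (z ω * B) := by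
      have hl' : -1 ≤ η ω / B := by rw [le_div_iff₀ hB]; linarith
      have hu' : η ω / B ≤ 1 := by rw [div_le_iff₀ hB]; linarith
      have hc := convexOn_exp.2 (Set.mem_univ (z ω * B)) (Set.mem_univ (-(z ω * B)))
        (show 0 ≤ (1 + η ω / B) / 2 by linarith) (show 0 ≤ (1 - η ω / B) / 2 by linarith) (by ring)
      simp only [smul_eq_mul] at hc
      rw [Real.cosh_eq, Real.sinh_eq]
      have e : (1 + η ω / B) / 2 * (z ω * B) + (1 - η ω / B) / 2 * -(z ω * B) = z ω * η ω := by
        field_simp; ring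
      rw [e] at hc
      linarith
    have hcosh := Real.cosh_le_exp_half_sq (z ω * B)
    have hE : 0 < Real.exp (-((z ω * B) ^ 2 / 2)) := Real.exp_pos _
    have hEE : Real.exp (-((z ω * B) ^ 2 / 2)) * Real.exp ((z ω * B) ^ 2 / 2) = 1 := by
      rw [← Real.exp_add]; simp
    have : Real.exp (z ω * η ω - (z ω * B) ^ 2 / 2)
        ≤ 1 + Real.exp (-((z ω * B) ^ 2 / 2)) * (Real.sinh (z ω * B) / B) * η ω := by
      rw [sub_eq_add_neg, Real.exp_add, mul_comm]
      calc _ ≤ Real.exp (-((z ω * B) ^ 2 / 2)) *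
            (Real.exp ((z ω * B) ^ 2 / 2) + η ω / B * Real.sinh (z ω * B)) := by
              gcongr; linarith
        _ = _ := by rw [mul_add, hEE]; ring
    calc _ ≤ W ω * (1 + Real.exp (-((z ω * B) ^ 2 / 2)) * (Real.sinh (z ω * B) / B) * η ω) := by
          gcongr; exact hW0 ω
      _ = _ := by simp only [hY]; ring
  calc ∫ ω, W ω * Real.exp (z ω * η ω - (z ω * B) ^ 2 / 2) ∂P ≤ ∫ ω, (W ω + Y ω * η ω) ∂P := by
        refine integral_mono_of_nonneg (Filter.Eventually.of_forall fun ω => ?_)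
          (hWi.add hYηi) hpt
        exact mul_nonneg (hW0 ω) (Real.exp_pos _).le
    _ = ∫ ω, W ω ∂P := by
        have := integral_add hWi hYηi
        simp only [Pi.mul_apply] at this
        rw [this, h0, add_zero]

/-- Markov's inequality for the exponential of a real function. -/
theorem measure_exp_ge_le {Ω : Type*} [MeasurableSpace Ω] (P : Measure Ω) [IsProbabilityMeasure P]
    {X : Ω → ℝ} (hi : Integrable (fun ω => Real.exp (X ω)) P)
    (h1 : ∫ ω, Real.exp (X ω) ∂P ≤ 1) (ℓ : ℝ) :
    P {ω | ℓ ≤ X ω} ≤ ENNReal.ofReal (Real.exp (-ℓ)) := by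
  have h2 := mul_meas_ge_le_lintegral₀ (μ := P) (f := fun ω => ENNReal.ofReal (Real.exp (X ω)))
    hi.aestronglyMeasurable.aemeasurable.ennreal_ofReal (ENNReal.ofReal (Real.exp ℓ))
  rw [← ofReal_integral_eq_lintegral_ofReal hi (Filter.Eventually.of_forall fun ω =>
    (Real.exp_pos _).le)] at h2
  have h3 := h2.trans (ENNReal.ofReal_le_ofReal h1)
  have e : {ω | ENNReal.ofReal (Real.exp ℓ) ≤ ENNReal.ofReal (Real.exp (X ω))} = {ω | ℓ ≤ X ω} := by
    ext ω
    simp [ENNReal.ofReal_le_ofReal_iff (Real.exp_pos _).le]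
  rw [e] at h3
  rw [Real.exp_neg, ENNReal.ofReal_inv_of_pos (Real.exp_pos _)]
  rw [ENNReal.ofReal_one] at h3
  rw [← one_div]
  rw [ENNReal.le_div_iff_mul_le (Or.inl (by simp [Real.exp_pos])) (Or.inl ENNReal.ofReal_ne_top), mul_comm]
  exact h3

/-- A union bound over the cells of a grid: parameters `θ` are encoded by real vectors `e θ`; outside
a small exceptional set every valid parameter shares its grid cell with a valid parameter for which
the bad event does not happen. -/
theorem exists_grid_cover {Ω Θ ι : Type*} [Fintype ι] [DecidableEq ι] [MeasurableSpace Ω]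
    (P : Measure Ω) (e : Θ → ι → ℝ) (valid : Set Θ) {T : ℝ} (hT : 0 < T) (N : ℕ)
    (hN : ∀ θ ∈ valid, ∀ i, |e θ i| * T ≤ N) (Bad : Θ → Set Ω) (ε : ENNReal)
    (hBad : ∀ θ ∈ valid, P (Bad θ) ≤ ε) :
    ∃ B : Set Ω, P B ≤ (2 * N + 1 : ENNReal) ^ Fintype.card ι * ε ∧
      ∀ ω ∉ B, ∀ θ ∈ valid, ∃ θ' ∈ valid, (∀ i, |e θ i - e θ' i| ≤ 1 / T) ∧ ω ∉ Bad θ' := by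
  classical
  let cell : Θ → ι → ℤ := fun θ i => ⌊e θ i * T⌋
  let G : Finset (ι → ℤ) := Fintype.piFinset fun _ => Finset.Icc (-(N : ℤ)) N
  have hG : ∀ θ ∈ valid, cell θ ∈ G := by
    intro θ hθ
    rw [Fintype.mem_piFinset]
    intro i
    obtain ⟨h1, h2⟩ := abs_le.1 (show |e θ i * T| ≤ N by
      rw [abs_mul, abs_of_pos hT]; exact hN θ hθ i)
    rw [Finset.mem_Icc]
    constructor
    · exact Int.le_floor.2 (by push_cast; exact h1)
    · have := (Int.floor_le (e θ i * T)).trans h2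
      exact_mod_cast this
  have hcard : G.card = (2 * N + 1) ^ Fintype.card ι := by
    rw [Fintype.card_piFinset]
    simp only [Int.card_Icc, Finset.prod_const, Finset.card_univ]
    congr 1
    omega
  let S : (ι → ℤ) → Set Ω := fun c =>
    if h : ∃ θ ∈ valid, cell θ = c then Bad h.choose else ∅
  refine ⟨⋃ c ∈ G, S c, ?_, ?_⟩
  · calc P (⋃ c ∈ G, S c) ≤ ∑ c ∈ G, P (S c) := measure_biUnion_finset_le _ _
      _ ≤ ∑ _c ∈ G, ε := by
          refine Finset.sum_le_sum fun c _ => ?_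
          by_cases h : ∃ θ ∈ valid, cell θ = c
          · simp only [S, dif_pos h]; exact hBad _ h.choose_spec.1
          · simp only [S, dif_neg h]; simp
      _ = _ := by rw [Finset.sum_const, hcard, nsmul_eq_mul]; push_cast; rfl
  · intro ω hω θ hθ
    have h : ∃ θ' ∈ valid, cell θ' = cell θ := ⟨θ, hθ, rfl⟩
    refine ⟨h.choose, h.choose_spec.1, fun i => ?_, fun hb => ?_⟩
    · have hc : ⌊e h.choose i * T⌋ = ⌊e θ i * T⌋ := congrFun h.choose_spec.2 i
      have := Int.abs_sub_lt_one_of_floor_eq_floor hc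
      rw [← sub_mul, abs_mul, abs_of_pos hT] at this
      rw [le_div_iff₀ hT, abs_sub_comm]
      exact this.le
    · refine hω (Set.mem_iUnion₂.2 ⟨cell θ, hG θ hθ, ?_⟩)
      simp only [S, dif_pos h]; exact hb

/-! ### Regularized Gram matrices and least eigenvalues -/

section LinearAlgebra

variable {d : ℕ}

theorem inner_eq_dotProduct_ofLp (x y : EuclideanSpace ℝ (Fin d)) :
    inner ℝ x y = x.ofLp ⬝ᵥ y.ofLp := by
  rw [EuclideanSpace.inner_eq_star_dotProduct, dotProduct_comm]; simp

theorem norm_sq_eq_dotProduct_ofLp (x : EuclideanSpace ℝ (Fin d)) :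
    ‖x‖ ^ 2 = x.ofLp ⬝ᵥ x.ofLp := by
  rw [← inner_eq_dotProduct_ofLp, real_inner_self_eq_norm_sq]

/-- The regularized Gram matrix `∑_{t ∈ T} v_t v_tᵀ + I`. -/
noncomputable def ridge (T : Finset ℕ) (v : ℕ → EuclideanSpace ℝ (Fin d)) : Matrix (Fin d) (Fin d) ℝ :=
  ∑ t ∈ T, Matrix.vecMulVec (v t).ofLp (v t).ofLp + (1 : ℝ) • (1 : Matrix (Fin d) (Fin d) ℝ)

theorem ridge_mulVec (T : Finset ℕ) (v : ℕ → EuclideanSpace ℝ (Fin d)) (x : Fin d → ℝ) :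
    (ridge T v).mulVec x = ∑ t ∈ T, ((v t).ofLp ⬝ᵥ x) • (v t).ofLp + x := by
  rw [ridge, Matrix.add_mulVec, Matrix.sum_mulVec, one_smul, Matrix.one_mulVec]
  congr 1
  refine Finset.sum_congr rfl fun t _ => ?_
  rw [Matrix.vecMulVec_mulVec]
  ext i; simp [mul_comm]

theorem dotProduct_ridge_mulVec (T : Finset ℕ) (v : ℕ → EuclideanSpace ℝ (Fin d))
    (y x : Fin d → ℝ) :
    y ⬝ᵥ (ridge T v).mulVec x
      = ∑ t ∈ T, ((v t).ofLp ⬝ᵥ y) * ((v t).ofLp ⬝ᵥ x) + y ⬝ᵥ x := by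
  rw [ridge_mulVec, dotProduct_add, dotProduct_sum]
  congr 1
  refine Finset.sum_congr rfl fun t _ => ?_
  rw [dotProduct_smul, smul_eq_mul, dotProduct_comm y, mul_comm]

theorem isUnit_det_ridge (T : Finset ℕ) (v : ℕ → EuclideanSpace ℝ (Fin d)) :
    IsUnit (ridge T v).det := by
  rw [← Matrix.isUnit_iff_isUnit_det, ← Matrix.mulVec_injective_iff_isUnit]
  have h0 : ∀ x : Fin d → ℝ, (ridge T v).mulVec x = 0 → x = 0 := by
    intro x hx
    have h := dotProduct_ridge_mulVec T v x x
    rw [hx, dotProduct_zero] at h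
    have h1 : 0 ≤ ∑ t ∈ T, ((v t).ofLp ⬝ᵥ x) * ((v t).ofLp ⬝ᵥ x) :=
      Finset.sum_nonneg fun t _ => mul_self_nonneg _
    have h2 : 0 ≤ x ⬝ᵥ x := Finset.sum_nonneg fun i _ => mul_self_nonneg _
    exact dotProduct_self_eq_zero.1 (by linarith)
  intro x y hxy
  have := h0 (x - y) (by rw [Matrix.mulVec_sub]; exact sub_eq_zero.2 hxy)
  exact sub_eq_zero.1 this

/-- The solution `u` of `(∑_{t ∈ T} v_t v_tᵀ + I) u = x`. -/
noncomputable def ridgeSol (T : Finset ℕ) (v : ℕ → EuclideanSpace ℝ (Fin d)) (x : EuclideanSpace ℝ (Fin d)) :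
    EuclideanSpace ℝ (Fin d) :=
  WithLp.toLp 2 ((ridge T v)⁻¹.mulVec x.ofLp)

theorem ridge_mulVec_ridgeSol (T : Finset ℕ) (v : ℕ → EuclideanSpace ℝ (Fin d))
    (x : EuclideanSpace ℝ (Fin d)) : (ridge T v).mulVec (ridgeSol T v x).ofLp = x.ofLp := by
  simp only [ridgeSol]
  rw [Matrix.mulVec_mulVec, Matrix.mul_nonsing_inv _ (isUnit_det_ridge T v), Matrix.one_mulVec]

theorem inner_eq_sum_ridgeSol (T : Finset ℕ) (v : ℕ → EuclideanSpace ℝ (Fin d))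
    (x y : EuclideanSpace ℝ (Fin d)) :
    inner ℝ y x = ∑ t ∈ T, inner ℝ (v t) y * inner ℝ (v t) (ridgeSol T v x)
      + inner ℝ y (ridgeSol T v x) := by
  simp only [inner_eq_dotProduct_ofLp]
  rw [← dotProduct_ridge_mulVec, ridge_mulVec_ridgeSol]

theorem dotProduct_ridge_inv_mulVec (T : Finset ℕ) (v : ℕ → EuclideanSpace ℝ (Fin d))
    (x : EuclideanSpace ℝ (Fin d)) (z : Fin d → ℝ) :
    x.ofLp ⬝ᵥ (ridge T v)⁻¹.mulVec z = (ridgeSol T v x).ofLp ⬝ᵥ z := by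
  have h1 := inner_eq_sum_ridgeSol T v x (ridgeSol T v (WithLp.toLp 2 z))
  have h2 := inner_eq_sum_ridgeSol T v (WithLp.toLp 2 z) (ridgeSol T v x)
  simp only [inner_eq_dotProduct_ofLp] at h1 h2
  have h3 : x.ofLp ⬝ᵥ (ridge T v)⁻¹.mulVec z
      = (ridgeSol T v (WithLp.toLp 2 z)).ofLp ⬝ᵥ x.ofLp := by
    rw [dotProduct_comm]; rfl
  rw [h3, h1]
  change _ = (ridgeSol T v x).ofLp ⬝ᵥ (WithLp.toLp 2 z).ofLp
  rw [h2, dotProduct_comm (ridgeSol T v x).ofLp]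
  congr 1
  exact Finset.sum_congr rfl fun t _ => mul_comm _ _

theorem dotProduct_ridge_inv_mulVec_self (T : Finset ℕ) (v : ℕ → EuclideanSpace ℝ (Fin d))
    (x : EuclideanSpace ℝ (Fin d)) :
    x.ofLp ⬝ᵥ (ridge T v)⁻¹.mulVec x.ofLp
      = ∑ t ∈ T, inner ℝ (v t) (ridgeSol T v x) ^ 2 + ‖ridgeSol T v x‖ ^ 2 := by
  have h := inner_eq_sum_ridgeSol T v x (ridgeSol T v x)
  rw [dotProduct_ridge_inv_mulVec, ← inner_eq_dotProduct_ofLp, h, real_inner_self_eq_norm_sq]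
  simp only [sq]

theorem norm_ridgeSol_le (T : Finset ℕ) (v : ℕ → EuclideanSpace ℝ (Fin d))
    (x : EuclideanSpace ℝ (Fin d)) : ‖ridgeSol T v x‖ ≤ ‖x‖ := by
  have h := dotProduct_ridge_inv_mulVec_self T v x
  rw [dotProduct_ridge_inv_mulVec, ← inner_eq_dotProduct_ofLp] at h
  have h1 : 0 ≤ ∑ t ∈ T, inner ℝ (v t) (ridgeSol T v x) ^ 2 :=
    Finset.sum_nonneg fun t _ => sq_nonneg _
  have h2 := real_inner_le_norm (ridgeSol T v x) x
  by_contra! hc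
  have h3 : 0 < ‖ridgeSol T v x‖ := lt_of_le_of_lt (norm_nonneg _) hc
  nlinarith

theorem abs_ridge_inv_apply_le (T : Finset ℕ) (v : ℕ → EuclideanSpace ℝ (Fin d)) (i j : Fin d) :
    |(ridge T v)⁻¹ i j| ≤ 1 := by
  have h1 : (ridge T v)⁻¹ i j = (ridgeSol T v (EuclideanSpace.single j (1 : ℝ))).ofLp i := by
    simp [ridgeSol, Matrix.mulVec_single]
  rw [h1]
  have h2 := PiLp.norm_apply_le (ridgeSol T v (EuclideanSpace.single j (1 : ℝ))) i
  refine h2.trans ((norm_ridgeSol_le T v _).trans ?_)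
  simp

theorem abs_ridge_inv_mulVec_sum_le (T : Finset ℕ) (v : ℕ → EuclideanSpace ℝ (Fin d)) (c : ℕ → ℝ)
    {B : ℝ} (hv : ∀ t ∈ T, ‖v t‖ ≤ 1) (hc : ∀ t ∈ T, |c t| ≤ B) (i : Fin d) :
    |((ridge T v)⁻¹.mulVec (∑ t ∈ T, c t • (v t).ofLp)) i| ≤ T.card * B := by
  have h1 : ((ridge T v)⁻¹.mulVec (∑ t ∈ T, c t • (v t).ofLp))
      = (ridgeSol T v (∑ t ∈ T, c t • v t)).ofLp := by
    rw [ridgeSol]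
    simp
  rw [h1]
  refine (PiLp.norm_apply_le (ridgeSol T v _) i).trans ((norm_ridgeSol_le T v _).trans ?_)
  refine (norm_sum_le _ _).trans ?_
  rw [← nsmul_eq_mul]
  refine Finset.sum_le_card_nsmul _ _ _ fun t ht => ?_
  rw [norm_smul]
  calc _ ≤ B * 1 := mul_le_mul (hc t ht) (hv t ht) (norm_nonneg _) ((abs_nonneg _).trans (hc t ht))
    _ = B := mul_one B

theorem abs_coord_le_one {x : EuclideanSpace ℝ (Fin d)} (hx : ‖x‖ ≤ 1) (i : Fin d) :
    |x.ofLp i| ≤ 1 := (PiLp.norm_apply_le x i).trans hx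

theorem norm_le_of_coord_le {x : EuclideanSpace ℝ (Fin d)} {ε : ℝ} (h : ∀ i, |x.ofLp i| ≤ ε) :
    ‖x‖ ≤ d * ε := by
  have hx : x = ∑ i, EuclideanSpace.single i (x.ofLp i) := by
    ext j; simp [Pi.single_apply]
  rw [hx]
  refine (norm_sum_le _ _).trans ?_
  calc _ ≤ ∑ _i : Fin d, ε := Finset.sum_le_sum fun i _ => by simpa using h i
    _ = _ := by simp

theorem abs_dotProduct_sub_le {x : EuclideanSpace ℝ (Fin d)} (hx : ‖x‖ ≤ 1) {w w' : Fin d → ℝ}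
    {ε : ℝ} (h : ∀ i, |w i - w' i| ≤ ε) : |x.ofLp ⬝ᵥ w - x.ofLp ⬝ᵥ w'| ≤ d * ε := by
  rw [← dotProduct_sub]
  refine (Finset.abs_sum_le_sum_abs _ _).trans ?_
  calc _ ≤ ∑ _i : Fin d, ε := Finset.sum_le_sum fun i _ => by
        rw [abs_mul]
        calc _ ≤ 1 * ε := mul_le_mul (abs_coord_le_one hx i) (h i) (abs_nonneg _) zero_le_one
          _ = ε := one_mul ε
    _ = _ := by simp

theorem abs_quadratic_sub_le {x : EuclideanSpace ℝ (Fin d)} (hx : ‖x‖ ≤ 1)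
    {L L' : Matrix (Fin d) (Fin d) ℝ} {ε : ℝ} (h : ∀ i j, |L i j - L' i j| ≤ ε) :
    |x.ofLp ⬝ᵥ L.mulVec x.ofLp - x.ofLp ⬝ᵥ L'.mulVec x.ofLp| ≤ d * (d * ε) := by
  refine abs_dotProduct_sub_le hx fun i => ?_
  have h1 := abs_dotProduct_sub_le hx (w := L i) (w' := L' i) (h i)
  simp only [Matrix.mulVec]
  rwa [dotProduct_comm (L i), dotProduct_comm (L' i)]

theorem abs_sqrt_sub_sqrt_le (a b : ℝ) : |Real.sqrt a - Real.sqrt b| ≤ Real.sqrt |a - b| := by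
  wlog hab : b ≤ a generalizing a b
  · rw [abs_sub_comm, abs_sub_comm a]; exact this b a (le_of_not_ge hab)
  rw [abs_of_nonneg (sub_nonneg.2 (Real.sqrt_le_sqrt hab)), abs_of_nonneg (sub_nonneg.2 hab)]
  rcases le_total b 0 with hb | hb
  · rw [Real.sqrt_eq_zero_of_nonpos hb, sub_zero]
    exact Real.sqrt_le_sqrt (by linarith)
  · rw [sub_le_iff_le_add]
    refine Real.sqrt_le_iff.2 ⟨by positivity, ?_⟩
    have h1 := Real.sq_sqrt (sub_nonneg.2 hab)
    have h2 := Real.sq_sqrt hb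
    have := mul_nonneg (Real.sqrt_nonneg (a - b)) (Real.sqrt_nonneg b)
    nlinarith

/-- Above the kernel of a positive semidefinite matrix its quadratic form is bounded below by the
smallest positive eigenvalue. -/
theorem exists_minPosEigenvalue_mul_le {S : Matrix (Fin d) (Fin d) ℝ} (hS : S.IsHermitian)
    (hpos : ∀ x : Fin d → ℝ, 0 ≤ x ⬝ᵥ S.mulVec x) (u : EuclideanSpace ℝ (Fin d)) :
    ∃ w : EuclideanSpace ℝ (Fin d), S.mulVec (u - w).ofLp = 0 ∧
      minPosEigenvalue S * ‖w‖ ^ 2 ≤ w.ofLp ⬝ᵥ S.mulVec w.ofLp := by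
  classical
  set b := hS.eigenvectorBasis
  set ev := hS.eigenvalues
  have hb : ∀ i, S.mulVec (b i).ofLp = ev i • (b i).ofLp := hS.mulVec_eigenvectorBasis
  have hSsymm : ∀ x y : Fin d → ℝ, x ⬝ᵥ S.mulVec y = y ⬝ᵥ S.mulVec x := fun x y => by
    have hT : S.transpose = S := by simpa [Matrix.IsHermitian] using hS
    rw [Matrix.dotProduct_mulVec, ← Matrix.mulVec_transpose, hT, dotProduct_comm]
  have hn : ∀ i, (b i).ofLp ⬝ᵥ (b i).ofLp = 1 := fun i => by
    rw [← norm_sq_eq_dotProduct_ofLp, b.orthonormal.1 i]; norm_num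
  have hev0 : ∀ i, 0 ≤ ev i := fun i => by
    have h := hpos (b i).ofLp
    rw [hb, dotProduct_smul, hn] at h; simpa using h
  have hmin : ∀ i, ev i ≠ 0 → minPosEigenvalue S ≤ ev i := fun i hi => by
    refine csInf_le ⟨0, fun x hx => hx.1.le⟩ ⟨lt_of_le_of_ne (hev0 i) (Ne.symm hi), ?_⟩
    refine Module.End.hasEigenvalue_of_hasEigenvector (x := (b i).ofLp) ⟨?_, ?_⟩
    · rw [Module.End.mem_eigenspace_iff, Matrix.toLin'_apply, hb]
    · intro h0
      have := hn i
      rw [h0] at this; simp at this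
  let w : EuclideanSpace ℝ (Fin d) := ∑ i, (if ev i = 0 then 0 else inner ℝ (b i) u) • b i
  have hw : ∀ i, inner ℝ (b i) w = if ev i = 0 then 0 else inner ℝ (b i) u := fun i => by
    simp only [w]
    rw [b.orthonormal.inner_right_fintype]
  have hSw : ∀ x : EuclideanSpace ℝ (Fin d), ∀ i,
      inner ℝ (b i) (WithLp.toLp 2 (S.mulVec x.ofLp)) = ev i * inner ℝ (b i) x := fun x i => by
    rw [inner_eq_dotProduct_ofLp, inner_eq_dotProduct_ofLp]
    simp only
    rw [hSsymm, hb, dotProduct_smul, dotProduct_comm, smul_eq_mul]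
  refine ⟨w, ?_, ?_⟩
  · have h0 : (WithLp.toLp 2 (S.mulVec (u - w).ofLp) : EuclideanSpace ℝ (Fin d)) = 0 := by
      refine InnerProductSpace.ext_inner_left_basis b.toBasis fun i => ?_
      rw [b.coe_toBasis, hSw, inner_sub_right, hw, inner_zero_right]
      split_ifs with h <;> simp [h]
    simpa using congrArg WithLp.ofLp h0
  · have h1 : w.ofLp ⬝ᵥ S.mulVec w.ofLp = ∑ i, ev i * inner ℝ (b i) w ^ 2 := by
      have := b.sum_inner_mul_inner w (WithLp.toLp 2 (S.mulVec w.ofLp))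
      rw [inner_eq_dotProduct_ofLp] at this
      simp only at this
      rw [← this]
      refine Finset.sum_congr rfl fun i _ => ?_
      rw [hSw, real_inner_comm w (b i)]
      ring
    have h2 : ‖w‖ ^ 2 = ∑ i, inner ℝ (b i) w ^ 2 := by
      have := b.sum_inner_mul_inner w w
      rw [real_inner_self_eq_norm_sq] at this
      rw [← this]
      refine Finset.sum_congr rfl fun i _ => ?_
      rw [real_inner_comm w (b i)]; ring
    rw [h1, h2, Finset.mul_sum]
    refine Finset.sum_le_sum fun i _ => ?_
    by_cases h : ev i = 0
    · rw [hw]; simp [h]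
    · exact mul_le_mul_of_nonneg_right (hmin i h) (sq_nonneg _)

theorem minPosEigenvalue_pos_of_ne_zero {S : Matrix (Fin d) (Fin d) ℝ} (hS : S.IsHermitian)
    (hpos : ∀ x : Fin d → ℝ, 0 ≤ x ⬝ᵥ S.mulVec x) (hS0 : S ≠ 0) :
    0 < minPosEigenvalue S ∧
      ∃ x : EuclideanSpace ℝ (Fin d), ‖x‖ = 1 ∧ x.ofLp ⬝ᵥ S.mulVec x.ofLp = minPosEigenvalue S := by
  classical
  set b := hS.eigenvectorBasis
  set ev := hS.eigenvalues
  have hb : ∀ i, S.mulVec (b i).ofLp = ev i • (b i).ofLp := hS.mulVec_eigenvectorBasis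
  have hn : ∀ i, (b i).ofLp ⬝ᵥ (b i).ofLp = 1 := fun i => by
    rw [← norm_sq_eq_dotProduct_ofLp, b.orthonormal.1 i]; norm_num
  have hev0 : ∀ i, 0 ≤ ev i := fun i => by
    have h := hpos (b i).ofLp
    rw [hb, dotProduct_smul, hn] at h; simpa using h
  obtain ⟨i, hi⟩ : ∃ i, ev i ≠ 0 := by
    by_contra! h
    exact hS0 (hS.eigenvalues_eq_zero_iff.1 (funext h))
  have hfin : {x : ℝ | 0 < x ∧ Module.End.HasEigenvalue (Matrix.toLin' S) x}.Finite :=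
    (Module.End.finite_hasEigenvalue (Matrix.toLin' S)).subset fun x hx => hx.2
  have hne : {x : ℝ | 0 < x ∧ Module.End.HasEigenvalue (Matrix.toLin' S) x}.Nonempty := by
    refine ⟨ev i, lt_of_le_of_ne (hev0 i) (Ne.symm hi), ?_⟩
    refine Module.End.hasEigenvalue_of_hasEigenvector (x := (b i).ofLp) ⟨?_, ?_⟩
    · rw [Module.End.mem_eigenspace_iff, Matrix.toLin'_apply, hb]
    · intro h0
      have := hn i
      rw [h0] at this; simp at this
  have hmem := hne.csInf_mem hfin
  refine ⟨hmem.1, ?_⟩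
  obtain ⟨y, hy⟩ := hmem.2.exists_hasEigenvector
  have hy1 := hy.apply_eq_smul
  rw [Matrix.toLin'_apply] at hy1
  set yE : EuclideanSpace ℝ (Fin d) := WithLp.toLp 2 y
  have hyE : yE ≠ 0 := fun h => hy.2 (by simpa [yE] using congrArg WithLp.ofLp h)
  have hny : ‖yE‖ ≠ 0 := norm_ne_zero_iff.2 hyE
  refine ⟨‖yE‖⁻¹ • yE, ?_, ?_⟩
  · rw [norm_smul, norm_inv, norm_norm, inv_mul_cancel₀ hny]
  · have e : (‖yE‖⁻¹ • yE).ofLp = ‖yE‖⁻¹ • y := rfl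
    rw [e, Matrix.mulVec_smul, hy1, smul_dotProduct, dotProduct_smul, dotProduct_smul]
    have h2 : y ⬝ᵥ y = ‖yE‖ ^ 2 := (norm_sq_eq_dotProduct_ofLp yE).symm
    rw [h2, minPosEigenvalue]
    simp only [smul_eq_mul]
    field_simp

end LinearAlgebra

/-! ### Measurability and bounds for values -/

section Values

variable {S A : Type*} [MeasurableSpace S] [MeasurableSpace A] {ρ : Measure S}

theorem measurableSet_singleton_of_measurableEq {A : Type*} [MeasurableSpace A] [MeasurableEq A]
    (a : A) : MeasurableSet ({a} : Set A) :=
  measurableSet_eq_fun (f := fun x : A => x) (g := fun _ => a) measurable_id measurable_const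

namespace DecisionRule

theorem measurable_toMeasure (π : DecisionRule S A) :
    Measurable fun s => (π.act s).toMeasure :=
  Measure.measurable_of_measurable_coe _ π.meas

/-- A decision rule as a Markov kernel. -/
noncomputable def kernel (π : DecisionRule S A) : ProbabilityTheory.Kernel S A :=
  ⟨fun s => (π.act s).toMeasure, π.measurable_toMeasure⟩

instance (π : DecisionRule S A) : ProbabilityTheory.IsMarkovKernel π.kernel :=
  ⟨fun s => inferInstanceAs (IsProbabilityMeasure (π.act s).toMeasure)⟩

theorem measurable_avg (π : DecisionRule S A) {f : S → A → ℝ}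
    (hf : Measurable fun x : S × A => f x.1 x.2) : Measurable (π.avg f) :=
  (StronglyMeasurable.integral_kernel_prod_right' (κ := π.kernel) hf.stronglyMeasurable).measurable

theorem integrable_act (π : DecisionRule S A) {f : S → A → ℝ} {C : ℝ} (s : S)
    (hf : Measurable (f s)) (h0 : ∀ a, 0 ≤ f s a) (hC : ∀ a, f s a ≤ C) :
    Integrable (f s) (π.act s).toMeasure :=
  Integrable.of_bound hf.aestronglyMeasurable C (Filter.Eventually.of_forall fun a => by
    rw [Real.norm_eq_abs, abs_of_nonneg (h0 a)]; exact hC a)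

theorem avg_nonneg (π : DecisionRule S A) {f : S → A → ℝ} (s : S) (h0 : ∀ a, 0 ≤ f s a) :
    0 ≤ π.avg f s := integral_nonneg h0

theorem avg_mono (π : DecisionRule S A) {f g : S → A → ℝ} {C : ℝ} (s : S)
    (hg : Measurable (g s)) (h0 : ∀ a, 0 ≤ f s a) (hfg : ∀ a, f s a ≤ g s a)
    (hC : ∀ a, g s a ≤ C) : π.avg f s ≤ π.avg g s :=
  integral_mono_of_nonneg (Filter.Eventually.of_forall h0)
    (π.integrable_act s hg (fun a => (h0 a).trans (hfg a)) hC) (Filter.Eventually.of_forall hfg)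

theorem avg_le (π : DecisionRule S A) {f : S → A → ℝ} {C : ℝ} (s : S)
    (h0 : ∀ a, 0 ≤ f s a) (hC : ∀ a, f s a ≤ C) : π.avg f s ≤ C := by
  have := π.avg_mono (f := f) (g := fun _ _ => C) (C := C) s measurable_const h0 hC
    (fun _ => le_rfl)
  simpa [avg] using this

/-- The decision rule `π`, modified to play the action `a` in the state `s₀`. -/
noncomputable def modify [MeasurableSingletonClass S] (π : DecisionRule S A) (s₀ : S) (a : A) :
    DecisionRule S A := by
  classical
  exact
  { act := fun s => if s = s₀ then PMF.pure a else π.act s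
    meas := fun B hB => by
      have : (fun s => (if s = s₀ then PMF.pure a else π.act s).toMeasure B)
          = fun s => if s ∈ ({s₀} : Set S) then (PMF.pure a).toMeasure B
            else (π.act s).toMeasure B := by
        ext s; by_cases h : s = s₀ <;> simp [h]
      rw [this]
      exact Measurable.ite (measurableSet_singleton s₀) measurable_const (π.meas B hB) }

theorem modify_act_self [MeasurableSingletonClass S] (π : DecisionRule S A) (s₀ : S) (a : A) :
    (π.modify s₀ a).act s₀ = PMF.pure a := by simp [modify]

theorem modify_act_of_ne [MeasurableSingletonClass S] (π : DecisionRule S A) {s₀ s : S} (a : A)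
    (h : s ≠ s₀) : (π.modify s₀ a).act s = π.act s := by simp [modify, h]

theorem avg_of_act_eq_pure [MeasurableEq A] {π : DecisionRule S A} {s : S} {a : A}
    (h : π.act s = PMF.pure a) (f : S → A → ℝ) : π.avg f s = f s a := by
  have : MeasurableSingletonClass A := ⟨measurableSet_singleton_of_measurableEq⟩
  rw [avg, h, PMF.toMeasure_pure, integral_dirac]

end DecisionRule

namespace MDP

variable (M : MDP S A ρ)

theorem isProbabilityMeasure_initMeasure : IsProbabilityMeasure M.initMeasure :=
  ⟨by rw [initMeasure, withDensity_apply _ MeasurableSet.univ, Measure.restrict_univ]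
      exact M.init_mass⟩

theorem isProbabilityMeasure_transMeasure {h : ℕ} (hh : h ∈ Finset.Icc 1 M.H) (s : S) (a : A) :
    IsProbabilityMeasure (M.transMeasure h s a) :=
  ⟨by rw [transMeasure, withDensity_apply _ MeasurableSet.univ, Measure.restrict_univ]
      exact M.dens_mass h hh s a⟩

theorem measurable_transMeasure [SFinite ρ] {h : ℕ} (hh : h ∈ Finset.Icc 1 M.H) :
    Measurable fun x : S × A => M.transMeasure h x.1 x.2 := by
  refine Measure.measurable_of_measurable_coe _ fun B hB => ?_
  have : (fun x : S × A => M.transMeasure h x.1 x.2 B)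
      = fun x => ∫⁻ s' in B, ENNReal.ofReal (M.dens h x.1 x.2 s') ∂ρ := by
    ext x; rw [transMeasure, withDensity_apply _ hB]
  rw [this]
  exact Measurable.lintegral_prod_right' (ν := ρ.restrict B) (M.dens_meas h hh).ennreal_ofReal

/-- The transition kernel of the step `h`. -/
noncomputable def transKernel [SFinite ρ] {h : ℕ} (hh : h ∈ Finset.Icc 1 M.H) :
    ProbabilityTheory.Kernel (S × A) S :=
  ⟨fun x => M.transMeasure h x.1 x.2, M.measurable_transMeasure hh⟩

instance [SFinite ρ] {h : ℕ} (hh : h ∈ Finset.Icc 1 M.H) :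
    ProbabilityTheory.IsMarkovKernel (M.transKernel hh) :=
  ⟨fun x => M.isProbabilityMeasure_transMeasure hh x.1 x.2⟩

theorem measurable_bellman [SFinite ρ] {h : ℕ} (hh : h ∈ Finset.Icc 1 M.H) {V : S → ℝ}
    (hV : Measurable V) : Measurable fun x : S × A => M.bellman h V x.1 x.2 := by
  refine (M.rew_meas h hh).add ?_
  exact (StronglyMeasurable.integral_kernel_prod_right' (κ := M.transKernel hh)
    (f := fun p : (S × A) × S => V p.2) (hV.comp measurable_snd).stronglyMeasurable).measurable

theorem integrable_transMeasure {h : ℕ} (hh : h ∈ Finset.Icc 1 M.H) {V : S → ℝ}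
    (hV : Measurable V) (h0 : ∀ s, 0 ≤ V s) {C : ℝ} (hC : ∀ s, V s ≤ C) (s : S) (a : A) :
    Integrable V (M.transMeasure h s a) := by
  have := M.isProbabilityMeasure_transMeasure hh s a
  exact Integrable.of_bound hV.aestronglyMeasurable C (Filter.Eventually.of_forall fun x => by
    rw [Real.norm_eq_abs, abs_of_nonneg (h0 x)]; exact hC x)

theorem integral_transMeasure_le {h : ℕ} (hh : h ∈ Finset.Icc 1 M.H) {V : S → ℝ}
    (h0 : ∀ s, 0 ≤ V s) {C : ℝ} (hC : ∀ s, V s ≤ C) (s : S) (a : A) :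
    ∫ s', V s' ∂(M.transMeasure h s a) ≤ C := by
  have := M.isProbabilityMeasure_transMeasure hh s a
  refine (integral_mono_of_nonneg (Filter.Eventually.of_forall h0) (integrable_const C)
    (Filter.Eventually.of_forall hC)).trans ?_
  simp

theorem bellman_nonneg {h : ℕ} (hh : h ∈ Finset.Icc 1 M.H) {V : S → ℝ} (h0 : ∀ s, 0 ≤ V s)
    (s : S) (a : A) : 0 ≤ M.bellman h V s a :=
  add_nonneg (M.rew_mem h hh s a).1 (integral_nonneg h0)

theorem bellman_le {h : ℕ} (hh : h ∈ Finset.Icc 1 M.H) {V : S → ℝ} (h0 : ∀ s, 0 ≤ V s)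
    {C : ℝ} (hC : ∀ s, V s ≤ C) (s : S) (a : A) : M.bellman h V s a ≤ 1 + C :=
  add_le_add (M.rew_mem h hh s a).2 (M.integral_transMeasure_le hh h0 hC s a)

theorem bellman_mono {h : ℕ} (hh : h ∈ Finset.Icc 1 M.H) {V W : S → ℝ} (hW : Measurable W)
    (h0 : ∀ s, 0 ≤ V s) (hVW : ∀ s, V s ≤ W s) {C : ℝ} (hC : ∀ s, W s ≤ C) (s : S) (a : A) :
    M.bellman h V s a ≤ M.bellman h W s a := by
  refine add_le_add le_rfl (integral_mono_of_nonneg (Filter.Eventually.of_forall h0) ?_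
    (Filter.Eventually.of_forall hVW))
  exact M.integrable_transMeasure hh hW (fun s => (h0 s).trans (hVW s)) hC s a

/-- Changing the next value by at most `ε` changes the Bellman backup by at most `ε`. -/
theorem abs_bellman_sub_le {h : ℕ} (hh : h ∈ Finset.Icc 1 M.H) {V W : S → ℝ}
    (hV : Measurable V) (hW : Measurable W) (hV0 : ∀ s, 0 ≤ V s) (hW0 : ∀ s, 0 ≤ W s) {C ε : ℝ}
    (hVC : ∀ s, V s ≤ C) (hWC : ∀ s, W s ≤ C) (hε : ∀ s, |V s - W s| ≤ ε) (s : S) (a : A) :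
    |M.bellman h V s a - M.bellman h W s a| ≤ ε := by
  have := M.isProbabilityMeasure_transMeasure hh s a
  rw [bellman, bellman, add_sub_add_left_eq_sub,
    ← integral_sub (M.integrable_transMeasure hh hV hV0 hVC s a)
      (M.integrable_transMeasure hh hW hW0 hWC s a)]
  have := norm_integral_le_of_norm_le_const (μ := M.transMeasure h s a)
    (f := fun s => V s - W s) (C := ε) (Filter.Eventually.of_forall hε)
  simpa using this

theorem V_succ_H (π : Policy S A) : M.V π (M.H + 1) = fun _ => 0 := by
  simp [V, valueToGo]

theorem V_eq_avg_Q (π : Policy S A) {h : ℕ} (hh : h ∈ Finset.Icc 1 M.H) :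
    M.V π h = (π h).avg (M.Q π h) := by
  rw [Finset.mem_Icc] at hh
  have e1 : M.H + 1 - h = (M.H - h) + 1 := by omega
  have e2 : M.H - (M.H - h) = h := by omega
  have e3 : M.H + 1 - (h + 1) = M.H - h := by omega
  simp only [V, Q, e1, e3, valueToGo, e2]

/-- Backward induction over the steps `H + 1, H, …, 1`. -/
theorem backward_induction {H : ℕ} {p : ℕ → Prop} (hlast : p (H + 1))
    (hstep : ∀ h ∈ Finset.Icc 1 H, p (h + 1) → p h) : ∀ h ∈ Finset.Icc 1 (H + 1), p h := by
  have key : ∀ n, n ≤ H → p (H + 1 - n) := by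
    intro n
    induction n with
    | zero => intro _; exact hlast
    | succ n ih =>
      intro hn
      have h1 := ih (by omega)
      have e : H + 1 - n = (H + 1 - (n + 1)) + 1 := by omega
      rw [e] at h1
      exact hstep _ (Finset.mem_Icc.2 ⟨by omega, by omega⟩) h1
  intro h hh
  rw [Finset.mem_Icc] at hh
  have := key (H + 1 - h) (by omega)
  rwa [show H + 1 - (H + 1 - h) = h by omega] at this

theorem V_measurable_and_mem [SFinite ρ] (π : Policy S A) : ∀ h ∈ Finset.Icc 1 (M.H + 1),
    Measurable (M.V π h) ∧ ∀ s, 0 ≤ M.V π h s ∧ M.V π h s ≤ (M.H : ℝ) - h + 1 := by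
  refine backward_induction ?_ ?_
  · rw [V_succ_H]
    exact ⟨measurable_const, fun s => ⟨le_rfl, by push_cast; linarith⟩⟩
  · rintro h hh ⟨hm, hb⟩
    rw [M.V_eq_avg_Q π hh]
    have hQ0 : ∀ s a, 0 ≤ M.Q π h s a := M.bellman_nonneg hh fun s => (hb s).1
    have hQ1 : ∀ s a, M.Q π h s a ≤ (M.H : ℝ) - h + 1 := fun s a => by
      have := M.bellman_le hh (fun s => (hb s).1) (fun s => (hb s).2) s a
      push_cast at this
      rw [Q]; linarith
    exact ⟨(π h).measurable_avg (M.measurable_bellman hh hm), fun s =>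
      ⟨(π h).avg_nonneg s (hQ0 s), (π h).avg_le s (hQ0 s) (hQ1 s)⟩⟩

theorem measurable_V [SFinite ρ] (π : Policy S A) {h : ℕ} (hh : h ∈ Finset.Icc 1 (M.H + 1)) :
    Measurable (M.V π h) := (M.V_measurable_and_mem π h hh).1

theorem V_nonneg [SFinite ρ] (π : Policy S A) {h : ℕ} (hh : h ∈ Finset.Icc 1 (M.H + 1)) (s : S) :
    0 ≤ M.V π h s := ((M.V_measurable_and_mem π h hh).2 s).1

theorem V_le [SFinite ρ] (π : Policy S A) {h : ℕ} (hh : h ∈ Finset.Icc 1 (M.H + 1)) (s : S) :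
    M.V π h s ≤ (M.H : ℝ) - h + 1 := ((M.V_measurable_and_mem π h hh).2 s).2

theorem succ_mem_Icc {H h : ℕ} (hh : h ∈ Finset.Icc 1 H) : h + 1 ∈ Finset.Icc 1 (H + 1) := by
  rw [Finset.mem_Icc] at *; omega

theorem mem_Icc_succ {H h : ℕ} (hh : h ∈ Finset.Icc 1 H) : h ∈ Finset.Icc 1 (H + 1) := by
  rw [Finset.mem_Icc] at *; omega

theorem Q_nonneg [SFinite ρ] (π : Policy S A) {h : ℕ} (hh : h ∈ Finset.Icc 1 M.H) (s : S) (a : A) :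
    0 ≤ M.Q π h s a := M.bellman_nonneg hh (M.V_nonneg π (succ_mem_Icc hh)) s a

theorem valueToGo_congr {π π' : Policy S A} (n : ℕ) (h : ∀ m < n, π (M.H - m) = π' (M.H - m)) :
    M.valueToGo π n = M.valueToGo π' n := by
  induction n with
  | zero => rfl
  | succ n ih =>
    rw [valueToGo, valueToGo, ih fun m hm => h m (by omega), h n (by omega)]

/-- Playing any action once cannot improve on an optimal policy. -/
theorem Q_le_V_of_isOptimal [MeasurableEq A] {πstar : Policy S A} (hopt : M.IsOptimal πstar) {h : ℕ}
    (hh : h ∈ Finset.Icc 1 M.H) (s : S) (a : A) : M.Q πstar h s a ≤ M.V πstar h s := by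
  classical
  let c : DecisionRule S A :=
    { act := fun _ => PMF.pure a
      meas := fun _ _ => measurable_const }
  let π' : Policy S A := Function.update πstar h c
  have h1 := hopt π' h hh s
  have e1 : M.V π' (h + 1) = M.V πstar (h + 1) := by
    refine M.valueToGo_congr _ fun m hm => ?_
    have : M.H - m ≠ h := by rw [Finset.mem_Icc] at hh; omega
    exact Function.update_of_ne this _ _
  rw [M.V_eq_avg_Q π' hh, show π' h = c from Function.update_self _ _ _,
    DecisionRule.avg_of_act_eq_pure (a := a) rfl] at h1
  rwa [Q, e1] at h1

theorem V_detPolicy [MeasurableEq A] {f : ℕ → S → A} (hf : ∀ h, Measurable (f h)) {h : ℕ}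
    (hh : h ∈ Finset.Icc 1 M.H) (s : S) :
    M.V (detPolicy f hf) h s = M.Q (detPolicy f hf) h s (f h s) := by
  rw [M.V_eq_avg_Q _ hh]
  exact DecisionRule.avg_of_act_eq_pure rfl _

theorem gapMin_le_gap [MeasurableEq A] {πstar : Policy S A} (hopt : M.IsOptimal πstar) {h : ℕ}
    (hh : h ∈ Finset.Icc 1 M.H) {s : S} {a : A} (hne : M.gap πstar h s a ≠ 0) :
    M.gapMin πstar ≤ M.gap πstar h s a := by
  refine csInf_le ⟨0, ?_⟩ ⟨hne, h, hh, s, a, rfl⟩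
  rintro x ⟨-, h', hh', s', a', rfl⟩
  exact sub_nonneg.2 (M.Q_le_V_of_isOptimal hopt hh' s' a')

theorem gapMin_le_H [SFinite ρ] [MeasurableEq A] {πstar : Policy S A} (hopt : M.IsOptimal πstar)
    (hpos : 0 < M.gapMin πstar) : M.gapMin πstar ≤ M.H := by
  have hne : {x : ℝ | x ≠ 0 ∧ ∃ h ∈ Finset.Icc 1 M.H, ∃ s a, x = M.gap πstar h s a}.Nonempty := by
    by_contra! h
    rw [gapMin, h, Real.sInf_empty] at hpos
    exact lt_irrefl _ hpos
  obtain ⟨x, hx0, h, hh, s, a, rfl⟩ := hne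
  refine (M.gapMin_le_gap hopt hh hx0).trans ?_
  have h1 := M.V_le πstar (mem_Icc_succ hh) s
  have h2 := M.Q_nonneg πstar hh s a
  have h3 : (1 : ℝ) ≤ h := by rw [Finset.mem_Icc] at hh; exact_mod_cast hh.1
  rw [gap]; linarith

end MDP

end Values

/-! ### Visitation densities -/

section Visitation

variable {S A : Type*} [MeasurableSpace S] [MeasurableSpace A] {ρ : Measure S}

namespace MDP

variable (M : MDP S A ρ)

theorem lintegral_transMeasure {h : ℕ} (hh : h ∈ Finset.Icc 1 M.H) (s : S) (a : A)
    {F : S → ENNReal} (hF : Measurable F) :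
    ∫⁻ s', F s' ∂(M.transMeasure h s a) = ∫⁻ s', ENNReal.ofReal (M.dens h s a s') * F s' ∂ρ := by
  have hm : Measurable fun s' => ENNReal.ofReal (M.dens h s a s') :=
    ((M.dens_meas h hh).comp (measurable_prodMk_left (x := (s, a)))).ennreal_ofReal
  rw [transMeasure, lintegral_withDensity_eq_lintegral_mul _ hm hF]
  rfl

theorem measurable_dens_comp {α : Type*} [MeasurableSpace α] {h : ℕ} (hh : h ∈ Finset.Icc 1 M.H)
    {s : α → S} {a : α → A} {s' : α → S} (hs : Measurable s) (ha : Measurable a)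
    (hs' : Measurable s') : Measurable fun x => ENNReal.ofReal (M.dens h (s x) (a x) (s' x)) :=
  ((M.dens_meas h hh).comp ((hs.prodMk ha).prodMk hs')).ennreal_ofReal

theorem stateDens_succ (π : Policy S A) {h : ℕ} (hh : 1 ≤ h) (s' : S) :
    M.stateDens π (h + 1) s' = ∫⁻ s, ∫⁻ a, M.stateDens π h s * ENNReal.ofReal (M.dens h s a s')
      ∂((π h).act s).toMeasure ∂ρ := by
  obtain ⟨n, rfl⟩ : ∃ n, h = n + 1 := ⟨h - 1, by omega⟩
  rfl

/-- Joint measurability of the visitation densities of a measurably parametrized policy. -/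
theorem measurable_stateDens [SFinite ρ] {Z : Type*} [MeasurableSpace Z] (μ : Z → Policy S A)
    (hμ : ∀ h ∈ Finset.Icc 1 M.H, ∀ B : Set A, MeasurableSet B →
      Measurable fun x : Z × S => ((μ x.1 h).act x.2).toMeasure B) :
    ∀ h, 1 ≤ h → h ≤ M.H → Measurable fun x : Z × S => M.stateDens (μ x.1) h x.2 := by
  intro h h1
  induction h, h1 using Nat.le_induction with
  | base =>
    intro _
    simp only [stateDens]
    exact (M.init_meas.comp measurable_snd).ennreal_ofReal
  | succ h h1 ih =>
    intro hH
    have hh : h ∈ Finset.Icc 1 M.H := Finset.mem_Icc.2 ⟨h1, by omega⟩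
    have ih := ih (by omega)
    simp only [M.stateDens_succ _ h1]
    have hk1 : Measurable fun x : Z × S => ((μ x.1 h).act x.2).toMeasure :=
      Measure.measurable_of_measurable_coe _ (hμ h hh)
    have hk2 : Measurable fun x : (Z × S) × S => (x.1.1, x.2) := by fun_prop
    let k : ProbabilityTheory.Kernel ((Z × S) × S) A := ⟨_, hk1.comp hk2⟩
    have : ProbabilityTheory.IsMarkovKernel k :=
      ⟨fun x => inferInstanceAs (IsProbabilityMeasure ((μ x.1.1 h).act x.2).toMeasure)⟩
    have hF : Measurable fun y : ((Z × S) × S) × A => M.stateDens (μ y.1.1.1) h y.1.2 *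
        ENNReal.ofReal (M.dens h y.1.2 y.2 y.1.1.2) := by
      refine Measurable.mul ?_ ?_
      · have h2 : Measurable fun y : ((Z × S) × S) × A => (y.1.1.1, y.1.2) := by fun_prop
        exact ih.comp h2
      · exact M.measurable_dens_comp hh (by fun_prop) measurable_snd (by fun_prop)
    exact (hF.lintegral_kernel_prod_right' (κ := k)).lintegral_prod_right'

theorem measurable_stateDens_policy [SFinite ρ] (π : Policy S A) {h : ℕ}
    (hh : h ∈ Finset.Icc 1 M.H) : Measurable (M.stateDens π h) := by
  rw [Finset.mem_Icc] at hh
  exact (M.measurable_stateDens (Z := Unit) (fun _ => π)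
    (fun h _ B hB => ((π h).meas B hB).comp measurable_snd) h hh.1 hh.2).comp
    (measurable_prodMk_left (x := ()))

/-- Tonelli's theorem for a kernel followed by a transition density. -/
theorem _root_.BCPVI.lintegral_density_swap [SFinite ρ] (k : ProbabilityTheory.Kernel S A)
    [ProbabilityTheory.IsMarkovKernel k] {D F : S → ENNReal} {p : (S × A) × S → ENNReal}
    (hD : Measurable D) (hF : Measurable F) (hp : Measurable p) :
    ∫⁻ s', (∫⁻ s, ∫⁻ a, D s * p ((s, a), s') ∂(k s) ∂ρ) * F s' ∂ρ
      = ∫⁻ s, D s * ∫⁻ a, ∫⁻ s', p ((s, a), s') * F s' ∂ρ ∂(k s) ∂ρ := by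
  have hpa : ∀ s s', Measurable fun a => p ((s, a), s') := fun s s' => by fun_prop
  have hI : Measurable fun y : S × S => ∫⁻ a, p ((y.2, a), y.1) ∂(k y.2) :=
    Measurable.lintegral_kernel_prod_right' (κ := k.comap Prod.snd measurable_snd)
      (f := fun y : (S × S) × A => p ((y.1.2, y.2), y.1.1)) (by fun_prop)
  have e1 : ∀ s', (∫⁻ s, ∫⁻ a, D s * p ((s, a), s') ∂(k s) ∂ρ) * F s'
      = ∫⁻ s, D s * (∫⁻ a, p ((s, a), s') ∂(k s)) * F s' ∂ρ := fun s' => by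
    have hI' : Measurable fun s => ∫⁻ a, p ((s, a), s') ∂(k s) :=
      hI.comp (measurable_prodMk_left (x := s'))
    have hDI : Measurable fun s => D s * ∫⁻ a, p ((s, a), s') ∂(k s) := hD.mul hI'
    rw [lintegral_mul_const _ hDI]
    congr 1
    exact lintegral_congr fun s => lintegral_const_mul _ (hpa s s')
  simp_rw [e1]
  rw [lintegral_lintegral_swap (by fun_prop)]
  refine lintegral_congr fun s => ?_
  have hI' : Measurable fun s' => ∫⁻ a, p ((s, a), s') ∂(k s) :=
    hI.comp (measurable_prodMk_right (y := s))
  have hIF : Measurable fun s' => (∫⁻ a, p ((s, a), s') ∂(k s)) * F s' := hI'.mul hF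
  simp_rw [mul_assoc]
  rw [lintegral_const_mul _ hIF]
  congr 1
  simp_rw [← lintegral_mul_const _ (hpa s _)]
  rw [lintegral_lintegral_swap (by fun_prop)]

/-- The forward equation for visitation densities, tested against a nonnegative function. -/
theorem lintegral_stateDens_succ [SFinite ρ] (π : Policy S A) {h : ℕ} (hh : h ∈ Finset.Icc 1 M.H)
    {F : S → ENNReal} (hF : Measurable F) :
    ∫⁻ s', M.stateDens π (h + 1) s' * F s' ∂ρ
      = ∫⁻ s, M.stateDens π h s *
          ∫⁻ a, ∫⁻ s', F s' ∂(M.transMeasure h s a) ∂((π h).act s).toMeasure ∂ρ := by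
  have hD := M.measurable_stateDens_policy π hh
  simp_rw [fun s a => M.lintegral_transMeasure hh s a hF]
  simp only [M.stateDens_succ π (Finset.mem_Icc.1 hh).1]
  exact lintegral_density_swap (π h).kernel hD hF (M.dens_meas h hh).ennreal_ofReal

/-- The state distribution of the step `h` under `π`. -/
noncomputable def occupancy (π : Policy S A) (h : ℕ) : Measure S := ρ.withDensity (M.stateDens π h)

theorem lintegral_occupancy [SFinite ρ] (π : Policy S A) {h : ℕ} (hh : h ∈ Finset.Icc 1 M.H)
    {F : S → ENNReal} (hF : Measurable F) :
    ∫⁻ s, F s ∂(M.occupancy π h) = ∫⁻ s, M.stateDens π h s * F s ∂ρ := by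
  rw [occupancy, lintegral_withDensity_eq_lintegral_mul _ (M.measurable_stateDens_policy π hh) hF]
  rfl

theorem ae_stateDens_pos [SFinite ρ] (π : Policy S A) {h : ℕ} (hh : h ∈ Finset.Icc 1 M.H) :
    ∀ᵐ s ∂(M.occupancy π h), 0 < M.stateDens π h s := by
  rw [occupancy, ae_withDensity_iff (M.measurable_stateDens_policy π hh)]
  exact Filter.Eventually.of_forall fun s hs => pos_iff_ne_zero.2 hs

theorem isProbabilityMeasure_occupancy [SFinite ρ] (π : Policy S A) {h : ℕ}
    (hh : h ∈ Finset.Icc 1 M.H) : IsProbabilityMeasure (M.occupancy π h) := by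
  have key : ∀ h, 1 ≤ h → h ≤ M.H → ∫⁻ s, M.stateDens π h s * 1 ∂ρ = 1 := by
    intro h h1
    induction h, h1 using Nat.le_induction with
    | base => intro _; simpa [stateDens] using M.init_mass
    | succ h h1 ih =>
      intro hH
      have hh : h ∈ Finset.Icc 1 M.H := Finset.mem_Icc.2 ⟨h1, by omega⟩
      rw [M.lintegral_stateDens_succ π hh (F := fun _ => 1) measurable_const]
      refine Eq.trans ?_ (ih (by omega))
      refine lintegral_congr fun s => ?_
      have : ∀ a, ∫⁻ _, 1 ∂(M.transMeasure h s a) = 1 := fun a => by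
        have := M.isProbabilityMeasure_transMeasure hh s a
        simp
      simp only [this, lintegral_const, measure_univ, mul_one]
  rw [Finset.mem_Icc] at hh
  refine ⟨?_⟩
  rw [occupancy, withDensity_apply _ MeasurableSet.univ, Measure.restrict_univ]
  simpa using key h hh.1 hh.2

/-- What holds almost surely at the step `h + 1` under a deterministic policy holds almost surely
after almost every transition from the step `h`. -/
theorem ae_transMeasure_of_ae_occupancy_succ [SFinite ρ] [MeasurableEq A] {f : ℕ → S → A}
    (hf : ∀ h, Measurable (f h)) {h : ℕ} (hh : h ∈ Finset.Icc 1 M.H)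
    (hh1 : h + 1 ∈ Finset.Icc 1 M.H) {p : S → Prop}
    (hp : ∀ᵐ s ∂(M.occupancy (detPolicy f hf) (h + 1)), p s) :
    ∀ᵐ s ∂(M.occupancy (detPolicy f hf) h), ∀ᵐ s' ∂(M.transMeasure h s (f h s)), p s' := by
  have : MeasurableSingletonClass A := ⟨measurableSet_singleton_of_measurableEq⟩
  obtain ⟨N, hsub, hNm, hN0⟩ := exists_measurable_superset_of_null hp
  have hFm : Measurable (N.indicator (fun _ => (1 : ENNReal))) := measurable_const.indicator hNm
  have h1 : ∫⁻ s', N.indicator (fun _ => (1 : ENNReal)) s' ∂(M.occupancy (detPolicy f hf) (h + 1))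
      = 0 := by
    rw [lintegral_indicator_const hNm, hN0, mul_zero]
  rw [M.lintegral_occupancy _ hh1 hFm, M.lintegral_stateDens_succ _ hh hFm] at h1
  have e : ∀ s, ∫⁻ a, ∫⁻ s', N.indicator (fun _ => (1 : ENNReal)) s' ∂(M.transMeasure h s a)
      ∂((detPolicy f hf h).act s).toMeasure = M.transMeasure h s (f h s) N := fun s => by
    have : (detPolicy f hf h).act s = PMF.pure (f h s) := rfl
    rw [this, PMF.toMeasure_pure, lintegral_dirac, lintegral_indicator_const hNm, one_mul]
  have hgraph : Measurable fun s => (s, f h s) := measurable_id.prodMk (hf h)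
  have hcoe : Measurable fun x : S × A => M.transMeasure h x.1 x.2 N :=
    (M.transKernel hh).measurable_coe hNm
  have hmeas : Measurable fun s => M.transMeasure h s (f h s) N := by
    have := hcoe.comp hgraph
    exact this
  have h2 : ∫⁻ s, M.transMeasure h s (f h s) N ∂(M.occupancy (detPolicy f hf) h) = 0 := by
    rw [M.lintegral_occupancy _ hh hmeas, ← h1]
    exact lintegral_congr fun s => by rw [e]
  filter_upwards [(lintegral_eq_zero_iff hmeas).1 h2] with s hs
  exact measure_mono_null hsub hs

end MDP

end Visitation

/-! ### The law of the data -/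

section Histories

variable {S A Ω : Type*} [MeasurableSpace S] [MeasurableSpace A] (st : ℕ → ℕ → Ω → S)
  (ac : ℕ → ℕ → Ω → A) (rw : ℕ → ℕ → Ω → ℝ)

/-- The history before the step `h` of the episode `t`, together with the current state. -/
@[reducible] def historyState (H : ℕ) (st : ℕ → ℕ → Ω → S) (ac : ℕ → ℕ → Ω → A)
    (rw : ℕ → ℕ → Ω → ℝ) (t h : ℕ) : MeasurableSpace Ω :=
  history H st ac rw t h ⊔ MeasurableSpace.comap (st t h) inferInstance

/-- The history before the step `h` of the episode `t`, together with the current state and action. -/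
@[reducible] def historyAction (H : ℕ) (st : ℕ → ℕ → Ω → S) (ac : ℕ → ℕ → Ω → A)
    (rw : ℕ → ℕ → Ω → ℝ) (t h : ℕ) : MeasurableSpace Ω :=
  historyState H st ac rw t h ⊔ MeasurableSpace.comap (ac t h) inferInstance

theorem history_one_le (H t h : ℕ) :
    history H st ac rw t 1 ≤ history H st ac rw t h :=
  sup_le le_sup_left (by simp)

theorem stepInfo_le_history {H t t' h' : ℕ} (ht : t' ∈ Finset.Ico 1 t) (hh : h' ∈ Finset.Icc 1 H)
    (h : ℕ) : stepInfo st ac rw t' h' ≤ history H st ac rw t h :=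
  le_sup_of_le_left (le_iSup₂_of_le t' ht (le_iSup₂_of_le h' hh le_rfl))

theorem measurable_st_historyState (H t h : ℕ) :
    Measurable[historyState H st ac rw t h] (st t h) :=
  (comap_measurable (st t h)).mono le_sup_right le_rfl

theorem measurable_st_historyAction (H t h : ℕ) :
    Measurable[historyAction H st ac rw t h] (st t h) :=
  (measurable_st_historyState st ac rw H t h).mono le_sup_left le_rfl

theorem measurable_ac_historyAction (H t h : ℕ) :
    Measurable[historyAction H st ac rw t h] (ac t h) :=
  (comap_measurable (ac t h)).mono le_sup_right le_rfl

end Histories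

section Data

variable {S A Ω : Type*} [MeasurableSpace S] [MeasurableSpace A] [mΩ : MeasurableSpace Ω]
  {ρ : Measure S} {P : Measure Ω} {M : MDP S A ρ} {K : ℕ}
  {st : ℕ → ℕ → Ω → S} {ac : ℕ → ℕ → Ω → A} {rw : ℕ → ℕ → Ω → ℝ} {μ : ℕ → Ω → Policy S A}

theorem stepInfo_le (hd : IsAdaptiveData P M K st ac rw μ) {t h : ℕ} (ht : t ∈ Finset.Icc 1 K)
    (hh : h ∈ Finset.Icc 1 M.H) : stepInfo st ac rw t h ≤ mΩ :=
  sup_le (sup_le (hd.st_meas t ht h hh).comap_le (hd.ac_meas t ht h hh).comap_le)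
    (hd.rw_meas t ht h hh).comap_le

theorem history_le (hd : IsAdaptiveData P M K st ac rw μ) {t h : ℕ} (ht : t ∈ Finset.Icc 1 K)
    (hh : h ∈ Finset.Icc 1 M.H) : history M.H st ac rw t h ≤ mΩ := by
  refine sup_le (iSup₂_le fun t' ht' => iSup₂_le fun h' hh' => stepInfo_le hd ?_ hh')
    (iSup₂_le fun h' hh' => stepInfo_le hd ht ?_)
  · simp only [Finset.mem_Ico, Finset.mem_Icc] at *; omega
  · simp only [Finset.mem_Ico, Finset.mem_Icc] at *; omega

theorem historyState_le (hd : IsAdaptiveData P M K st ac rw μ) {t h : ℕ} (ht : t ∈ Finset.Icc 1 K)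
    (hh : h ∈ Finset.Icc 1 M.H) : historyState M.H st ac rw t h ≤ mΩ :=
  sup_le (history_le hd ht hh) (hd.st_meas t ht h hh).comap_le

theorem historyAction_le (hd : IsAdaptiveData P M K st ac rw μ) {t h : ℕ} (ht : t ∈ Finset.Icc 1 K)
    (hh : h ∈ Finset.Icc 1 M.H) : historyAction M.H st ac rw t h ≤ mΩ :=
  sup_le (historyState_le hd ht hh) (hd.ac_meas t ht h hh).comap_le

end Data

section DataLaw

variable {S A Ω : Type*} [MeasurableSpace S] [MeasurableSpace A] [mΩ : MeasurableSpace Ω]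
  {ρ : Measure S} {P : Measure Ω} [IsProbabilityMeasure P] {M : MDP S A ρ} {K : ℕ}
  {st : ℕ → ℕ → Ω → S} {ac : ℕ → ℕ → Ω → A} {rw : ℕ → ℕ → Ω → ℝ} {μ : ℕ → Ω → Policy S A}

/-- Pairing a sub-σ-algebra with a random element. -/
theorem measurable_prodMk_of_le {Ω E : Type*} {m m' : MeasurableSpace Ω} (hle : m ≤ m')
    [mE : MeasurableSpace E] {X : Ω → E} (hX : Measurable[m'] X) :
    @Measurable _ _ m' (m.prod mE) fun ω => (ω, X ω) :=
  @Measurable.prodMk Ω m' Ω E m mE id X (measurable_id'' hle) hX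

theorem measurable_lintegral_toMeasure {A : Type*} [MeasurableSpace A] {Z : Type*}
    [MeasurableSpace Z] (ν : Z → PMF A) (G : Z × A → ENNReal)
    (hν : ∀ B : Set A, MeasurableSet B → Measurable fun z => (ν z).toMeasure B)
    (hG : Measurable G) : Measurable fun z => ∫⁻ a, G (z, a) ∂(ν z).toMeasure := by
  let k : ProbabilityTheory.Kernel Z A :=
    ⟨fun z => (ν z).toMeasure, Measure.measurable_of_measurable_coe _ hν⟩
  have : ProbabilityTheory.IsMarkovKernel k :=
    ⟨fun z => inferInstanceAs (IsProbabilityMeasure (ν z).toMeasure)⟩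
  exact Measurable.lintegral_kernel_prod_right' (κ := k) hG

theorem lintegral_action_eq (hd : IsAdaptiveData P M K st ac rw μ) {t h : ℕ}
    (ht : t ∈ Finset.Icc 1 K) (hh : h ∈ Finset.Icc 1 M.H)
    {F : (Ω × S) × A → ENNReal} (hF : Measurable[((history M.H st ac rw t 1).prod inferInstance).prod
      inferInstance] F) :
    ∫⁻ ω, F ((ω, st t h ω), ac t h ω) ∂P
      = ∫⁻ ω, ∫⁻ a, F ((ω, st t h ω), a) ∂((μ t ω h).act (st t h ω)).toMeasure ∂P := by
  have hle : history M.H st ac rw t 1 ≤ historyState M.H st ac rw t h :=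
    (history_one_le st ac rw _ _ _).trans le_sup_left
  have hst := measurable_prodMk_of_le hle
    (measurable_st_historyState st ac rw M.H t h)
  refine lintegral_of_condExp_indicator (historyState_le hd ht hh) P (hd.ac_meas t ht h hh)
    (κ := fun ω => ((μ t ω h).act (st t h ω)).toMeasure) ?_
    (fun ω => inferInstance) (hd.action_law t ht h hh)
    (F := fun x => F ((x.1, st t h x.1), x.2)) ?_
  · refine Measure.measurable_of_measurable_coe _ fun B hB => ?_
    have := (hd.policy_meas t ht h hh B hB).comp hst
    exact this
  · have h1 := hst.comp (@measurable_fst Ω A (historyState M.H st ac rw t h) inferInstance)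
    have h2 := @Measurable.prodMk _ ((historyState M.H st ac rw t h).prod inferInstance) (Ω × S) A
      ((history M.H st ac rw t 1).prod inferInstance) _ _ _ h1
      (@measurable_snd Ω A (historyState M.H st ac rw t h) inferInstance)
    have := hF.comp h2
    exact this

theorem lintegral_next_state_eq [SFinite ρ] (hd : IsAdaptiveData P M K st ac rw μ) {t h : ℕ}
    (ht : t ∈ Finset.Icc 1 K) (hh : h ∈ Finset.Ico 1 M.H)
    {F : Ω × S → ENNReal} (hF : Measurable[(history M.H st ac rw t 1).prod inferInstance] F) :
    ∫⁻ ω, F (ω, st t (h + 1) ω) ∂P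
      = ∫⁻ ω, ∫⁻ s', F (ω, s') ∂(M.transMeasure h (st t h ω) (ac t h ω)) ∂P := by
  have hh0 : h ∈ Finset.Icc 1 M.H := by simp only [Finset.mem_Ico, Finset.mem_Icc] at *; omega
  have hh1 : h + 1 ∈ Finset.Icc 1 M.H := by simp only [Finset.mem_Ico, Finset.mem_Icc] at *; omega
  have hle : history M.H st ac rw t 1 ≤ historyAction M.H st ac rw t h :=
    ((history_one_le st ac rw _ _ _).trans le_sup_left).trans le_sup_left
  refine lintegral_of_condExp_indicator (historyAction_le hd ht hh0) P (hd.st_meas t ht _ hh1)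
    (κ := fun ω => M.transMeasure h (st t h ω) (ac t h ω)) ?_
    (fun ω => M.isProbabilityMeasure_transMeasure hh0 _ _) (hd.trans_law t ht h hh) ?_
  · have := (M.measurable_transMeasure hh0).comp ((measurable_st_historyAction st ac rw M.H t h).prodMk
      (measurable_ac_historyAction st ac rw M.H t h))
    exact this
  · refine hF.mono ?_ le_rfl
    exact sup_le_sup (MeasurableSpace.comap_mono hle) le_rfl

/-- Given the previous episodes, `s_h^t` has the visitation density of the behaviour policy. -/
theorem lintegral_state_eq [SFinite ρ] (hd : IsAdaptiveData P M K st ac rw μ) {t : ℕ}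
    (ht : t ∈ Finset.Icc 1 K) : ∀ h, 1 ≤ h → h ≤ M.H → ∀ F : Ω × S → ENNReal,
    Measurable[(history M.H st ac rw t 1).prod inferInstance] F →
    ∫⁻ ω, F (ω, st t h ω) ∂P
      = ∫⁻ ω, ∫⁻ s, M.stateDens (μ t ω) h s * F (ω, s) ∂ρ ∂P := by
  intro h h1
  induction h, h1 using Nat.le_induction with
  | base =>
    intro hH F hF
    have hh : 1 ∈ Finset.Icc 1 M.H := Finset.mem_Icc.2 ⟨le_rfl, hH⟩
    rw [lintegral_of_condExp_indicator (history_le hd ht hh) P (hd.st_meas t ht 1 hh)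
      (κ := fun _ => M.initMeasure) measurable_const
      (fun _ => M.isProbabilityMeasure_initMeasure) (hd.init_law t ht hH) hF]
    refine lintegral_congr fun ω => ?_
    have hFω : Measurable fun s => F (ω, s) := by
      have := hF.comp (@measurable_prodMk_left Ω S (history M.H st ac rw t 1) _ ω)
      exact this
    rw [MDP.initMeasure, lintegral_withDensity_eq_lintegral_mul _ M.init_meas.ennreal_ofReal hFω]
    rfl
  | succ h h1 ih =>
    intro hH F hF
    have hh : h ∈ Finset.Icc 1 M.H := Finset.mem_Icc.2 ⟨h1, by omega⟩
    have hFω : ∀ ω, Measurable fun s => F (ω, s) := fun ω => by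
      have := hF.comp (@measurable_prodMk_left Ω S (history M.H st ac rw t 1) _ ω)
      exact this
    rw [lintegral_next_state_eq hd ht (Finset.mem_Ico.2 ⟨h1, hH⟩) hF]
    let G : (Ω × S) × A → ENNReal := fun x => ∫⁻ s', F (x.1.1, s') ∂(M.transMeasure h x.1.2 x.2)
    have hG : Measurable[((history M.H st ac rw t 1).prod inferInstance).prod inferInstance] G := by
      have aux : ∀ {Z : Type _} [MeasurableSpace Z] (F : Z × S → ENNReal), Measurable F →
          Measurable fun x : (Z × S) × A => ∫⁻ s', F (x.1.1, s') ∂(M.transMeasure h x.1.2 x.2) := by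
        intro Z _ F hF
        have hc : Measurable fun x : (Z × S) × A => (x.1.2, x.2) := by fun_prop
        exact Measurable.lintegral_kernel_prod_right' (κ := (M.transKernel hh).comap _ hc)
          (f := fun y : ((Z × S) × A) × S => F (y.1.1.1, y.2)) (by fun_prop)
      exact @aux Ω (history M.H st ac rw t 1) F hF
    have e1 := lintegral_action_eq hd ht hh hG
    simp only [G] at e1
    rw [e1]
    let G2 : Ω × S → ENNReal := fun x =>
      ∫⁻ a, G (x, a) ∂((μ t x.1 h).act x.2).toMeasure
    have hG2 : Measurable[(history M.H st ac rw t 1).prod inferInstance] G2 := by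
      exact @measurable_lintegral_toMeasure A _ (Ω × S)
        ((history M.H st ac rw t 1).prod inferInstance) (fun x => (μ t x.1 h).act x.2) G (hd.policy_meas t ht h hh) hG
    refine (ih (by omega) G2 hG2).trans (lintegral_congr fun ω => ?_)
    rw [M.lintegral_stateDens_succ (μ t ω) hh (hFω ω)]

/-- Given the previous episodes, `(s_h^t, a_h^t)` has the state-action visitation density of the
behaviour policy. -/
theorem lintegral_stateAction_eq [SFinite ρ] (hd : IsAdaptiveData P M K st ac rw μ) {t h : ℕ}
    (ht : t ∈ Finset.Icc 1 K) (hh : h ∈ Finset.Icc 1 M.H) {F : (Ω × S) × A → ENNReal}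
    (hF : Measurable[((history M.H st ac rw t 1).prod inferInstance).prod inferInstance] F) :
    ∫⁻ ω, F ((ω, st t h ω), ac t h ω) ∂P
      = ∫⁻ ω, ∫⁻ s, M.stateDens (μ t ω) h s *
          ∫⁻ a, F ((ω, s), a) ∂((μ t ω h).act s).toMeasure ∂ρ ∂P := by
  rw [lintegral_action_eq hd ht hh hF]
  have hG := @measurable_lintegral_toMeasure A _ (Ω × S)
    ((history M.H st ac rw t 1).prod inferInstance) (fun x => (μ t x.1 h).act x.2) F
    (hd.policy_meas t ht h hh) hF
  rw [Finset.mem_Icc] at hh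
  exact lintegral_state_eq hd ht h hh.1 hh.2
    (fun x => ∫⁻ a, F (x, a) ∂((μ t x.1 h).act x.2).toMeasure) hG

end DataLaw

/-! ### Concentration of the regression noise -/

section Noise

variable {S A Ω : Type*} [MeasurableSpace S] [MeasurableSpace A]
  {ρ : Measure S} {M : MDP S A ρ} {K : ℕ}
  {st : ℕ → ℕ → Ω → S} {ac : ℕ → ℕ → Ω → A} {rw : ℕ → ℕ → Ω → ℝ} {μ : ℕ → Ω → Policy S A}
  {d : ℕ} {φ : ℕ → S → A → EuclideanSpace ℝ (Fin d)}

/-- The error of the regression target `r_h^t + V(s_{h+1}^t)` for `T_h V (s_h^t, a_h^t)`. -/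
noncomputable def noise (M : MDP S A ρ) (st : ℕ → ℕ → Ω → S) (ac : ℕ → ℕ → Ω → A)
    (rw : ℕ → ℕ → Ω → ℝ) (h : ℕ) (V : S → ℝ) (t : ℕ) (ω : Ω) : ℝ :=
  rw t h ω + V (st t (h + 1) ω) - M.bellman h V (st t h ω) (ac t h ω)

/-- The functions `V` on the states of the step `h + 1` that can occur as regression targets: they
are measurable with values in `[0, H]`, and vanish after the last step. -/
structure IsTarget (M : MDP S A ρ) (h : ℕ) (V : S → ℝ) : Prop where
  meas : Measurable V
  nonneg : ∀ s, 0 ≤ V s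
  le : ∀ s, V s ≤ M.H
  last : h < M.H ∨ V = fun _ => 0

theorem IsTarget.measurable_comp_st {h : ℕ} {V : S → ℝ} (hV : IsTarget M h V) {m : MeasurableSpace Ω}
    {t : ℕ} (hst : h < M.H → Measurable[m] (st t (h + 1))) :
    Measurable[m] fun ω => V (st t (h + 1) ω) := by
  rcases hV.last with hh | h0
  · exact hV.meas.comp (hst hh)
  · rw [h0]; exact measurable_const

theorem measurable_noise [SFinite ρ] {h : ℕ} (hh : h ∈ Finset.Icc 1 M.H) {V : S → ℝ}
    (hV : IsTarget M h V) {m : MeasurableSpace Ω} {t : ℕ} (hst : Measurable[m] (st t h))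
    (hac : Measurable[m] (ac t h)) (hrw : Measurable[m] (rw t h))
    (hst' : h < M.H → Measurable[m] (st t (h + 1))) :
    Measurable[m] (noise M st ac rw h V t) := by
  have h1 := (M.measurable_bellman hh hV.meas).comp (hst.prodMk hac)
  exact (hrw.add (hV.measurable_comp_st hst')).sub h1

theorem abs_noise_le {h : ℕ} (hh : h ∈ Finset.Icc 1 M.H) {V : S → ℝ}
    (hV : IsTarget M h V) {t : ℕ} {ω : Ω} (hr : rw t h ω ∈ Set.Icc (0 : ℝ) 1) :
    |noise M st ac rw h V t ω| ≤ 2 * M.H := by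
  have h1 : (1 : ℝ) ≤ M.H := by
    rw [Finset.mem_Icc] at hh; exact_mod_cast hh.1.trans hh.2
  have h2 := M.bellman_nonneg hh hV.nonneg (st t h ω) (ac t h ω)
  have h3 := M.bellman_le hh hV.nonneg hV.le (st t h ω) (ac t h ω)
  have h4 := hV.nonneg (st t (h + 1) ω)
  have h5 := hV.le (st t (h + 1) ω)
  rw [noise, abs_le]
  constructor <;> linarith [hr.1, hr.2]

/-- The exponent of the supermartingale for the noise in the direction `x`, after the episodes
`1, …, n - 1`. -/
noncomputable def noiseExponent (M : MDP S A ρ) (φ : ℕ → S → A → EuclideanSpace ℝ (Fin d))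
    (st : ℕ → ℕ → Ω → S) (ac : ℕ → ℕ → Ω → A) (rw : ℕ → ℕ → Ω → ℝ) (h : ℕ) (V : S → ℝ) (c : ℝ)
    (x : EuclideanSpace ℝ (Fin d)) (n : ℕ) (ω : Ω) : ℝ :=
  ∑ t ∈ Finset.Ico 1 n, (c * inner ℝ x (φ h (st t h ω) (ac t h ω)) * noise M st ac rw h V t ω
    - (c * inner ℝ x (φ h (st t h ω) (ac t h ω)) * (2 * M.H)) ^ 2 / 2)

theorem measurable_inner_feature {h : ℕ} (hφ : Measurable fun x : S × A => φ h x.1 x.2)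
    {m : MeasurableSpace Ω} {t : ℕ} (hst : Measurable[m] (st t h)) (hac : Measurable[m] (ac t h))
    (x : EuclideanSpace ℝ (Fin d)) :
    Measurable[m] fun ω => inner ℝ x (φ h (st t h ω) (ac t h ω)) := by
  have h1 : Measurable fun y : S × A => inner ℝ x (φ h y.1 y.2) := hφ.const_inner
  have h2 := h1.comp (hst.prodMk hac)
  exact h2

theorem abs_inner_feature_le {S A : Type*} {φ : ℕ → S → A → EuclideanSpace ℝ (Fin d)} {h : ℕ} (hφ1 : ∀ s a, ‖φ h s a‖ ≤ 1) (x : EuclideanSpace ℝ (Fin d))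
    (s : S) (a : A) : |inner ℝ x (φ h s a)| ≤ ‖x‖ :=
  (abs_real_inner_le_norm _ _).trans (mul_le_of_le_one_right (norm_nonneg x) (hφ1 s a))

theorem measurable_noiseExponent [SFinite ρ] {h : ℕ}
    (hh : h ∈ Finset.Icc 1 M.H) (hφ : Measurable fun x : S × A => φ h x.1 x.2)
    {V : S → ℝ} (hV : IsTarget M h V) (c : ℝ) (x : EuclideanSpace ℝ (Fin d)) (n : ℕ) :
    Measurable[historyAction M.H st ac rw n h] (noiseExponent M φ st ac rw h V c x n) := by
  refine Finset.measurable_fun_sum _ fun t ht => ?_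
  have hle : ∀ h' ∈ Finset.Icc 1 M.H, stepInfo st ac rw t h' ≤ historyAction M.H st ac rw n h :=
    fun h' hh' => ((stepInfo_le_history st ac rw ht hh' h).trans le_sup_left).trans le_sup_left
  have hst : ∀ h' ∈ Finset.Icc 1 M.H, Measurable[historyAction M.H st ac rw n h] (st t h') :=
    fun h' hh' => (comap_measurable (st t h')).mono
      ((le_sup_left.trans le_sup_left).trans (hle h' hh')) le_rfl
  have hac : Measurable[historyAction M.H st ac rw n h] (ac t h) :=
    (comap_measurable (ac t h)).mono ((le_sup_right.trans le_sup_left).trans (hle h hh)) le_rfl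
  have hrw : Measurable[historyAction M.H st ac rw n h] (rw t h) :=
    (comap_measurable (rw t h)).mono (le_sup_right.trans (hle h hh)) le_rfl
  have h1 := measurable_inner_feature hφ (hst h hh) hac x
  have h2 := measurable_noise hh hV (hst h hh) hac hrw fun h1 =>
    hst (h + 1) (Finset.mem_Icc.2 ⟨by omega, h1⟩)
  exact ((h1.const_mul c).mul h2).sub ((((h1.const_mul c).mul_const _).pow_const 2).div_const 2)

variable [mΩ : MeasurableSpace Ω] {P : Measure Ω}

theorem ae_noiseExponent_le (hd : IsAdaptiveData P M K st ac rw μ) {h : ℕ}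
    (hh : h ∈ Finset.Icc 1 M.H) (hφ1 : ∀ s a, ‖φ h s a‖ ≤ 1)
    {V : S → ℝ} (hV : IsTarget M h V) {c : ℝ} (hc : 0 ≤ c) (x : EuclideanSpace ℝ (Fin d)) {n : ℕ}
    (hn : n ≤ K + 1) :
    ∀ᵐ ω ∂P, noiseExponent M φ st ac rw h V c x n ω
      ≤ ∑ _t ∈ Finset.Ico 1 n, c * ‖x‖ * (2 * M.H) := by
  have hall : ∀ᵐ ω ∂P, ∀ t ∈ Finset.Ico 1 n, rw t h ω ∈ Set.Icc (0 : ℝ) 1 := by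
    refine (Finset.eventually_all _).2 fun t ht => hd.reward_mem t ?_ h hh
    simp only [Finset.mem_Ico, Finset.mem_Icc] at *; omega
  filter_upwards [hall] with ω hω
  refine Finset.sum_le_sum fun t ht => ?_
  have h1 := abs_noise_le (st := st) (ac := ac) hh hV (hω t ht)
  have h2 := abs_inner_feature_le hφ1 x (st t h ω) (ac t h ω)
  have h3 := sq_nonneg (c * inner ℝ x (φ h (st t h ω) (ac t h ω)) * (2 * M.H))
  have h4 : c * inner ℝ x (φ h (st t h ω) (ac t h ω)) * noise M st ac rw h V t ω
      ≤ c * ‖x‖ * (2 * M.H) := by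
    refine (le_abs_self _).trans ?_
    rw [abs_mul, abs_mul, abs_of_nonneg hc]
    gcongr
  linarith

variable [IsProbabilityMeasure P]

theorem condExp_noise [SFinite ρ] (hd : IsAdaptiveData P M K st ac rw μ) {t h : ℕ}
    (ht : t ∈ Finset.Icc 1 K) (hh : h ∈ Finset.Icc 1 M.H) {V : S → ℝ} (hV : IsTarget M h V) :
    P[noise M st ac rw h V t | historyAction M.H st ac rw t h] =ᵐ[P] 0 := by
  have hm := historyAction_le hd ht hh
  have hgraph : Measurable[historyAction M.H st ac rw t h] fun ω => (st t h ω, ac t h ω) :=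
    (measurable_st_historyAction st ac rw M.H t h).prodMk
      (measurable_ac_historyAction st ac rw M.H t h)
  have hst' : h < M.H → Measurable (st t (h + 1)) := fun h1 =>
    hd.st_meas t ht (h + 1) (Finset.mem_Icc.2 ⟨by omega, h1⟩)
  have hri : Integrable (rw t h) P := by
    refine Integrable.of_bound (hd.rw_meas t ht h hh).aestronglyMeasurable 1 ?_
    filter_upwards [hd.reward_mem t ht h hh] with ω hω
    rw [Real.norm_eq_abs, abs_of_nonneg hω.1]; exact hω.2
  have hVi : Integrable (fun ω => V (st t (h + 1) ω)) P := by
    refine Integrable.of_bound (hV.measurable_comp_st hst').aestronglyMeasurable M.H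
      (Filter.Eventually.of_forall fun ω => ?_)
    rw [Real.norm_eq_abs, abs_of_nonneg (hV.nonneg _)]; exact hV.le _
  have hbm : Measurable[historyAction M.H st ac rw t h]
      fun ω => M.bellman h V (st t h ω) (ac t h ω) := by
    have := (M.measurable_bellman hh hV.meas).comp hgraph
    exact this
  have hbi : Integrable (fun ω => M.bellman h V (st t h ω) (ac t h ω)) P := by
    refine Integrable.of_bound (hbm.mono hm le_rfl).aestronglyMeasurable (1 + M.H)
      (Filter.Eventually.of_forall fun ω => ?_)
    rw [Real.norm_eq_abs, abs_of_nonneg (M.bellman_nonneg hh hV.nonneg _ _)]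
    exact M.bellman_le hh hV.nonneg hV.le _ _
  have hVc : P[fun ω => V (st t (h + 1) ω) | historyAction M.H st ac rw t h]
      =ᵐ[P] fun ω => ∫ s', V s' ∂(M.transMeasure h (st t h ω) (ac t h ω)) := by
    rcases hV.last with h1 | h0
    · refine condExp_comp_of_law hm P (hst' h1)
        (κ := fun ω => M.transMeasure h (st t h ω) (ac t h ω)) ?_
        (fun ω => M.isProbabilityMeasure_transMeasure hh _ _)
        (hd.trans_law t ht h (Finset.mem_Ico.2 ⟨(Finset.mem_Icc.1 hh).1, h1⟩))
        hV.meas hV.nonneg hV.le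
      have := (M.measurable_transMeasure hh).comp hgraph
      exact this
    · rw [h0]; simp [condExp_const hm]
  have e : noise M st ac rw h V t = (rw t h + fun ω => V (st t (h + 1) ω))
      - fun ω => M.bellman h V (st t h ω) (ac t h ω) := rfl
  rw [e]
  have hsub := condExp_sub (hri.add hVi) hbi (historyAction M.H st ac rw t h)
  have hadd := condExp_add hri hVi (historyAction M.H st ac rw t h)
  have hb := condExp_of_stronglyMeasurable hm hbm.stronglyMeasurable hbi
  filter_upwards [hsub, hadd, hVc, hd.reward_mean t ht h hh] with ω h1 h2 h3 h4
  rw [h1, Pi.sub_apply, h2, Pi.add_apply, h3, hb]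
  have h4' : (P[rw t h | historyAction M.H st ac rw t h]) ω = M.rew h (st t h ω) (ac t h ω) := h4
  rw [h4']
  simp [MDP.bellman]

/-- The exponential process for the noise is a supermartingale over episodes. -/
theorem integral_exp_noiseExponent_le [SFinite ρ] (hd : IsAdaptiveData P M K st ac rw μ) {h : ℕ}
    (hh : h ∈ Finset.Icc 1 M.H) (hφ : Measurable fun x : S × A => φ h x.1 x.2)
    (hφ1 : ∀ s a, ‖φ h s a‖ ≤ 1) {V : S → ℝ} (hV : IsTarget M h V) {c : ℝ} (hc : 0 ≤ c)
    (x : EuclideanSpace ℝ (Fin d)) : ∀ n ≤ K + 1,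
    ∫ ω, Real.exp (noiseExponent M φ st ac rw h V c x n ω) ∂P ≤ 1 := by
  intro n
  induction n with
  | zero => intro _; simp [noiseExponent]
  | succ n ih =>
    intro hn
    rcases Nat.eq_zero_or_pos n with rfl | hn0
    · simp [noiseExponent]
    · have ht : n ∈ Finset.Icc 1 K := Finset.mem_Icc.2 ⟨hn0, by omega⟩
      refine le_trans ?_ (ih (by omega))
      have hB : (0 : ℝ) < 2 * M.H := by
        rw [Finset.mem_Icc] at hh
        have : (0 : ℝ) < M.H := by exact_mod_cast (by omega : 0 < M.H)
        linarith
      have hm := historyAction_le hd ht hh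
      have hstm := hd.st_meas n ht h hh
      have key := integral_mul_exp_le hm P
        (W := fun ω => Real.exp (noiseExponent M φ st ac rw h V c x n ω))
        (z := fun ω => c * inner ℝ x (φ h (st n h ω) (ac n h ω)))
        (η := noise M st ac rw h V n)
        (C := Real.exp (∑ _t ∈ Finset.Ico 1 n, c * ‖x‖ * (2 * M.H))) (Z := c * ‖x‖) (B := 2 * M.H)
        (Real.measurable_exp.comp (measurable_noiseExponent hh hφ hV c x n))
        (fun ω => (Real.exp_pos _).le)
        ((ae_noiseExponent_le hd hh hφ1 hV hc x (n := n) (by omega)).mono fun ω hω =>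
          Real.exp_le_exp.2 hω)
        ((measurable_inner_feature hφ (measurable_st_historyAction st ac rw M.H n h)
          (measurable_ac_historyAction st ac rw M.H n h) x).const_mul c)
        (fun ω => by
          rw [abs_mul, abs_of_nonneg hc]
          exact mul_le_mul_of_nonneg_left (abs_inner_feature_le hφ1 x _ _) hc)
        (measurable_noise hh hV hstm (hd.ac_meas n ht h hh) (hd.rw_meas n ht h hh) fun h1 =>
          hd.st_meas n ht (h + 1) (Finset.mem_Icc.2 ⟨by omega, h1⟩)).aestronglyMeasurable
        hB
        ((hd.reward_mem n ht h hh).mono fun ω hω => abs_noise_le hh hV hω)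
        (condExp_noise hd ht hh hV)
      refine le_trans (le_of_eq ?_) key
      refine integral_congr_ae (Filter.Eventually.of_forall fun ω => ?_)
      simp only [noiseExponent]
      rw [Finset.sum_Ico_succ_top hn0, Real.exp_add]

theorem measure_noiseExponent_ge_le [SFinite ρ] (hd : IsAdaptiveData P M K st ac rw μ) {h : ℕ}
    (hh : h ∈ Finset.Icc 1 M.H) (hφ : Measurable fun x : S × A => φ h x.1 x.2)
    (hφ1 : ∀ s a, ‖φ h s a‖ ≤ 1) {V : S → ℝ} (hV : IsTarget M h V) {c : ℝ} (hc : 0 ≤ c)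
    (x : EuclideanSpace ℝ (Fin d)) {n : ℕ} (hn : n ∈ Finset.Icc 1 (K + 1)) (ℓ : ℝ) :
    P {ω | ℓ ≤ noiseExponent M φ st ac rw h V c x n ω} ≤ ENNReal.ofReal (Real.exp (-ℓ)) := by
  rw [Finset.mem_Icc] at hn
  refine measure_exp_ge_le P ?_ (integral_exp_noiseExponent_le hd hh hφ hφ1 hV hc x n hn.2) ℓ
  have hmeas : Measurable (noiseExponent M φ st ac rw h V c x n) := by
    refine Finset.measurable_fun_sum _ fun t ht => ?_
    have ht : t ∈ Finset.Icc 1 K := by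
      simp only [Finset.mem_Ico, Finset.mem_Icc] at *; omega
    have h1 := measurable_inner_feature hφ (hd.st_meas t ht h hh) (hd.ac_meas t ht h hh) x
    have h2 := measurable_noise hh hV (hd.st_meas t ht h hh) (hd.ac_meas t ht h hh)
      (hd.rw_meas t ht h hh) fun h1 =>
      hd.st_meas t ht (h + 1) (Finset.mem_Icc.2 ⟨by omega, h1⟩)
    exact ((h1.const_mul c).mul h2).sub ((((h1.const_mul c).mul_const _).pow_const 2).div_const 2)
  refine Integrable.of_bound (Real.measurable_exp.comp hmeas).aestronglyMeasurable
    (Real.exp (∑ _t ∈ Finset.Ico 1 n, c * ‖x‖ * (2 * M.H)))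
    ((ae_noiseExponent_le hd hh hφ1 hV hc x hn.2).mono fun ω hω => ?_)
  rw [Real.norm_eq_abs, Real.abs_exp]
  exact Real.exp_le_exp.2 hω

end Noise

/-! ### Coverage of the optimal features by the data -/

section Coverage

variable {S A Ω : Type*} [MeasurableSpace S] [MeasurableSpace A]
  {ρ : Measure S} {M : MDP S A ρ} {K : ℕ}
  {st : ℕ → ℕ → Ω → S} {ac : ℕ → ℕ → Ω → A} {rw : ℕ → ℕ → Ω → ℝ} {μ : ℕ → Ω → Policy S A}
  {d : ℕ} {φ : ℕ → S → A → EuclideanSpace ℝ (Fin d)} {f : ℕ → S → A}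

section Covariance

theorem measurable_inner_optimal_feature {h : ℕ} (hf : ∀ h, Measurable (f h))
    (hφ : Measurable fun x : S × A => φ h x.1 x.2) (x : EuclideanSpace ℝ (Fin d)) :
    Measurable fun s => inner ℝ x (φ h s (f h s)) :=
  measurable_inner_feature (st := fun _ _ s => s) (ac := fun _ h s => f h s) (t := 0) hφ
    measurable_id (hf h) x

variable [SFinite ρ] (hf : ∀ h, Measurable (f h)) {h : ℕ}

theorem integrable_inner_sq (hh : h ∈ Finset.Icc 1 M.H)
    (hφ : Measurable fun x : S × A => φ h x.1 x.2) (hφ1 : ∀ s a, ‖φ h s a‖ ≤ 1)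
    (x : EuclideanSpace ℝ (Fin d)) :
    Integrable (fun s => inner ℝ x (φ h s (f h s)) ^ 2) (M.occupancy (detPolicy f hf) h) := by
  have := M.isProbabilityMeasure_occupancy (detPolicy f hf) hh
  refine Integrable.of_bound
    ((measurable_inner_optimal_feature hf hφ x).pow_const 2).aestronglyMeasurable (‖x‖ ^ 2)
    (Filter.Eventually.of_forall fun s => ?_)
  rw [norm_pow]
  gcongr
  exact abs_inner_feature_le hφ1 x _ _

variable [MeasurableEq A]

/-- The quadratic form of `Σ*_h` is the second moment of the optimal features. -/
theorem dotProduct_featureCov_mulVec (hh : h ∈ Finset.Icc 1 M.H)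
    (hφ : Measurable fun x : S × A => φ h x.1 x.2) (hφ1 : ∀ s a, ‖φ h s a‖ ≤ 1)
    (y x : EuclideanSpace ℝ (Fin d)) :
    y.ofLp ⬝ᵥ (M.featureCov φ (detPolicy f hf) h).mulVec x.ofLp
      = ∫ s, inner ℝ y (φ h s (f h s)) * inner ℝ x (φ h s (f h s))
        ∂(M.occupancy (detPolicy f hf) h) := by
  have := M.isProbabilityMeasure_occupancy (detPolicy f hf) hh
  have hcoord : ∀ i, Measurable fun s => (φ h s (f h s)).ofLp i := fun i => by
    have := measurable_inner_optimal_feature hf hφ (EuclideanSpace.single i (1 : ℝ))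
    simpa [inner_eq_dotProduct_ofLp] using this
  have hint : ∀ i j, Integrable (fun s => (φ h s (f h s)).ofLp i * (φ h s (f h s)).ofLp j)
      (M.occupancy (detPolicy f hf) h) := fun i j => by
    refine Integrable.of_bound ((hcoord i).mul (hcoord j)).aestronglyMeasurable 1
      (Filter.Eventually.of_forall fun s => ?_)
    rw [norm_mul, ← one_mul (1 : ℝ)]
    exact mul_le_mul (abs_coord_le_one (hφ1 _ _) i) (abs_coord_le_one (hφ1 _ _) j)
      (norm_nonneg _) zero_le_one
  have hentry : ∀ i j, M.featureCov φ (detPolicy f hf) h i j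
      = ∫ s, (φ h s (f h s)).ofLp i * (φ h s (f h s)).ofLp j
        ∂(M.occupancy (detPolicy f hf) h) := fun i j => by
    rw [MDP.featureCov, Matrix.of_apply]
    refine integral_congr_ae (Filter.Eventually.of_forall fun s => ?_)
    exact DecisionRule.avg_of_act_eq_pure (a := f h s) rfl _
  have hL : y.ofLp ⬝ᵥ (M.featureCov φ (detPolicy f hf) h).mulVec x.ofLp
      = ∑ i, ∑ j, ∫ s, y.ofLp i * ((φ h s (f h s)).ofLp i * (φ h s (f h s)).ofLp j * x.ofLp j)
        ∂(M.occupancy (detPolicy f hf) h) := by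
    simp only [dotProduct, Matrix.mulVec, Finset.mul_sum]
    refine Finset.sum_congr rfl fun i _ => Finset.sum_congr rfl fun j _ => ?_
    rw [hentry, ← integral_mul_const, ← integral_const_mul]
  rw [hL]
  have hint2 : ∀ i j, Integrable (fun s => y.ofLp i *
      ((φ h s (f h s)).ofLp i * (φ h s (f h s)).ofLp j * x.ofLp j))
      (M.occupancy (detPolicy f hf) h) := fun i j => ((hint i j).mul_const _).const_mul _
  simp_rw [← integral_finsetSum _ fun j (_ : j ∈ Finset.univ) => hint2 _ j]
  rw [← integral_finsetSum _ fun i _ => integrable_finsetSum _ fun j _ => hint2 i j]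
  refine integral_congr_ae (Filter.Eventually.of_forall fun s => ?_)
  simp only [inner_eq_dotProduct_ofLp, dotProduct, Finset.sum_mul_sum]
  refine Finset.sum_congr rfl fun i _ => Finset.sum_congr rfl fun j _ => ?_
  ring

theorem featureCov_quadratic (hh : h ∈ Finset.Icc 1 M.H)
    (hφ : Measurable fun x : S × A => φ h x.1 x.2) (hφ1 : ∀ s a, ‖φ h s a‖ ≤ 1)
    (x : EuclideanSpace ℝ (Fin d)) :
    x.ofLp ⬝ᵥ (M.featureCov φ (detPolicy f hf) h).mulVec x.ofLp
      = ∫ s, inner ℝ x (φ h s (f h s)) ^ 2 ∂(M.occupancy (detPolicy f hf) h) := by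
  rw [dotProduct_featureCov_mulVec hf hh hφ hφ1]
  simp only [sq]

theorem featureCov_quadratic_nonneg (hh : h ∈ Finset.Icc 1 M.H)
    (hφ : Measurable fun x : S × A => φ h x.1 x.2) (hφ1 : ∀ s a, ‖φ h s a‖ ≤ 1)
    (x : Fin d → ℝ) : 0 ≤ x ⬝ᵥ (M.featureCov φ (detPolicy f hf) h).mulVec x := by
  rw [featureCov_quadratic (x := WithLp.toLp 2 x) hf hh hφ hφ1]
  exact integral_nonneg fun s => sq_nonneg _

theorem featureCov_quadratic_le (hh : h ∈ Finset.Icc 1 M.H)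
    (hφ : Measurable fun x : S × A => φ h x.1 x.2) (hφ1 : ∀ s a, ‖φ h s a‖ ≤ 1)
    (x : EuclideanSpace ℝ (Fin d)) :
    x.ofLp ⬝ᵥ (M.featureCov φ (detPolicy f hf) h).mulVec x.ofLp ≤ ‖x‖ ^ 2 := by
  have := M.isProbabilityMeasure_occupancy (detPolicy f hf) hh
  rw [featureCov_quadratic hf hh hφ hφ1]
  refine (integral_mono (integrable_inner_sq hf hh hφ hφ1 x) (integrable_const (‖x‖ ^ 2))
    fun s => ?_).trans (by simp)
  exact sq_le_sq' (by have := abs_le.1 (abs_inner_feature_le hφ1 x s (f h s)); linarith [this.1])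
    (abs_le.1 (abs_inner_feature_le hφ1 x s (f h s))).2

theorem isHermitian_featureCov (hh : h ∈ Finset.Icc 1 M.H)
    (hφ : Measurable fun x : S × A => φ h x.1 x.2) (hφ1 : ∀ s a, ‖φ h s a‖ ≤ 1) :
    (M.featureCov φ (detPolicy f hf) h).IsHermitian := by
  ext i j
  have e : ∀ i j, M.featureCov φ (detPolicy f hf) h i j
      = (EuclideanSpace.single i (1 : ℝ) : EuclideanSpace ℝ (Fin d)).ofLp ⬝ᵥ
        (M.featureCov φ (detPolicy f hf) h).mulVec
        (EuclideanSpace.single j (1 : ℝ) : EuclideanSpace ℝ (Fin d)).ofLp := fun i j => by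
    simp [Matrix.mulVec_single]
  rw [Matrix.conjTranspose_apply, star_trivial, e, e, dotProduct_featureCov_mulVec hf hh hφ hφ1,
    dotProduct_featureCov_mulVec hf hh hφ hφ1]
  simp only [mul_comm]

/-- Almost every optimal feature is orthogonal to the kernel of `Σ*_h`. -/
theorem ae_inner_eq_zero_of_featureCov (hh : h ∈ Finset.Icc 1 M.H)
    (hφ : Measurable fun x : S × A => φ h x.1 x.2) (hφ1 : ∀ s a, ‖φ h s a‖ ≤ 1) :
    ∀ᵐ s ∂(M.occupancy (detPolicy f hf) h), ∀ y : EuclideanSpace ℝ (Fin d),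
      (M.featureCov φ (detPolicy f hf) h).mulVec y.ofLp = 0 → inner ℝ y (φ h s (f h s)) = 0 := by
  set G := M.featureCov φ (detPolicy f hf) h with hG
  let W : Submodule ℝ (EuclideanSpace ℝ (Fin d)) :=
    LinearMap.ker (Matrix.mulVecLin G ∘ₗ (WithLp.linearEquiv 2 ℝ (Fin d → ℝ)).toLinearMap)
  have hW : ∀ y, y ∈ W ↔ G.mulVec y.ofLp = 0 := fun y => by simp [W]
  have hone : ∀ y ∈ W, ∀ᵐ s ∂(M.occupancy (detPolicy f hf) h), inner ℝ y (φ h s (f h s)) = 0 := by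
    intro y hy
    have h1 := featureCov_quadratic (M := M) hf hh hφ hφ1 y
    rw [← hG, (hW y).1 hy, dotProduct_zero, eq_comm,
      integral_eq_zero_iff_of_nonneg (fun s => sq_nonneg _)
        (integrable_inner_sq hf hh hφ hφ1 y)] at h1
    filter_upwards [h1] with s hs
    simpa using hs
  obtain ⟨t, ht⟩ := (IsNoetherian.noetherian W : W.FG)
  have hall : ∀ᵐ s ∂(M.occupancy (detPolicy f hf) h), ∀ y ∈ t, inner ℝ y (φ h s (f h s)) = 0 :=
    (Finset.eventually_all t).2 fun y hy => hone y (ht ▸ Submodule.subset_span hy)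
  filter_upwards [hall] with s hs y hy
  have hyW : y ∈ Submodule.span ℝ (t : Set (EuclideanSpace ℝ (Fin d))) := ht ▸ (hW y).2 hy
  induction hyW using Submodule.span_induction with
  | mem z hz => exact hs z hz
  | zero => exact inner_zero_left _
  | add a b _ _ iha ihb =>
    rw [inner_add_left]
    have ha : G.mulVec a.ofLp = 0 := (hW a).1 (ht ▸ by assumption)
    have hb : G.mulVec b.ofLp = 0 := (hW b).1 (ht ▸ by assumption)
    rw [iha ha, ihb hb, add_zero]
  | smul c a _ iha =>
    have ha : G.mulVec a.ofLp = 0 := (hW a).1 (ht ▸ by assumption)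
    rw [inner_smul_left, iha ha, mul_zero]

end Covariance

/-- The visitation distribution of a policy covers that of the optimal policy, up to the least
positive value of its density: optimal visitation densities are at most `1`. -/
theorem mul_lintegral_occupancy_le [SFinite ρ] [MeasurableEq A] (hf : ∀ h, Measurable (f h)) {h : ℕ}
    (hh : h ∈ Finset.Icc 1 M.H) (ν : Policy S A) {c : ENNReal}
    (h1 : ∀ s, M.stateDens (detPolicy f hf) h s ≤ 1)
    (hc : ∀ s, 0 < M.stateDens (detPolicy f hf) h s → c ≤ M.saDens ν h s (f h s))
    {F : S → A → ENNReal} (hF : Measurable fun x : S × A => F x.1 x.2) :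
    c * ∫⁻ s, F s (f h s) ∂(M.occupancy (detPolicy f hf) h)
      ≤ ∫⁻ s, M.stateDens ν h s * ∫⁻ a, F s a ∂((ν h).act s).toMeasure ∂ρ := by
  have : MeasurableSingletonClass A := ⟨measurableSet_singleton_of_measurableEq⟩
  have hFf : Measurable fun s => F s (f h s) := hF.comp (measurable_id.prodMk (hf h))
  have hD := M.measurable_stateDens_policy (detPolicy f hf) hh
  have hDF : Measurable fun s => M.stateDens (detPolicy f hf) h s * F s (f h s) := hD.mul hFf
  rw [M.lintegral_occupancy _ hh hFf, ← lintegral_const_mul _ hDF]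
  refine lintegral_mono fun s => ?_
  rcases eq_or_ne (M.stateDens (detPolicy f hf) h s) 0 with h0 | h0
  · simp [h0]
  · have hle : F s (f h s) * (ν h).act s (f h s) ≤ ∫⁻ a, F s a ∂((ν h).act s).toMeasure := by
      calc F s (f h s) * (ν h).act s (f h s)
          = ∫⁻ a in {f h s}, F s a ∂((ν h).act s).toMeasure := by
            rw [lintegral_singleton, PMF.toMeasure_apply_singleton _ _ (measurableSet_singleton _)]
        _ ≤ _ := setLIntegral_le_lintegral _ _
    calc c * (M.stateDens (detPolicy f hf) h s * F s (f h s))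
        ≤ M.saDens ν h s (f h s) * (1 * F s (f h s)) := by
          gcongr
          · exact hc s (pos_iff_ne_zero.2 h0)
          · exact h1 s
      _ = M.stateDens ν h s * (F s (f h s) * (ν h).act s (f h s)) := by
          rw [MDP.saDens]; ring
      _ ≤ _ := by gcongr

open Classical in
/-- The squared component along `x` of the feature of `(s, a)`, counted only where `s` is visited by
the optimal policy and `a` is its action. -/
noncomputable def optTerm (M : MDP S A ρ) (φ : ℕ → S → A → EuclideanSpace ℝ (Fin d)) (f : ℕ → S → A)
    (π : Policy S A) (h : ℕ) (x : EuclideanSpace ℝ (Fin d)) (s : S) (a : A) : ℝ :=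
  if 0 < M.stateDens π h s ∧ a = f h s then inner ℝ x (φ h s a) ^ 2 else 0

theorem optTerm_nonneg (π : Policy S A) (h : ℕ) (x : EuclideanSpace ℝ (Fin d)) (s : S) (a : A) :
    0 ≤ optTerm M φ f π h x s a := by
  rw [optTerm]; split_ifs <;> positivity

theorem optTerm_le_sq (π : Policy S A) (h : ℕ) (x : EuclideanSpace ℝ (Fin d)) (s : S) (a : A) :
    optTerm M φ f π h x s a ≤ inner ℝ x (φ h s a) ^ 2 := by
  rw [optTerm]; split_ifs <;> first | exact le_rfl | positivity

theorem optTerm_le_one (π : Policy S A) {h : ℕ} (hφ1 : ∀ s a, ‖φ h s a‖ ≤ 1)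
    {x : EuclideanSpace ℝ (Fin d)} (hx : ‖x‖ ≤ 1) (s : S) (a : A) :
    optTerm M φ f π h x s a ≤ 1 :=
  (optTerm_le_sq π h x s a).trans
    ((sq_le_one_iff_abs_le_one _).2 ((abs_inner_feature_le hφ1 x s a).trans hx))

theorem measurable_optTerm [SFinite ρ] [MeasurableEq A] (hf : ∀ h, Measurable (f h))
    (π : Policy S A) {h : ℕ} (hh : h ∈ Finset.Icc 1 M.H)
    (hφ : Measurable fun x : S × A => φ h x.1 x.2) (x : EuclideanSpace ℝ (Fin d)) :
    Measurable fun y : S × A => optTerm M φ f π h x y.1 y.2 := by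
  have hD := M.measurable_stateDens_policy π hh
  refine Measurable.ite ?_ (hφ.const_inner.pow_const 2) measurable_const
  have h1 : MeasurableSet {y : S × A | 0 < M.stateDens π h y.1} :=
    measurableSet_lt measurable_const (hD.comp measurable_fst)
  have h2 : MeasurableSet {y : S × A | y.2 = f h y.1} :=
    measurableSet_eq_fun measurable_snd ((hf h).comp measurable_fst)
  exact h1.inter h2

theorem exp_neg_le_one_sub_half {g : ℝ} (h0 : 0 ≤ g) (h1 : g ≤ 1) : Real.exp (-g) ≤ 1 - g / 2 := by
  have h2 := Real.add_one_le_exp g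
  rw [Real.exp_neg]
  refine inv_le_of_inv_le₀ (by linarith) ?_
  refine le_trans ?_ h2
  rw [inv_le_iff_one_le_mul₀ (by linarith)]
  nlinarith

/-- The exponent of the supermartingale for the coverage in the direction `x`. -/
noncomputable def coverExponent (M : MDP S A ρ) (φ : ℕ → S → A → EuclideanSpace ℝ (Fin d))
    (f : ℕ → S → A) (π : Policy S A) (st : ℕ → ℕ → Ω → S) (ac : ℕ → ℕ → Ω → A) (h : ℕ) (q : ℝ)
    (x : EuclideanSpace ℝ (Fin d)) (n : ℕ) (ω : Ω) : ℝ :=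
  ∑ t ∈ Finset.Ico 1 n, (q / 2 - optTerm M φ f π h x (st t h ω) (ac t h ω))

theorem coverExponent_le (π : Policy S A) (h : ℕ) {q : ℝ}
    (x : EuclideanSpace ℝ (Fin d)) (n : ℕ) (ω : Ω) :
    coverExponent M φ f π st ac h q x n ω ≤ ∑ _t ∈ Finset.Ico 1 n, q / 2 :=
  Finset.sum_le_sum fun t _ => by
    have := optTerm_nonneg (M := M) (φ := φ) (f := f) π h x (st t h ω) (ac t h ω)
    linarith

theorem measurable_optTerm_data {m : MeasurableSpace Ω} [SFinite ρ] [MeasurableEq A]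
    (hf : ∀ h, Measurable (f h))
    (π : Policy S A) {h : ℕ} (hh : h ∈ Finset.Icc 1 M.H)
    (hφ : Measurable fun x : S × A => φ h x.1 x.2) (x : EuclideanSpace ℝ (Fin d)) {t : ℕ}
    (hst : Measurable[m] (st t h)) (hac : Measurable[m] (ac t h)) :
    Measurable[m] fun ω => optTerm M φ f π h x (st t h ω) (ac t h ω) := by
  have := (measurable_optTerm hf π hh hφ x).comp (hst.prodMk hac)
  exact this

variable [mΩ : MeasurableSpace Ω] {P : Measure Ω}

/-- One step of the multiplicative lower-tail bound for a sum of `[0, 1]`-valued terms whose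
conditional means are at least `q`. -/
theorem integral_mul_exp_neg_le {W g : Ω → ℝ} {q : ℝ} (hW0 : ∀ ω, 0 ≤ W ω) (hWi : Integrable W P)
    (hg0 : ∀ ω, 0 ≤ g ω) (hg1 : ∀ ω, g ω ≤ 1) (hgm : AEStronglyMeasurable g P)
    (hq : q * ∫ ω, W ω ∂P ≤ ∫ ω, W ω * g ω ∂P) :
    ∫ ω, W ω * Real.exp (q / 2 - g ω) ∂P ≤ ∫ ω, W ω ∂P := by
  have hWg : Integrable (fun ω => W ω * g ω) P := by
    refine hWi.mul_bdd (c := 1) hgm (Filter.Eventually.of_forall fun ω => ?_)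
    rw [Real.norm_eq_abs, abs_of_nonneg (hg0 ω)]; exact hg1 ω
  have hi : Integrable (fun ω => Real.exp (q / 2) * (W ω - W ω * g ω * (1 / 2))) P :=
    (hWi.sub (hWg.mul_const (1 / 2))).const_mul _
  have hI0 : 0 ≤ ∫ ω, W ω ∂P := integral_nonneg hW0
  calc ∫ ω, W ω * Real.exp (q / 2 - g ω) ∂P
      ≤ ∫ ω, Real.exp (q / 2) * (W ω - W ω * g ω * (1 / 2)) ∂P := by
        refine integral_mono_of_nonneg (Filter.Eventually.of_forall fun ω =>
          mul_nonneg (hW0 ω) (Real.exp_pos _).le) hi (Filter.Eventually.of_forall fun ω => ?_)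
        have := exp_neg_le_one_sub_half (hg0 ω) (hg1 ω)
        simp only [sub_eq_add_neg (q / 2), Real.exp_add]
        calc W ω * (Real.exp (q / 2) * Real.exp (-g ω))
            ≤ W ω * (Real.exp (q / 2) * (1 - g ω / 2)) := by
              gcongr
              exact hW0 ω
          _ = _ := by ring
    _ = Real.exp (q / 2) * (∫ ω, W ω ∂P - (∫ ω, W ω * g ω ∂P) * (1 / 2)) := by
        rw [integral_const_mul, integral_sub hWi (hWg.mul_const _), integral_mul_const]
    _ ≤ Real.exp (q / 2) * ((1 - q / 2) * ∫ ω, W ω ∂P) := by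
        gcongr; linarith
    _ ≤ Real.exp (q / 2) * (Real.exp (-(q / 2)) * ∫ ω, W ω ∂P) := by
        gcongr
        have := Real.add_one_le_exp (-(q / 2)); linarith
    _ = ∫ ω, W ω ∂P := by
        rw [← mul_assoc, ← Real.exp_add]; simp

variable [IsProbabilityMeasure P]

/-- The exponential process for the coverage is a supermartingale over episodes: given the past
episodes, the conditional mean of `optTerm` is at least `q`. -/
theorem integral_exp_coverExponent_le [SFinite ρ] [MeasurableEq A]
    (hd : IsAdaptiveData P M K st ac rw μ) (hf : ∀ h, Measurable (f h)) {h : ℕ}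
    (hh : h ∈ Finset.Icc 1 M.H) (hφ : Measurable fun x : S × A => φ h x.1 x.2)
    (hφ1 : ∀ s a, ‖φ h s a‖ ≤ 1) {c : ENNReal} (hctop : c ≠ ⊤)
    (h1 : ∀ s, M.stateDens (detPolicy f hf) h s ≤ 1)
    (hc : ∀ t ∈ Finset.Icc 1 K, ∀ ω, ∀ s, 0 < M.stateDens (detPolicy f hf) h s →
      c ≤ M.saDens (μ t ω) h s (f h s))
    {x : EuclideanSpace ℝ (Fin d)} (hx : ‖x‖ ≤ 1) {q : ℝ}
    (hq : q = c.toReal * ∫ s, inner ℝ x (φ h s (f h s)) ^ 2 ∂(M.occupancy (detPolicy f hf) h)) :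
    ∀ n ≤ K + 1,
      Integrable (fun ω => Real.exp (coverExponent M φ f (detPolicy f hf) st ac h q x n ω)) P ∧
      ∫ ω, Real.exp (coverExponent M φ f (detPolicy f hf) st ac h q x n ω) ∂P ≤ 1 := by
  set π := detPolicy f hf with hπ
  have hint : ∀ n ≤ K + 1,
      Integrable (fun ω => Real.exp (coverExponent M φ f π st ac h q x n ω)) P := by
    intro n hn
    have hmeas : Measurable (coverExponent M φ f π st ac h q x n) := by
      refine Finset.measurable_fun_sum _ fun t ht => ?_
      have ht : t ∈ Finset.Icc 1 K := by
        simp only [Finset.mem_Ico, Finset.mem_Icc] at *; omega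
      exact measurable_const.sub (measurable_optTerm_data hf π hh hφ x (hd.st_meas t ht h hh)
        (hd.ac_meas t ht h hh))
    refine Integrable.of_bound (Real.measurable_exp.comp hmeas).aestronglyMeasurable
      (Real.exp (∑ _t ∈ Finset.Ico 1 n, q / 2)) (Filter.Eventually.of_forall fun ω => ?_)
    rw [Real.norm_eq_abs, Real.abs_exp]
    exact Real.exp_le_exp.2 (coverExponent_le π h x n ω)
  intro n hn
  refine ⟨hint n hn, ?_⟩
  induction n with
  | zero => simp [coverExponent]
  | succ n ih =>
    rcases Nat.eq_zero_or_pos n with rfl | hn0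
    · simp [coverExponent]
    · have ht : n ∈ Finset.Icc 1 K := Finset.mem_Icc.2 ⟨hn0, by omega⟩
      refine le_trans ?_ (ih (by omega))
      have hg := measurable_optTerm_data (M := M) hf π hh hφ x (hd.st_meas n ht h hh)
        (hd.ac_meas n ht h hh)
      have hWi := hint n (by omega)
      set W : Ω → ℝ := fun ω => Real.exp (coverExponent M φ f π st ac h q x n ω) with hWdef
      have hW0 : ∀ ω, 0 ≤ W ω := fun ω => (Real.exp_pos _).le
      have hWm : Measurable[history M.H st ac rw n 1] W := by
        refine Real.measurable_exp.comp (Finset.measurable_fun_sum _ fun t ht' => ?_)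
        have hle := stepInfo_le_history st ac rw ht' hh 1
        exact measurable_const.sub (measurable_optTerm_data hf π hh hφ x
          ((comap_measurable (st t h)).mono ((le_sup_left.trans le_sup_left).trans hle) le_rfl)
          ((comap_measurable (ac t h)).mono ((le_sup_right.trans le_sup_left).trans hle) le_rfl))
      have key := integral_mul_exp_neg_le (P := P) (W := W)
        (g := fun ω => optTerm M φ f π h x (st n h ω) (ac n h ω)) (q := q) hW0 hWi
        (fun ω => optTerm_nonneg π h x _ _) (fun ω => optTerm_le_one π hφ1 hx _ _)
        hg.aestronglyMeasurable ?_
      · refine le_trans (le_of_eq ?_) key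
        refine integral_congr_ae (Filter.Eventually.of_forall fun ω => ?_)
        simp only [hWdef, coverExponent]
        rw [Finset.sum_Ico_succ_top hn0, Real.exp_add]
      · have hWg : Integrable (fun ω => W ω * optTerm M φ f π h x (st n h ω) (ac n h ω)) P := by
          refine hWi.mul_bdd (c := 1) hg.aestronglyMeasurable
            (Filter.Eventually.of_forall fun ω => ?_)
          rw [Real.norm_eq_abs, abs_of_nonneg (optTerm_nonneg π h x _ _)]
          exact optTerm_le_one π hφ1 hx _ _
        have hnn : ∀ ω, 0 ≤ W ω * optTerm M φ f π h x (st n h ω) (ac n h ω) := fun ω =>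
          mul_nonneg (hW0 ω) (optTerm_nonneg π h x _ _)
        have hq0 : 0 ≤ q := by
          rw [hq]; exact mul_nonneg ENNReal.toReal_nonneg (integral_nonneg fun s => sq_nonneg _)
        rw [← ENNReal.ofReal_le_ofReal_iff (integral_nonneg hnn),
          ofReal_integral_eq_lintegral_ofReal hWg (Filter.Eventually.of_forall hnn),
          ENNReal.ofReal_mul hq0,
          ofReal_integral_eq_lintegral_ofReal hWi (Filter.Eventually.of_forall hW0)]
        have hFm : Measurable[((history M.H st ac rw n 1).prod inferInstance).prod inferInstance]
            fun y : (Ω × S) × A => ENNReal.ofReal (W y.1.1) *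
              ENNReal.ofReal (optTerm M φ f π h x y.1.2 y.2) := by
          have aux : ∀ {Z : Type _} [MeasurableSpace Z] (W : Z → ℝ), Measurable W →
              Measurable fun y : (Z × S) × A => ENNReal.ofReal (W y.1.1) *
              ENNReal.ofReal (optTerm M φ f π h x y.1.2 y.2) := by
            intro Z _ W hW
            have h2 : Measurable fun y : (Z × S) × A => (y.1.2, y.2) := by fun_prop
            have h3 := (measurable_optTerm (M := M) hf π hh hφ x).comp h2
            exact (hW.comp (measurable_fst.comp measurable_fst)).ennreal_ofReal.mul
              h3.ennreal_ofReal
          exact @aux Ω (history M.H st ac rw n 1) W hWm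
        have e := lintegral_stateAction_eq hd ht hh hFm
        simp only [← ENNReal.ofReal_mul (hW0 _)] at e
        rw [e, mul_comm, ← lintegral_mul_const'' _ hWi.aestronglyMeasurable.aemeasurable.ennreal_ofReal]
        refine lintegral_mono fun ω => ?_
        -- Concentrability is used here, to pass from the data policy to the optimal one.
        have hcomp := mul_lintegral_occupancy_le hf hh (μ n ω) h1 (hc n ht ω)
          (F := fun s a => ENNReal.ofReal (W ω * optTerm M φ f π h x s a))
          ((measurable_optTerm hf π hh hφ x).const_mul (W ω)).ennreal_ofReal
        refine le_trans (le_of_eq ?_) hcomp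
        have hD := M.measurable_stateDens_policy π hh
        have e2 : ∫⁻ s, ENNReal.ofReal (W ω * optTerm M φ f π h x s (f h s)) ∂(M.occupancy π h)
            = ∫⁻ s, ENNReal.ofReal (W ω) * ENNReal.ofReal (inner ℝ x (φ h s (f h s)) ^ 2)
              ∂(M.occupancy π h) := by
          refine lintegral_congr_ae ?_
          have hpos : ∀ᵐ s ∂(M.occupancy π h), M.stateDens π h s ≠ 0 := by
            rw [MDP.occupancy, ae_withDensity_iff hD]
            exact Filter.Eventually.of_forall fun s hs => hs
          filter_upwards [hpos] with s hs
          rw [ENNReal.ofReal_mul (hW0 ω), optTerm, if_pos ⟨pos_iff_ne_zero.2 hs, rfl⟩]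
        have e3 := ofReal_integral_eq_lintegral_ofReal (integrable_inner_sq (M := M) hf hh hφ hφ1 x)
          (Filter.Eventually.of_forall fun s => sq_nonneg _)
        have hsq : Measurable fun s => ENNReal.ofReal (inner ℝ x (φ h s (f h s)) ^ 2) :=
          ((measurable_inner_optimal_feature hf hφ x).pow_const 2).ennreal_ofReal
        rw [e2, lintegral_const_mul _ hsq, ← e3, hq, ENNReal.ofReal_mul ENNReal.toReal_nonneg,
          ENNReal.ofReal_toReal hctop]
        ring

theorem measure_coverExponent_ge_le [SFinite ρ] [MeasurableEq A]
    (hd : IsAdaptiveData P M K st ac rw μ) (hf : ∀ h, Measurable (f h)) {h : ℕ}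
    (hh : h ∈ Finset.Icc 1 M.H) (hφ : Measurable fun x : S × A => φ h x.1 x.2)
    (hφ1 : ∀ s a, ‖φ h s a‖ ≤ 1) {c : ENNReal} (hctop : c ≠ ⊤)
    (h1 : ∀ s, M.stateDens (detPolicy f hf) h s ≤ 1)
    (hc : ∀ t ∈ Finset.Icc 1 K, ∀ ω, ∀ s, 0 < M.stateDens (detPolicy f hf) h s →
      c ≤ M.saDens (μ t ω) h s (f h s))
    {x : EuclideanSpace ℝ (Fin d)} (hx : ‖x‖ ≤ 1) {q : ℝ}
    (hq : q = c.toReal * ∫ s, inner ℝ x (φ h s (f h s)) ^ 2 ∂(M.occupancy (detPolicy f hf) h))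
    {n : ℕ} (hn : n ≤ K + 1) (ℓ : ℝ) :
    P {ω | ℓ ≤ coverExponent M φ f (detPolicy f hf) st ac h q x n ω}
      ≤ ENNReal.ofReal (Real.exp (-ℓ)) := by
  obtain ⟨h2, h3⟩ := integral_exp_coverExponent_le hd hf hh hφ hφ1 hctop h1 hc hx hq n hn
  exact measure_exp_ge_le P h2 h3 ℓ

/-- Almost surely, the features of the data at states visited by the optimal policy, under optimal
actions, are orthogonal to the kernel of `Σ*_h`. -/
theorem ae_data_inner_eq_zero [SFinite ρ] [MeasurableEq A]
    (hd : IsAdaptiveData P M K st ac rw μ) (hf : ∀ h, Measurable (f h)) {t h : ℕ}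
    (ht : t ∈ Finset.Icc 1 K) (hh : h ∈ Finset.Icc 1 M.H)
    (hφ : Measurable fun x : S × A => φ h x.1 x.2) (hφ1 : ∀ s a, ‖φ h s a‖ ≤ 1) :
    ∀ᵐ ω ∂P, 0 < M.stateDens (detPolicy f hf) h (st t h ω) → ∀ y : EuclideanSpace ℝ (Fin d),
      (M.featureCov φ (detPolicy f hf) h).mulVec y.ofLp = 0 →
        inner ℝ y (φ h (st t h ω) (f h (st t h ω))) = 0 := by
  have h1 := ae_inner_eq_zero_of_featureCov (M := M) hf hh hφ hφ1
  rw [MDP.occupancy, ae_withDensity_iff (M.measurable_stateDens_policy _ hh)] at h1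
  obtain ⟨N, hsub, hNm, hN0⟩ := exists_measurable_superset_of_null h1
  have hFm : Measurable[(history M.H st ac rw t 1).prod inferInstance]
      fun y : Ω × S => N.indicator (fun _ => (1 : ENNReal)) y.2 := by
    have := (measurable_const.indicator hNm : Measurable (N.indicator fun _ => (1 : ENNReal))).comp
      (@measurable_snd Ω S (history M.H st ac rw t 1) _)
    exact this
  have h2 := lintegral_state_eq hd ht h (Finset.mem_Icc.1 hh).1 (Finset.mem_Icc.1 hh).2 _ hFm
  have h3 : ∀ ω, ∫⁻ s, M.stateDens (μ t ω) h s * N.indicator (fun _ => (1 : ENNReal)) s ∂ρ = 0 := by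
    intro ω
    have hae : (fun s => M.stateDens (μ t ω) h s * N.indicator (fun _ => (1 : ENNReal)) s)
        =ᵐ[ρ] 0 := by
      have : ∀ᵐ s ∂ρ, s ∉ N := measure_eq_zero_iff_ae_notMem.1 hN0
      filter_upwards [this] with s hs
      simp [hs]
    rw [lintegral_congr_ae hae]; simp
  have hstm := hd.st_meas t ht h hh
  simp only [h3, lintegral_zero] at h2
  have h4 : Measurable fun ω => N.indicator (fun _ => (1 : ENNReal)) (st t h ω) := by
    have := (measurable_const.indicator hNm : Measurable (N.indicator fun _ => (1 : ENNReal))).comp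
      hstm
    exact this
  filter_upwards [(lintegral_eq_zero_iff h4).1 h2] with ω hω
  have hnot : st t h ω ∉ N := fun hmem => by simp [hmem] at hω
  by_contra hcon
  refine hnot (hsub ?_)
  intro hgood
  exact hcon fun hp => hgood hp.ne'

end Coverage

/-! ### Uniform events -/

/-- The union bound over a grid with `O(D ^ 14)` values for each of at most `3 d²` coordinates,
against tails of size `D ^ (-48 d²)`. -/
theorem grid_card_mul_exp_le {D : ℝ} (hD : 4 ≤ D) {d c : ℕ} (hd : 1 ≤ d) (hc : c ≤ 3 * d ^ 2) :
    (2 * (⌈D ^ 14⌉₊ : ℕ) + 1 : ENNReal) ^ c *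
        ENNReal.ofReal (Real.exp (-(48 * (d : ℝ) ^ 2 * Real.log D)))
      ≤ ENNReal.ofReal ((D ^ 3)⁻¹) := by
  have hD0 : 0 < D := by linarith
  have h1 : (2 * (⌈D ^ 14⌉₊ : ℕ) + 1 : ENNReal) = ENNReal.ofReal (2 * (⌈D ^ 14⌉₊ : ℕ) + 1) := by
    rw [ENNReal.ofReal_add (by positivity) zero_le_one, ENNReal.ofReal_mul zero_le_two]
    simp
  have h2 : (2 * (⌈D ^ 14⌉₊ : ℕ) + 1 : ℝ) ≤ D ^ 15 := by
    have := (Nat.ceil_lt_add_one (by positivity : 0 ≤ D ^ 14)).le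
    have h3 : (4 : ℝ) ^ 14 ≤ D ^ 14 := pow_le_pow_left₀ (by norm_num) hD 14
    have h4 : D ^ 15 = D * D ^ 14 := by ring
    rw [h4]
    nlinarith
  have h3 : Real.exp (-(48 * (d : ℝ) ^ 2 * Real.log D)) = (D ^ (48 * d ^ 2))⁻¹ := by
    rw [Real.exp_neg]
    congr 1
    have : 48 * (d : ℝ) ^ 2 * Real.log D = ((48 * d ^ 2 : ℕ) : ℝ) * Real.log D := by push_cast; ring
    rw [this, Real.exp_nat_mul, Real.exp_log hD0]
  rw [h1, ← ENNReal.ofReal_pow (by positivity), ← ENNReal.ofReal_mul (by positivity), h3]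
  refine ENNReal.ofReal_le_ofReal ?_
  have h4 : (2 * (⌈D ^ 14⌉₊ : ℕ) + 1 : ℝ) ^ c ≤ D ^ (45 * d ^ 2) := by
    calc _ ≤ (D ^ 15) ^ c := pow_le_pow_left₀ (by positivity) h2 c
      _ = D ^ (15 * c) := by rw [pow_mul]
      _ ≤ D ^ (45 * d ^ 2) := pow_le_pow_right₀ (by linarith) (by omega)
  have h5 : 3 ≤ 3 * d ^ 2 := by have := Nat.one_le_pow 2 d hd; omega
  rw [← div_eq_mul_inv, div_le_iff₀ (by positivity)]
  refine h4.trans ?_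
  rw [inv_mul_eq_div, le_div_iff₀ (by positivity), ← pow_add]
  exact pow_le_pow_right₀ (by linarith) (by omega)

section Events

variable {S A Ω : Type*} [MeasurableSpace S] [MeasurableSpace A]
  {ρ : Measure S} {M : MDP S A ρ} {K : ℕ}
  {st : ℕ → ℕ → Ω → S} {ac : ℕ → ℕ → Ω → A} {rw : ℕ → ℕ → Ω → ℝ} {μ : ℕ → Ω → Policy S A}
  {d : ℕ} {φ : ℕ → S → A → EuclideanSpace ℝ (Fin d)}

/-- The truncated pessimistic action value with weight `w` and bonus `√(φᵀ L φ)`. -/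
noncomputable def pessimisticValue (M : MDP S A ρ) (φ : ℕ → S → A → EuclideanSpace ℝ (Fin d))
    (h : ℕ) (w : Fin d → ℝ) (L : Matrix (Fin d) (Fin d) ℝ) (s : S) (a : A) : ℝ :=
  max (min ((φ h s a).ofLp ⬝ᵥ w - Real.sqrt ((φ h s a).ofLp ⬝ᵥ L.mulVec (φ h s a).ofLp))
    ((M.H : ℝ) - h + 1)) 0

theorem abs_pessimisticValue_sub_le {h : ℕ} (hφ1 : ∀ s a, ‖φ h s a‖ ≤ 1) {w w' : Fin d → ℝ}
    {L L' : Matrix (Fin d) (Fin d) ℝ} {ε : ℝ} (hw : ∀ i, |w i - w' i| ≤ ε)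
    (hL : ∀ i j, |L i j - L' i j| ≤ ε) (s : S) (a : A) :
    |pessimisticValue M φ h w L s a - pessimisticValue M φ h w' L' s a|
      ≤ d * ε + Real.sqrt (d * (d * ε)) := by
  refine (abs_max_sub_max_le_abs _ _ _).trans ((abs_min_sub_min_le_max _ _ _ _).trans ?_)
  rw [sub_self, abs_zero, max_eq_left (abs_nonneg _)]
  have h1 := abs_dotProduct_sub_le (hφ1 s a) hw
  have h2 := (abs_sqrt_sub_sqrt_le ((φ h s a).ofLp ⬝ᵥ L.mulVec (φ h s a).ofLp)
    ((φ h s a).ofLp ⬝ᵥ L'.mulVec (φ h s a).ofLp)).trans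
    (Real.sqrt_le_sqrt (abs_quadratic_sub_le (hφ1 s a) hL))
  rw [sub_sub_sub_comm]
  exact (abs_sub _ _).trans (add_le_add h1 h2)

/-- `V` is the greatest pessimistic value of the step `h + 1` over the actions in `G s`; after the
last step it vanishes. -/
def IsEnvelope (M : MDP S A ρ) (φ : ℕ → S → A → EuclideanSpace ℝ (Fin d)) (G : S → Set A) (h : ℕ)
    (V : S → ℝ) (w : Fin d → ℝ) (L : Matrix (Fin d) (Fin d) ℝ) : Prop :=
  (h < M.H ∧ ∀ s, (∀ a ∈ G s, pessimisticValue M φ (h + 1) w L s a ≤ V s) ∧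
      ∃ a ∈ G s, V s = pessimisticValue M φ (h + 1) w L s a) ∨
    (h = M.H ∧ V = fun _ => 0)

theorem IsEnvelope.abs_sub_le {G : S → Set A} {h : ℕ} (hφ1 : h < M.H → ∀ s a, ‖φ (h + 1) s a‖ ≤ 1)
    {V V' : S → ℝ} {w w' : Fin d → ℝ} {L L' : Matrix (Fin d) (Fin d) ℝ} {ε : ℝ} (hε : 0 ≤ ε)
    (hw : ∀ i, |w i - w' i| ≤ ε) (hL : ∀ i j, |L i j - L' i j| ≤ ε)
    (hV : IsEnvelope M φ G h V w L) (hV' : IsEnvelope M φ G h V' w' L') (s : S) :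
    |V s - V' s| ≤ d * ε + Real.sqrt (d * (d * ε)) := by
  rcases hV with ⟨hh, hV⟩ | ⟨hh, hV⟩
  · rcases hV' with ⟨-, hV'⟩ | ⟨hh', -⟩
    · obtain ⟨a, ha, hVa⟩ := (hV s).2
      obtain ⟨b, hb, hVb⟩ := (hV' s).2
      have h1 := abs_le.1 (abs_pessimisticValue_sub_le (M := M) (hφ1 hh) hw hL s a)
      have h2 := abs_le.1 (abs_pessimisticValue_sub_le (M := M) (hφ1 hh) hw hL s b)
      have h3 := (hV' s).1 a ha
      have h4 := (hV s).1 b hb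
      rw [abs_le]
      constructor <;> linarith [h1.1, h1.2, h2.1, h2.2]
    · omega
  · rcases hV' with ⟨hh', -⟩ | ⟨-, hV'⟩
    · omega
    · rw [hV, hV']
      simp only [sub_self, abs_zero]
      positivity

variable [mΩ : MeasurableSpace Ω] {P : Measure Ω} [IsProbabilityMeasure P]

/-- With high probability the regression noise is small in all directions and for all value
functions that the algorithm may produce. -/
theorem exists_regression_event [SFinite ρ] (hd : IsAdaptiveData P M K st ac rw μ) {h k : ℕ}
    (hh : h ∈ Finset.Icc 1 M.H) (hk : k ∈ Finset.Icc 1 (K + 1))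
    (hφ : Measurable fun x : S × A => φ h x.1 x.2)
    (hφ1 : ∀ h ∈ Finset.Icc 1 M.H, ∀ s a, ‖φ h s a‖ ≤ 1) (G : S → Set A) {D : ℝ} (hD4 : 4 ≤ D)
    (hd1 : 1 ≤ d) (hDk : (d : ℝ) * k ≤ D) (hL1 : 1 ≤ Real.log D) :
    ∃ B : Set Ω, P B ≤ ENNReal.ofReal ((D ^ 3)⁻¹) ∧ ∀ ω ∉ B,
      (∀ t ∈ Finset.Ico 1 k, rw t h ω ∈ Set.Icc (0 : ℝ) 1) →
      ∀ (V : S → ℝ) (w : Fin d → ℝ) (L : Matrix (Fin d) (Fin d) ℝ), IsTarget M h V →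
        IsEnvelope M φ G h V w L → (∀ i, |w i| ≤ D ^ 12) → (∀ i j, |L i j| ≤ D ^ 12) →
        ∀ x : EuclideanSpace ℝ (Fin d), ‖x‖ ≤ 1 →
          ∑ t ∈ Finset.Ico 1 k, inner ℝ x (φ h (st t h ω) (ac t h ω)) ^ 2 ≤ 1 →
          ∑ t ∈ Finset.Ico 1 k, inner ℝ x (φ h (st t h ω) (ac t h ω)) *
            noise M st ac rw h V t ω ≤ 106 * (d * M.H * Real.log D) := by
  have hD0 : 0 < D := by linarith
  have hH1 : (1 : ℝ) ≤ M.H := by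
    rw [Finset.mem_Icc] at hh; exact_mod_cast hh.1.trans hh.2
  have hdR : (1 : ℝ) ≤ d := by exact_mod_cast hd1
  have hkR : (1 : ℝ) ≤ k := by rw [Finset.mem_Icc] at hk; exact_mod_cast hk.1
  have hT : 0 < D ^ 2 := by positivity
  -- This scale balances the threshold `48 d² log D` of the tail bound against the quadratic
  -- compensator, which it turns into `d² / 2 * ∑ ⟨x, φ⟩²`.
  set c : ℝ := d / (2 * M.H) with hc
  have hc0 : 0 < c := by positivity
  let e : (EuclideanSpace ℝ (Fin d) × (S → ℝ)) × ((Fin d → ℝ) × Matrix (Fin d) (Fin d) ℝ) →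
      Fin d ⊕ (Fin d ⊕ Fin d × Fin d) → ℝ := fun θ =>
    Sum.elim (fun i => θ.1.1.ofLp i) (Sum.elim θ.2.1 fun p => θ.2.2 p.1 p.2)
  let valid : Set ((EuclideanSpace ℝ (Fin d) × (S → ℝ)) ×
      ((Fin d → ℝ) × Matrix (Fin d) (Fin d) ℝ)) :=
    {θ | ‖θ.1.1‖ ≤ 1 ∧ IsTarget M h θ.1.2 ∧ IsEnvelope M φ G h θ.1.2 θ.2.1 θ.2.2 ∧
      (∀ i, |θ.2.1 i| ≤ D ^ 12) ∧ ∀ i j, |θ.2.2 i j| ≤ D ^ 12}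
  have hD12 : 1 ≤ D ^ 12 := one_le_pow₀ (by linarith)
  obtain ⟨B, hB, hcov⟩ := exists_grid_cover P e valid hT ⌈D ^ 14⌉₊
    (by
      rintro ⟨⟨x, V⟩, w, L⟩ ⟨hx, -, -, hw, hL⟩ i
      have hle : ∀ y : ℝ, |y| ≤ D ^ 12 → |y| * D ^ 2 ≤ (⌈D ^ 14⌉₊ : ℕ) := fun y hy => by
        calc |y| * D ^ 2 ≤ D ^ 12 * D ^ 2 := by gcongr
          _ = D ^ 14 := by ring
          _ ≤ _ := Nat.le_ceil _
      rcases i with i | i | ⟨i, j⟩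
      · exact hle _ ((abs_coord_le_one hx i).trans hD12)
      · exact hle _ (hw i)
      · exact hle _ (hL i j))
    (fun θ => {ω | 48 * (d : ℝ) ^ 2 * Real.log D ≤ noiseExponent M φ st ac rw h θ.1.2 c θ.1.1 k ω})
    (ENNReal.ofReal (Real.exp (-(48 * (d : ℝ) ^ 2 * Real.log D))))
    (fun θ hθ => measure_noiseExponent_ge_le hd hh hφ (hφ1 h hh) hθ.2.1 hc0.le θ.1.1 hk _)
  refine ⟨B, hB.trans (grid_card_mul_exp_le hD4 hd1 ?_), ?_⟩
  · simp only [Fintype.card_sum, Fintype.card_prod, Fintype.card_fin]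
    nlinarith
  intro ω hω hr V w L hV hE hw hL x hx hx1
  obtain ⟨⟨⟨x', V'⟩, w', L'⟩, ⟨hx', hV', hE', -, -⟩, hclose, hgood⟩ :=
    hcov ω hω ((x, V), (w, L)) ⟨hx, hV, hE, hw, hL⟩
  simp only [Set.mem_ofPred_eq, not_le] at hgood
  have hxx : ‖x - x'‖ ≤ d * (1 / D ^ 2) := norm_le_of_coord_le fun i => hclose (Sum.inl i)
  have hVV := hE.abs_sub_le (ε := 1 / D ^ 2)
    (fun hlt => hφ1 (h + 1) (Finset.mem_Icc.2 ⟨by omega, hlt⟩)) (by positivity)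
    (fun i => hclose (Sum.inr (Sum.inl i))) (fun i j => hclose (Sum.inr (Sum.inr (i, j)))) hE'
  have hdD : (d : ℝ) ≤ D := by nlinarith
  -- The mesh `D⁻²` is chosen for the square root in the bonus, which leaves an error `d / D`.
  have hVV2 : ∀ s, |V s - V' s| ≤ 2 * (d / D) := fun s => by
    refine (hVV s).trans ?_
    have e1 : (d : ℝ) * (d * (1 / D ^ 2)) = (d / D) ^ 2 := by field_simp
    rw [e1, Real.sqrt_sq (by positivity)]
    have e2 : (d : ℝ) * (1 / D ^ 2) ≤ d / D := by
      rw [mul_one_div]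
      gcongr
      nlinarith
    linarith
  set z : ℕ → ℝ := fun t => inner ℝ x (φ h (st t h ω) (ac t h ω)) with hz
  set z' : ℕ → ℝ := fun t => inner ℝ x' (φ h (st t h ω) (ac t h ω)) with hz'
  set η : ℕ → ℝ := fun t => noise M st ac rw h V t ω with hη
  set η' : ℕ → ℝ := fun t => noise M st ac rw h V' t ω with hη'
  have hzz : ∀ t, |z t - z' t| ≤ d * (1 / D ^ 2) := fun t => by
    rw [hz, hz', ← inner_sub_left]
    exact (abs_inner_feature_le (hφ1 h hh) _ _ _).trans hxx
  have hz1 : ∀ t, |z t| ≤ 1 := fun t => (abs_inner_feature_le (hφ1 h hh) _ _ _).trans hx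
  have hη1 : ∀ t ∈ Finset.Ico 1 k, |η' t| ≤ 2 * M.H := fun t ht => abs_noise_le hh hV' (hr t ht)
  have hηη : ∀ t, |η t - η' t| ≤ 4 * (d / D) := fun t => by
    have h1 := M.abs_bellman_sub_le hh hV.meas hV'.meas hV.nonneg hV'.nonneg hV.le hV'.le hVV2
      (st t h ω) (ac t h ω)
    have h2 := hVV2 (st t (h + 1) ω)
    have e1 : η t - η' t = (V (st t (h + 1) ω) - V' (st t (h + 1) ω))
        - (M.bellman h V (st t h ω) (ac t h ω) - M.bellman h V' (st t h ω) (ac t h ω)) := by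
      simp only [hη, hη', noise]; ring
    rw [e1]
    refine (abs_sub _ _).trans ?_
    linarith
  have hcard : ((Finset.Ico 1 k).card : ℝ) ≤ k := by
    rw [Nat.card_Ico]; exact_mod_cast Nat.sub_le k 1
  have hsumle : ∀ (g : ℕ → ℝ) (b : ℝ), 0 ≤ b → (∀ t ∈ Finset.Ico 1 k, g t ≤ b) →
      ∑ t ∈ Finset.Ico 1 k, g t ≤ k * b := fun g b hb hg => by
    calc _ ≤ (Finset.Ico 1 k).card • b := Finset.sum_le_card_nsmul _ _ _ hg
      _ = ((Finset.Ico 1 k).card : ℝ) * b := nsmul_eq_mul _ _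
      _ ≤ k * b := by gcongr
  -- The constraint `∑ ⟨x, φ⟩² ≤ 1` survives the approximation of `x` up to a constant.
  have hz2 : ∑ t ∈ Finset.Ico 1 k, z' t ^ 2 ≤ 4 := by
    have h1 : ∀ t, z' t ^ 2 ≤ 2 * z t ^ 2 + 2 * (d * (1 / D ^ 2)) ^ 2 := fun t => by
      have h2 : (z t - z' t) ^ 2 ≤ (d * (1 / D ^ 2)) ^ 2 := by
        rw [← sq_abs (z t - z' t)]
        exact pow_le_pow_left₀ (abs_nonneg _) (hzz t) 2
      nlinarith [sq_nonneg (2 * z t - z' t)]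
    calc ∑ t ∈ Finset.Ico 1 k, z' t ^ 2
        ≤ ∑ t ∈ Finset.Ico 1 k, (2 * z t ^ 2 + 2 * (d * (1 / D ^ 2)) ^ 2) :=
          Finset.sum_le_sum fun t _ => h1 t
      _ = 2 * ∑ t ∈ Finset.Ico 1 k, z t ^ 2
          + ∑ t ∈ Finset.Ico 1 k, 2 * (d * (1 / D ^ 2)) ^ 2 := by
          rw [Finset.sum_add_distrib, Finset.mul_sum]
      _ ≤ 2 * 1 + k * (2 * (d * (1 / D ^ 2)) ^ 2) :=
          add_le_add (by linarith [hx1]) (hsumle _ _ (by positivity) fun t _ => le_rfl)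
      _ ≤ 4 := by
          have e1 : (k : ℝ) * (2 * (d * (1 / D ^ 2)) ^ 2) = 2 * ((d * k) * (d * 1) / D ^ 4) := by
            field_simp
          rw [e1]
          have h3 : ((d : ℝ) * k) * (d * 1) / D ^ 4 ≤ 1 := by
            rw [div_le_one (by positivity)]
            calc ((d : ℝ) * k) * (d * 1) ≤ D * (D * 1) := by gcongr
              _ ≤ D ^ 4 := by
                have : (1 : ℝ) ≤ D ^ 2 := one_le_pow₀ (by linarith)
                nlinarith [sq_nonneg D]
          linarith
  -- The supermartingale bound holds at the grid representative `(x', V')`.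
  have hmain : ∑ t ∈ Finset.Ico 1 k, z' t * η' t ≤ 96 * (d * M.H * Real.log D) + 4 * (d * M.H) := by
    have e1 : noiseExponent M φ st ac rw h V' c x' k ω
        = c * ∑ t ∈ Finset.Ico 1 k, z' t * η' t
          - c ^ 2 * (2 * M.H) ^ 2 / 2 * ∑ t ∈ Finset.Ico 1 k, z' t ^ 2 := by
      simp only [noiseExponent, Finset.mul_sum, ← Finset.sum_sub_distrib]
      refine Finset.sum_congr rfl fun t _ => ?_
      simp only [hz', hη']
      ring
    rw [e1] at hgood
    have e2 : c * (2 * M.H) = d := by rw [hc]; field_simp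
    have e3 : c ^ 2 * (2 * (M.H : ℝ)) ^ 2 = d ^ 2 := by rw [← mul_pow, e2]
    rw [e3] at hgood
    have h4 : c * ∑ t ∈ Finset.Ico 1 k, z' t * η' t
        ≤ c * (96 * (d * M.H * Real.log D) + 4 * (d * M.H)) := by
      have e4 : c * (96 * (d * M.H * Real.log D) + 4 * (d * M.H))
          = (c * (2 * M.H)) * (48 * d * Real.log D + 2 * d) := by ring
      rw [e4, e2]
      nlinarith [sq_nonneg (d : ℝ)]
    exact le_of_mul_le_mul_left h4 hc0
  have hdec : ∑ t ∈ Finset.Ico 1 k, z t * η t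
      = ∑ t ∈ Finset.Ico 1 k, z' t * η' t + ∑ t ∈ Finset.Ico 1 k, (z t - z' t) * η' t
        + ∑ t ∈ Finset.Ico 1 k, z t * (η t - η' t) := by
    rw [← Finset.sum_add_distrib, ← Finset.sum_add_distrib]
    refine Finset.sum_congr rfl fun t _ => ?_
    ring
  have h2 : ∑ t ∈ Finset.Ico 1 k, (z t - z' t) * η' t ≤ k * (d * (1 / D ^ 2) * (2 * M.H)) := by
    refine hsumle _ _ (by positivity) fun t ht => (le_abs_self _).trans ?_
    rw [abs_mul]
    exact mul_le_mul (hzz t) (hη1 t ht) (abs_nonneg _) (by positivity)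
  have h2' : (k : ℝ) * (d * (1 / D ^ 2) * (2 * M.H)) ≤ 2 * M.H := by
    have e1 : (k : ℝ) * (d * (1 / D ^ 2) * (2 * M.H)) = (d * k) / D ^ 2 * (2 * M.H) := by
      field_simp
    rw [e1]
    have : (d : ℝ) * k / D ^ 2 ≤ 1 := by
      rw [div_le_one (by positivity)]; nlinarith
    calc _ ≤ 1 * (2 * (M.H : ℝ)) := by gcongr
      _ = _ := one_mul _
  have h3 : ∑ t ∈ Finset.Ico 1 k, z t * (η t - η' t) ≤ k * (4 * (d / D)) := by
    refine hsumle _ _ (by positivity) fun t ht => (le_abs_self _).trans ?_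
    rw [abs_mul]
    calc |z t| * |η t - η' t| ≤ 1 * (4 * (d / D)) :=
          mul_le_mul (hz1 t) (hηη t) (abs_nonneg _) zero_le_one
      _ = _ := one_mul _
  have h3' : (k : ℝ) * (4 * (d / D)) ≤ 4 := by
    have e1 : (k : ℝ) * (4 * (d / D)) = 4 * ((d * k) / D) := by ring
    rw [e1]
    have : (d : ℝ) * k / D ≤ 1 := by rw [div_le_one hD0]; exact hDk
    linarith
  have hdH : (1 : ℝ) ≤ d * M.H := by nlinarith
  have hdHL : (d : ℝ) * M.H ≤ d * M.H * Real.log D := le_mul_of_one_le_right (by positivity) hL1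
  have hHd : (M.H : ℝ) ≤ d * M.H := le_mul_of_one_le_left (by positivity) hdR
  change ∑ t ∈ Finset.Ico 1 k, z t * η t ≤ _
  rw [hdec]
  linarith

/-- With high probability the data cover the optimal features in all directions. -/
theorem exists_coverage_event [SFinite ρ] [MeasurableEq A]
    (hd : IsAdaptiveData P M K st ac rw μ) {f : ℕ → S → A} (hf : ∀ h, Measurable (f h)) {h k : ℕ}
    (hh : h ∈ Finset.Icc 1 M.H) (hk : k ∈ Finset.Icc 1 (K + 1))
    (hφ : Measurable fun x : S × A => φ h x.1 x.2)
    (hφ1 : ∀ s a, ‖φ h s a‖ ≤ 1) {c : ENNReal} (hc1 : c ≤ 1)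
    (h1 : ∀ s, M.stateDens (detPolicy f hf) h s ≤ 1)
    (hc : ∀ t ∈ Finset.Icc 1 K, ∀ ω, ∀ s, 0 < M.stateDens (detPolicy f hf) h s →
      c ≤ M.saDens (μ t ω) h s (f h s)) {D : ℝ} (hD4 : 4 ≤ D)
    (hd1 : 1 ≤ d) (hDk : (d : ℝ) * k ≤ D) (hL1 : 1 ≤ Real.log D) :
    ∃ B : Set Ω, P B ≤ ENNReal.ofReal ((D ^ 3)⁻¹) ∧ ∀ ω ∉ B,
      ∀ x : EuclideanSpace ℝ (Fin d), ‖x‖ ≤ 1 →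
        ((k : ℝ) - 1) * (c.toReal / 2) *
            (x.ofLp ⬝ᵥ (M.featureCov φ (detPolicy f hf) h).mulVec x.ofLp)
          - 51 * ((d : ℝ) ^ 2 * Real.log D)
          ≤ ∑ t ∈ Finset.Ico 1 k,
            optTerm M φ f (detPolicy f hf) h x (st t h ω) (ac t h ω) := by
  have hD0 : 0 < D := by linarith
  have hdR : (1 : ℝ) ≤ d := by exact_mod_cast hd1
  have hk1 := (Finset.mem_Icc.1 hk).1
  have hkR : (1 : ℝ) ≤ k := by exact_mod_cast hk1
  have hT : 0 < D ^ 2 := by positivity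
  have hctop : c ≠ ⊤ := ne_top_of_le_ne_top ENNReal.one_ne_top hc1
  have hcR : c.toReal ≤ 1 := by
    have := ENNReal.toReal_mono ENNReal.one_ne_top hc1; simpa using this
  have hcR0 : 0 ≤ c.toReal := ENNReal.toReal_nonneg
  set Q : EuclideanSpace ℝ (Fin d) → ℝ := fun x =>
    ∫ s, inner ℝ x (φ h s (f h s)) ^ 2 ∂(M.occupancy (detPolicy f hf) h) with hQ
  obtain ⟨B, hB, hcov⟩ := exists_grid_cover P
    (fun (x : EuclideanSpace ℝ (Fin d)) (i : Fin d) => x.ofLp i) {x | ‖x‖ ≤ 1} hT ⌈D ^ 14⌉₊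
    (by
      intro x hx i
      calc |x.ofLp i| * D ^ 2 ≤ D ^ 12 * D ^ 2 := by
            gcongr
            exact (abs_coord_le_one hx i).trans (one_le_pow₀ (by linarith))
        _ = D ^ 14 := by ring
        _ ≤ _ := Nat.le_ceil _)
    (fun x => {ω | 48 * (d : ℝ) ^ 2 * Real.log D
      ≤ coverExponent M φ f (detPolicy f hf) st ac h (c.toReal * Q x) x k ω})
    (ENNReal.ofReal (Real.exp (-(48 * (d : ℝ) ^ 2 * Real.log D))))
    (fun x hx => measure_coverExponent_ge_le hd hf hh hφ hφ1 hctop h1 hc hx rfl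
      (Finset.mem_Icc.1 hk).2 _)
  refine ⟨B, hB.trans (grid_card_mul_exp_le hD4 hd1 ?_), ?_⟩
  · rw [Fintype.card_fin]; nlinarith
  intro ω hω x hx
  obtain ⟨x', hx', hclose, hgood⟩ := hcov ω hω x hx
  simp only [Set.mem_ofPred_eq, not_le] at hgood
  have hxx : ‖x - x'‖ ≤ d * (1 / D ^ 2) := norm_le_of_coord_le fun i => hclose i
  have hsq : ∀ s a, |inner ℝ x (φ h s a) ^ 2 - inner ℝ x' (φ h s a) ^ 2|
      ≤ 2 * (d * (1 / D ^ 2)) := fun s a => by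
    have e1 : inner ℝ x (φ h s a) ^ 2 - inner ℝ x' (φ h s a) ^ 2
        = inner ℝ (x + x') (φ h s a) * inner ℝ (x - x') (φ h s a) := by
      rw [inner_add_left, inner_sub_left]; ring
    rw [e1, abs_mul]
    refine mul_le_mul ?_ ((abs_inner_feature_le hφ1 _ _ _).trans hxx) (abs_nonneg _) zero_le_two
    refine (abs_inner_feature_le hφ1 _ _ _).trans ((norm_add_le _ _).trans ?_)
    have : ‖x'‖ ≤ 1 := hx'
    linarith
  have := M.isProbabilityMeasure_occupancy (detPolicy f hf) hh
  have hQQ : Q x ≤ Q x' + 2 * (d * (1 / D ^ 2)) := by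
    have h2 := integrable_inner_sq (M := M) hf hh hφ hφ1 x
    have h3 := integrable_inner_sq (M := M) hf hh hφ hφ1 x'
    have h4 := integral_mono h2 (h3.add (integrable_const (2 * (d * (1 / D ^ 2)))))
      (fun s => by
        have := (abs_le.1 (hsq s (f h s))).2
        simp only [Pi.add_apply]; linarith)
    simp only [Pi.add_apply] at h4
    rw [integral_add h3 (integrable_const _)] at h4
    simpa using h4
  have hopt : ∀ s a, optTerm M φ f (detPolicy f hf) h x' s a
      ≤ optTerm M φ f (detPolicy f hf) h x s a + 2 * (d * (1 / D ^ 2)) := fun s a => by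
    have h2 := (abs_le.1 (hsq s a)).1
    rw [optTerm, optTerm]
    split_ifs
    · linarith
    · positivity
  have hcard : ((Finset.Ico 1 k).card : ℝ) = k - 1 := by
    rw [Nat.card_Ico, Nat.cast_sub hk1]; simp
  have hε : ((k : ℝ) - 1) * (2 * (d * (1 / D ^ 2))) ≤ 2 := by
    have e1 : ((k : ℝ)) * (2 * (d * (1 / D ^ 2))) = 2 * ((d * k) / D ^ 2) := by
      field_simp
    have h2 : (d : ℝ) * k / D ^ 2 ≤ 1 := by
      rw [div_le_one (by positivity)]; nlinarith
    have h3 : 0 ≤ 2 * ((d : ℝ) * (1 / D ^ 2)) := by positivity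
    nlinarith
  have hexp : coverExponent M φ f (detPolicy f hf) st ac h (c.toReal * Q x') x' k ω
      = (k - 1) * (c.toReal / 2) * Q x' - ∑ t ∈ Finset.Ico 1 k,
        optTerm M φ f (detPolicy f hf) h x' (st t h ω) (ac t h ω) := by
    rw [coverExponent, Finset.sum_sub_distrib, Finset.sum_const, nsmul_eq_mul, hcard]
    ring
  rw [hexp] at hgood
  have hsum : ∑ t ∈ Finset.Ico 1 k, optTerm M φ f (detPolicy f hf) h x' (st t h ω) (ac t h ω)
      ≤ ∑ t ∈ Finset.Ico 1 k, optTerm M φ f (detPolicy f hf) h x (st t h ω) (ac t h ω) + 2 := by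
    calc _ ≤ ∑ t ∈ Finset.Ico 1 k, (optTerm M φ f (detPolicy f hf) h x (st t h ω) (ac t h ω)
          + 2 * (d * (1 / D ^ 2))) := Finset.sum_le_sum fun t _ => hopt _ _
      _ = ∑ t ∈ Finset.Ico 1 k, optTerm M φ f (detPolicy f hf) h x (st t h ω) (ac t h ω)
          + (k - 1) * (2 * (d * (1 / D ^ 2))) := by
          rw [Finset.sum_add_distrib, Finset.sum_const, nsmul_eq_mul, hcard]
      _ ≤ _ := by linarith
  have hQ2 : ((k : ℝ) - 1) * (c.toReal / 2) * Q x ≤ (k - 1) * (c.toReal / 2) * Q x' + 1 := by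
    have h2 : 0 ≤ ((k : ℝ) - 1) := by linarith
    have h3 : ((k : ℝ) - 1) * (c.toReal / 2) * Q x
        ≤ (k - 1) * (c.toReal / 2) * (Q x' + 2 * (d * (1 / D ^ 2))) := by gcongr
    have h4 : c.toReal / 2 * (((k : ℝ) - 1) * (2 * (d * (1 / D ^ 2)))) ≤ 1 / 2 * 2 :=
      mul_le_mul (by linarith) hε (mul_nonneg h2 (by positivity)) (by norm_num)
    linarith
  rw [featureCov_quadratic hf hh hφ hφ1]
  change ((k : ℝ) - 1) * (c.toReal / 2) * Q x - _ ≤ _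
  have hdL : 1 ≤ (d : ℝ) ^ 2 * Real.log D := by nlinarith [one_le_pow₀ hdR (n := 2)]
  linarith

end Events

/-! ### Regression error and bonus bounds -/

section RidgeBounds

variable {d : ℕ}

/-- The prediction error of regularized least squares, in terms of the self-normalized noise. -/
theorem abs_ridge_prediction_sub_le (T : Finset ℕ) (v : ℕ → EuclideanSpace ℝ (Fin d))
    {c ν : ℕ → ℝ} {w : EuclideanSpace ℝ (Fin d)} (hc : ∀ t ∈ T, c t = inner ℝ (v t) w + ν t)
    {b₀ b₁ : ℝ} (hν : ∀ u : EuclideanSpace ℝ (Fin d), ‖u‖ ≤ 1 →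
      ∑ t ∈ T, inner ℝ u (v t) ^ 2 ≤ 1 → ∑ t ∈ T, inner ℝ u (v t) * ν t ≤ b₀)
    (hw : ‖w‖ ≤ b₁) (x : EuclideanSpace ℝ (Fin d)) :
    |x.ofLp ⬝ᵥ (ridge T v)⁻¹.mulVec (∑ t ∈ T, c t • (v t).ofLp) - inner ℝ x w|
      ≤ (b₀ + b₁) * Real.sqrt (x.ofLp ⬝ᵥ (ridge T v)⁻¹.mulVec x.ofLp) := by
  set u := ridgeSol T v x with hu
  have hQ := dotProduct_ridge_inv_mulVec_self T v x
  set a2 := x.ofLp ⬝ᵥ (ridge T v)⁻¹.mulVec x.ofLp with ha2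
  have hsum0 : 0 ≤ ∑ t ∈ T, inner ℝ (v t) u ^ 2 := Finset.sum_nonneg fun t _ => sq_nonneg _
  have ha0 : 0 ≤ a2 := by rw [hQ]; positivity
  have hua : ‖u‖ ≤ Real.sqrt a2 := Real.le_sqrt_of_sq_le (by rw [hQ]; linarith)
  have e1 : x.ofLp ⬝ᵥ (ridge T v)⁻¹.mulVec (∑ t ∈ T, c t • (v t).ofLp)
      = ∑ t ∈ T, c t * inner ℝ u (v t) := by
    rw [dotProduct_ridge_inv_mulVec, dotProduct_sum]
    refine Finset.sum_congr rfl fun t _ => ?_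
    rw [dotProduct_smul, smul_eq_mul, ← inner_eq_dotProduct_ofLp]
  have e2 : inner ℝ x w = ∑ t ∈ T, inner ℝ (v t) w * inner ℝ u (v t) + inner ℝ w u := by
    rw [real_inner_comm, inner_eq_sum_ridgeSol T v x w]
    congr 1
    refine Finset.sum_congr rfl fun t _ => ?_
    rw [real_inner_comm u (v t)]
  have e3 : x.ofLp ⬝ᵥ (ridge T v)⁻¹.mulVec (∑ t ∈ T, c t • (v t).ofLp) - inner ℝ x w
      = ∑ t ∈ T, inner ℝ u (v t) * ν t - inner ℝ w u := by
    rw [e1, e2, ← sub_sub, ← Finset.sum_sub_distrib]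
    congr 1
    refine Finset.sum_congr rfl fun t ht => ?_
    rw [hc t ht]; ring
  have hb0 : 0 ≤ b₀ := by
    have := hν 0 (by simp) (by simp)
    simpa using this
  have key : ∀ y : EuclideanSpace ℝ (Fin d), ‖y‖ ≤ Real.sqrt a2 →
      ∑ t ∈ T, inner ℝ y (v t) ^ 2 ≤ a2 → ∑ t ∈ T, inner ℝ y (v t) * ν t ≤ b₀ * Real.sqrt a2 := by
    intro y hy1 hy2
    rcases ha0.eq_or_lt with h0 | h0
    · rw [← h0, Real.sqrt_zero] at hy1
      have : y = 0 := norm_le_zero_iff.1 hy1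
      rw [this]; simp [← h0]
    · have hs : 0 < Real.sqrt a2 := Real.sqrt_pos.2 h0
      have h1 := hν ((Real.sqrt a2)⁻¹ • y)
        (by rw [norm_smul, norm_inv, Real.norm_of_nonneg hs.le, inv_mul_le_iff₀ hs]; linarith)
        (by
          simp only [inner_smul_left, mul_pow, ← Finset.mul_sum]
          simp only [conj_trivial, inv_pow, Real.sq_sqrt ha0]
          rw [inv_mul_le_iff₀ h0]; linarith)
      simp only [inner_smul_left, mul_assoc, ← Finset.mul_sum] at h1
      simp only [conj_trivial] at h1
      rwa [inv_mul_le_iff₀ hs, mul_comm] at h1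
  have hinner : ∑ t ∈ T, inner ℝ u (v t) ^ 2 ≤ a2 := by
    have : ∑ t ∈ T, inner ℝ u (v t) ^ 2 = ∑ t ∈ T, inner ℝ (v t) u ^ 2 :=
      Finset.sum_congr rfl fun t _ => by rw [real_inner_comm]
    rw [this, hQ]
    have := sq_nonneg ‖u‖
    linarith
  have h1 := key u hua hinner
  have h2 := key (-u) (by rwa [norm_neg]) (by simpa using hinner)
  simp only [inner_neg_left, neg_mul, Finset.sum_neg_distrib] at h2
  have h3 : |inner ℝ w u| ≤ b₁ * Real.sqrt a2 := (abs_real_inner_le_norm _ _).trans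
    (mul_le_mul hw hua (norm_nonneg _) ((norm_nonneg _).trans hw))
  rw [e3, abs_le]
  obtain ⟨h4, h5⟩ := abs_le.1 h3
  constructor <;> nlinarith

/-- If part of the data, with features orthogonal to the kernel of `Σ`, covers `Σ` up to an error
below the smallest positive eigenvalue, then the regularized Gram matrix is large on the range of
`Σ`. -/
theorem ridge_inv_quadratic_le {T J : Finset ℕ} (hJ : J ⊆ T) (v : ℕ → EuclideanSpace ℝ (Fin d))
    {G : Matrix (Fin d) (Fin d) ℝ} (hG : G.IsHermitian)
    (hpos : ∀ x : Fin d → ℝ, 0 ≤ x ⬝ᵥ G.mulVec x) {α ℓ : ℝ} (hα : 0 ≤ α)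
    (hcov : ∀ w : EuclideanSpace ℝ (Fin d), ‖w‖ ≤ 1 →
      α * (w.ofLp ⬝ᵥ G.mulVec w.ofLp) - ℓ ≤ ∑ t ∈ J, inner ℝ w (v t) ^ 2)
    (hker : ∀ t ∈ J, ∀ y : EuclideanSpace ℝ (Fin d), G.mulVec y.ofLp = 0 → inner ℝ y (v t) = 0)
    (hℓ : 2 * ℓ ≤ α * minPosEigenvalue G) (hαpos : 0 < α * minPosEigenvalue G)
    {x : EuclideanSpace ℝ (Fin d)} (hx : ‖x‖ ≤ 1)
    (hxker : ∀ y : EuclideanSpace ℝ (Fin d), G.mulVec y.ofLp = 0 → inner ℝ y x = 0) :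
    x.ofLp ⬝ᵥ (ridge T v)⁻¹.mulVec x.ofLp ≤ 2 / (α * minPosEigenvalue G) := by
  set u := ridgeSol T v x with hu
  have hQ := dotProduct_ridge_inv_mulVec_self T v x
  have hQ2 : x.ofLp ⬝ᵥ (ridge T v)⁻¹.mulVec x.ofLp = inner ℝ u x := by
    rw [dotProduct_ridge_inv_mulVec, inner_eq_dotProduct_ofLp]
  set a2 := x.ofLp ⬝ᵥ (ridge T v)⁻¹.mulVec x.ofLp with ha2
  obtain ⟨w, hw0, hw1⟩ := exists_minPosEigenvalue_mul_le hG hpos u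
  set l := minPosEigenvalue G with hl
  have hle : a2 ≤ ‖w‖ := by
    have h1 := hxker (u - w) hw0
    rw [inner_sub_left, sub_eq_zero] at h1
    rw [hQ2, h1]
    calc inner ℝ w x ≤ ‖w‖ * ‖x‖ := real_inner_le_norm _ _
      _ ≤ ‖w‖ := mul_le_of_le_one_right (norm_nonneg _) hx
  have ha0 : 0 ≤ a2 := by
    rw [hQ]
    exact add_nonneg (Finset.sum_nonneg fun t _ => sq_nonneg _) (sq_nonneg _)
  have hJu : ∑ t ∈ J, inner ℝ w (v t) ^ 2 ≤ a2 := by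
    have h1 : ∑ t ∈ J, inner ℝ w (v t) ^ 2 = ∑ t ∈ J, inner ℝ (v t) u ^ 2 := by
      refine Finset.sum_congr rfl fun t ht => ?_
      have h2 := hker t ht (u - w) hw0
      rw [inner_sub_left, sub_eq_zero] at h2
      rw [← h2, real_inner_comm]
    have h2 : ∑ t ∈ J, inner ℝ (v t) u ^ 2 ≤ ∑ t ∈ T, inner ℝ (v t) u ^ 2 :=
      Finset.sum_le_sum_of_subset_of_nonneg hJ fun t _ _ => sq_nonneg _
    rw [h1, hQ]
    have := sq_nonneg ‖u‖
    linarith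
  have hlow : α * l / 2 * ‖w‖ ^ 2 ≤ ∑ t ∈ J, inner ℝ w (v t) ^ 2 := by
    rcases eq_or_ne w 0 with rfl | hwne
    · simp
    · have hn : 0 < ‖w‖ := norm_pos_iff.2 hwne
      have h1 := hcov (‖w‖⁻¹ • w) (by rw [norm_smul, norm_inv, norm_norm, inv_mul_cancel₀ hn.ne'])
      have e : (‖w‖⁻¹ • w).ofLp = ‖w‖⁻¹ • w.ofLp := rfl
      rw [e, Matrix.mulVec_smul, smul_dotProduct, dotProduct_smul] at h1
      simp only [inner_smul_left, mul_pow, ← Finset.mul_sum, smul_eq_mul, conj_trivial] at h1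
      have h2 : α * l - ℓ ≤ (‖w‖⁻¹) ^ 2 * ∑ t ∈ J, inner ℝ w (v t) ^ 2 := by
        refine le_trans ?_ h1
        have h3 : l ≤ ‖w‖⁻¹ * (‖w‖⁻¹ * (w.ofLp ⬝ᵥ G.mulVec w.ofLp)) := by
          rw [← mul_assoc, ← mul_inv, ← sq, inv_mul_eq_div, le_div_iff₀ (by positivity)]
          exact hw1
        have := mul_le_mul_of_nonneg_left h3 hα
        linarith
      rw [inv_pow, inv_mul_eq_div, le_div_iff₀ (by positivity)] at h2
      nlinarith [sq_nonneg ‖w‖]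
  rw [le_div_iff₀ hαpos]
  have h5 : α * l / 2 * a2 ^ 2 ≤ a2 := by
    have : a2 ^ 2 ≤ ‖w‖ ^ 2 := pow_le_pow_left₀ ha0 hle 2
    have := mul_le_mul_of_nonneg_left this (by linarith : 0 ≤ α * l / 2)
    linarith
  rcases ha0.eq_or_lt with h0 | h0
  · rw [← h0]; norm_num
  · have : α * l / 2 * a2 ≤ 1 := by
      by_contra! hcon
      nlinarith
    linarith

end RidgeBounds

section LinearBellman

variable {S A : Type*} [MeasurableSpace S] [MeasurableSpace A] {ρ : Measure S} {M : MDP S A ρ}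
  {d : ℕ} {φ : ℕ → S → A → EuclideanSpace ℝ (Fin d)}

theorem MDP.IsLinear.norm_feature_le (hlin : M.IsLinear φ) {h : ℕ} (hh : h ∈ Finset.Icc 1 M.H)
    (s : S) (a : A) : ‖φ h s a‖ ≤ 1 := (hlin h hh).2.1 s a

theorem MDP.IsLinear.measurable_feature (hlin : M.IsLinear φ) {h : ℕ}
    (hh : h ∈ Finset.Icc 1 M.H) : Measurable fun x : S × A => φ h x.1 x.2 := (hlin h hh).1

/-- In a linear MDP Bellman backups are linear in the features. -/
theorem MDP.IsLinear.exists_bellman_eq (hlin : M.IsLinear φ) {h : ℕ} (hh : h ∈ Finset.Icc 1 M.H)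
    (hd : 1 ≤ d) {V : S → ℝ} (hV : Measurable V) (hV0 : ∀ s, 0 ≤ V s) (hVH : ∀ s, V s ≤ M.H) :
    ∃ w : EuclideanSpace ℝ (Fin d), ‖w‖ ≤ 2 * (d * M.H) ∧
      ∀ s a, M.bellman h V s a = inner ℝ (φ h s a) w := by
  obtain ⟨-, -, θ, m, hr, hp, hθ, hm, hB⟩ := hlin h hh
  have hVa : ∀ s, |V s| ≤ M.H := fun s => by rw [abs_of_nonneg (hV0 s)]; exact hVH s
  refine ⟨θ + ∫ s, V s • m s ∂ρ, ?_, fun s a => ?_⟩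
  · have h1 : (1 : ℝ) ≤ M.H := by
      rw [Finset.mem_Icc] at hh; exact_mod_cast hh.1.trans hh.2
    have hd1 : (1 : ℝ) ≤ d := by exact_mod_cast hd
    have h2 : Real.sqrt d ≤ d := by
      rw [Real.sqrt_le_left (by linarith)]; nlinarith
    have h3 := hB V M.H hV hVa
    have h4 : Real.sqrt d * M.H ≤ d * M.H := by gcongr
    refine (norm_add_le _ _).trans ?_
    nlinarith
  · have hmeas : Measurable fun s' => ENNReal.ofReal (M.dens h s a s') :=
      ((M.dens_meas h hh).comp (measurable_prodMk_left (x := (s, a)))).ennreal_ofReal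
    have hi : Integrable (fun s => V s • m s) ρ :=
      hm.bdd_smul (M.H : ℝ) hV.aestronglyMeasurable (Filter.Eventually.of_forall hVa)
    rw [MDP.bellman, inner_add_right, ← hr, ← integral_inner hi, MDP.transMeasure,
      integral_withDensity_eq_integral_toReal_smul hmeas
        (Filter.Eventually.of_forall fun _ => ENNReal.ofReal_lt_top)]
    congr 1
    refine integral_congr_ae (Filter.Eventually.of_forall fun s' => ?_)
    simp only [smul_eq_mul, inner_smul_right]
    rw [ENNReal.toReal_ofReal (M.dens_nonneg h hh s a s'), hp, mul_comm]

/-- A linear MDP with at least one step has features of positive dimension. -/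
theorem MDP.IsLinear.dim_pos (hlin : M.IsLinear φ) {h : ℕ} (hh : h ∈ Finset.Icc 1 M.H)
    (s : S) (a : A) : 1 ≤ d := by
  by_contra! hd
  obtain rfl : d = 0 := by omega
  obtain ⟨-, -, θ, m, -, hp, -⟩ := hlin h hh
  have h1 := M.dens_mass h hh s a
  have h2 : ∀ s', M.dens h s a s' = 0 := fun s' => by
    rw [hp, Subsingleton.elim (φ h s a) 0, inner_zero_left]
  simp [h2] at h1

theorem MDP.IsLinear.feature_ne_zero (hlin : M.IsLinear φ) {h : ℕ} (hh : h ∈ Finset.Icc 1 M.H)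
    (s : S) (a : A) : φ h s a ≠ 0 := by
  intro h0
  obtain ⟨-, -, θ, m, -, hp, -⟩ := hlin h hh
  have h1 := M.dens_mass h hh s a
  have h2 : ∀ s', M.dens h s a s' = 0 := fun s' => by rw [hp, h0, inner_zero_left]
  simp [h2] at h1

end LinearBellman

/-! ### Pessimistic value iteration on given data -/

section ValueIteration

variable {S A : Type*} [MeasurableSpace S] [MeasurableSpace A] {ρ : Measure S} {M : MDP S A ρ}
  {d : ℕ} {φ : ℕ → S → A → EuclideanSpace ℝ (Fin d)} {β : ℕ → ℝ} {supp : ℕ → S → Set A}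
  {st : ℕ → ℕ → S} {ac : ℕ → ℕ → A} {rw : ℕ → ℕ → ℝ} {k : ℕ} {π : Policy S A}

/-- The actions available to the algorithm at step `h` in the state `s`: all actions in an
infeasible state, and those in the support of the behaviour policy in a feasible one. -/
def allowedActions (M : MDP S A ρ) (supp : ℕ → S → Set A) (h : ℕ) (s : S) : Set A :=
  {a | s ∈ M.feasible h → a ∈ supp h s}

theorem vHat_succ_H : vHat M φ 1 β st ac rw k π (M.H + 1) = fun _ => 0 := by
  simp [vHat, vHatToGo]

theorem vHat_eq_avg {h : ℕ} (hh : h ∈ Finset.Icc 1 M.H) :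
    vHat M φ 1 β st ac rw k π h = (π h).avg (qHat M φ 1 β st ac rw k π h) := by
  rw [Finset.mem_Icc] at hh
  have e1 : M.H + 1 - h = (M.H - h) + 1 := by omega
  have e2 : M.H - (M.H - h) = h := by omega
  have e3 : M.H + 1 - (h + 1) = M.H - h := by omega
  unfold qHat vHat
  rw [e1, e3, vHatToGo, e2]

theorem qHat_nonneg (h : ℕ) (s : S) (a : A) : 0 ≤ qHat M φ 1 β st ac rw k π h s a :=
  le_max_right _ _

theorem qHat_le {h : ℕ} (hh : h ∈ Finset.Icc 1 M.H) (s : S) (a : A) :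
    qHat M φ 1 β st ac rw k π h s a ≤ (M.H : ℝ) - h + 1 := by
  have h1 : (h : ℝ) ≤ M.H := by exact_mod_cast (Finset.mem_Icc.1 hh).2
  exact max_le (min_le_right _ _) (by linarith)

theorem measurable_qHat {h : ℕ} (hφ : Measurable fun x : S × A => φ h x.1 x.2) :
    Measurable fun x : S × A => qHat M φ 1 β st ac rw k π h x.1 x.2 := by
  have hc : ∀ i, Measurable fun x : S × A => (φ h x.1 x.2).ofLp i := fun i =>
    (EuclideanSpace.proj i : EuclideanSpace ℝ (Fin d) →L[ℝ] ℝ).continuous.measurable.comp hφ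
  unfold qHat qHatOf bonus
  refine Measurable.max (Measurable.min (Measurable.sub ?_ (Measurable.const_mul
    (Measurable.sqrt ?_) _)) measurable_const) measurable_const
  · simp only [dotProduct]
    exact Finset.measurable_fun_sum _ fun i _ => (hc i).mul_const _
  · simp only [dotProduct, Matrix.mulVec]
    exact Finset.measurable_fun_sum _ fun i _ => (hc i).mul
      (Finset.measurable_fun_sum _ fun j _ => (hc j).const_mul _)

theorem vHat_measurable_and_mem
    (hφ : ∀ h ∈ Finset.Icc 1 M.H, Measurable fun x : S × A => φ h x.1 x.2) :
    ∀ h ∈ Finset.Icc 1 (M.H + 1), Measurable (vHat M φ 1 β st ac rw k π h) ∧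
      ∀ s, 0 ≤ vHat M φ 1 β st ac rw k π h s ∧
        vHat M φ 1 β st ac rw k π h s ≤ (M.H : ℝ) - h + 1 := by
  intro h hh
  rcases Finset.mem_Icc.1 hh with ⟨h1, h2⟩
  rcases h2.eq_or_lt with rfl | h2
  · rw [vHat_succ_H]
    exact ⟨measurable_const, fun s => ⟨le_rfl, by push_cast; linarith⟩⟩
  · have hh' : h ∈ Finset.Icc 1 M.H := Finset.mem_Icc.2 ⟨h1, by omega⟩
    rw [vHat_eq_avg hh']
    exact ⟨(π h).measurable_avg (measurable_qHat (hφ h hh')), fun s =>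
      ⟨(π h).avg_nonneg s (qHat_nonneg h s), (π h).avg_le s (qHat_nonneg h s) (qHat_le hh' s)⟩⟩

theorem isTarget_vHat (hφ : ∀ h ∈ Finset.Icc 1 M.H, Measurable fun x : S × A => φ h x.1 x.2)
    {h : ℕ} (hh : h ∈ Finset.Icc 1 M.H) : IsTarget M h (vHat M φ 1 β st ac rw k π (h + 1)) := by
  obtain ⟨h1, h2⟩ := vHat_measurable_and_mem (β := β) (st := st) (ac := ac) (rw := rw) (k := k)
    (π := π) hφ (h + 1) (MDP.succ_mem_Icc hh)
  refine ⟨h1, fun s => (h2 s).1, fun s => (h2 s).2.trans ?_, ?_⟩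
  · push_cast
    have : (0 : ℝ) ≤ h := Nat.cast_nonneg h
    linarith
  · rcases (Finset.mem_Icc.1 hh).2.eq_or_lt with h3 | h3
    · right; rw [h3, vHat_succ_H]
    · exact Or.inl h3

theorem bonus_nonneg {S A : Type*} {φ : ℕ → S → A → EuclideanSpace ℝ (Fin d)} {β : ℕ → ℝ}
    {st : ℕ → ℕ → S} {ac : ℕ → ℕ → A} {k : ℕ} (hβ : 0 ≤ β k) (h : ℕ) (s : S) (a : A) :
    0 ≤ bonus φ 1 β st ac k h s a :=
  mul_nonneg hβ (Real.sqrt_nonneg _)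

/-- The Bellman regression of the round is accurate up to the bonus. -/
def IsAccurate (M : MDP S A ρ) (φ : ℕ → S → A → EuclideanSpace ℝ (Fin d)) (β : ℕ → ℝ)
    (st : ℕ → ℕ → S) (ac : ℕ → ℕ → A) (rw : ℕ → ℕ → ℝ) (k : ℕ) (π : Policy S A) : Prop :=
  ∀ h ∈ Finset.Icc 1 M.H, ∀ s a,
    |(φ h s a).ofLp ⬝ᵥ weight φ 1 st ac rw k h (vHat M φ 1 β st ac rw k π (h + 1)) -
      M.bellman h (vHat M φ 1 β st ac rw k π (h + 1)) s a| ≤ bonus φ 1 β st ac k h s a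

theorem IsAccurate.qHat_le_bellman
    (hφ : ∀ h ∈ Finset.Icc 1 M.H, Measurable fun x : S × A => φ h x.1 x.2)
    (hacc : IsAccurate M φ β st ac rw k π) {h : ℕ} (hh : h ∈ Finset.Icc 1 M.H) (s : S) (a : A) :
    qHat M φ 1 β st ac rw k π h s a ≤ M.bellman h (vHat M φ 1 β st ac rw k π (h + 1)) s a := by
  have h1 := (abs_le.1 (hacc h hh s a)).2
  refine max_le ((min_le_left _ _).trans (by linarith)) ?_
  exact M.bellman_nonneg hh (isTarget_vHat hφ hh).nonneg s a

theorem IsAccurate.bellman_sub_le_qHat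
    (hφ : ∀ h ∈ Finset.Icc 1 M.H, Measurable fun x : S × A => φ h x.1 x.2) (hβ : 0 ≤ β k)
    (hacc : IsAccurate M φ β st ac rw k π) {h : ℕ} (hh : h ∈ Finset.Icc 1 M.H) (s : S) (a : A) :
    M.bellman h (vHat M φ 1 β st ac rw k π (h + 1)) s a - 2 * bonus φ 1 β st ac k h s a
      ≤ qHat M φ 1 β st ac rw k π h s a := by
  have h1 := (abs_le.1 (hacc h hh s a)).1
  have h2 := (vHat_measurable_and_mem (β := β) (st := st) (ac := ac) (rw := rw) (k := k)
    (π := π) hφ (h + 1) (MDP.succ_mem_Icc hh)).2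
  have h3 := M.bellman_le hh (fun s => (h2 s).1) (fun s => (h2 s).2) s a
  have h4 := bonus_nonneg (φ := φ) (st := st) (ac := ac) hβ h s a
  refine le_trans (le_min ?_ ?_) (le_max_left _ _)
  · linarith
  · push_cast at h3; linarith

/-- A policy that agrees with the optimal one almost everywhere along its trajectories is optimal
from the initial distribution. -/
theorem subOpt_eq_zero_of_ae_act_eq_pure [SFinite ρ] [MeasurableEq A] {f : ℕ → S → A}
    (hf : ∀ h, Measurable (f h))
    (hact : ∀ h ∈ Finset.Icc 1 M.H, ∀ᵐ s ∂(M.occupancy (detPolicy f hf) h),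
      (π h).act s = PMF.pure (f h s)) : M.subOpt (detPolicy f hf) π = 0 := by
  have key : ∀ h ∈ Finset.Icc 1 (M.H + 1), ∀ᵐ s ∂(M.occupancy (detPolicy f hf) h),
      M.V (detPolicy f hf) h s - M.V π h s = 0 := by
    refine MDP.backward_induction ?_ ?_
    · refine Filter.Eventually.of_forall fun s => ?_
      rw [M.V_succ_H, M.V_succ_H, sub_self]
    · intro h hh ih
      have hnext : ∀ᵐ s ∂(M.occupancy (detPolicy f hf) h), ∀ᵐ s' ∂(M.transMeasure h s (f h s)),
          M.V (detPolicy f hf) (h + 1) s' - M.V π (h + 1) s' = 0 := by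
        rcases (Finset.mem_Icc.1 hh).2.eq_or_lt with h3 | h3
        · refine Filter.Eventually.of_forall fun s => Filter.Eventually.of_forall fun s' => ?_
          rw [h3, M.V_succ_H, M.V_succ_H, sub_self]
        · exact M.ae_transMeasure_of_ae_occupancy_succ hf hh
            (Finset.mem_Icc.2 ⟨by omega, h3⟩) ih
      filter_upwards [hact h hh, hnext] with s hs hs'
      rw [M.V_detPolicy hf hh, M.V_eq_avg_Q π hh, DecisionRule.avg_of_act_eq_pure hs, MDP.Q, MDP.Q,
        MDP.bellman, MDP.bellman, add_sub_add_left_eq_sub, sub_eq_zero]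
      refine integral_congr_ae ?_
      filter_upwards [hs'] with s' h'
      exact sub_eq_zero.1 h'
  have h1 := key 1 (Finset.mem_Icc.2 ⟨le_rfl, by omega⟩)
  exact integral_eq_zero_of_ae h1

variable [MeasurableSingletonClass S] [MeasurableEq A]

/-- The extracted policy is greedy: no allowed action has a larger pessimistic value. -/
theorem qHat_le_vHat (hπ : IsEnsemblePolicy M φ 1 β supp st ac rw k π) {h : ℕ}
    (hh : h ∈ Finset.Icc 1 M.H) {s : S} {a : A} (ha : a ∈ allowedActions M supp h s) :
    qHat M φ 1 β st ac rw k π h s a ≤ vHat M φ 1 β st ac rw k π h s := by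
  have h1 := (hπ h hh).2 ((π h).modify s a) (by
    intro s' hs'
    rcases eq_or_ne s' s with rfl | hne
    · rw [DecisionRule.modify_act_self, PMF.support_pure]
      exact Set.singleton_subset_iff.2 (ha hs')
    · rw [DecisionRule.modify_act_of_ne _ _ hne]
      exact (hπ h hh).1 s' hs') s
  rwa [DecisionRule.avg_of_act_eq_pure (DecisionRule.modify_act_self _ s a),
    ← vHat_eq_avg hh] at h1

/-- All actions played by the extracted policy are maximizers of the pessimistic value. -/
theorem qHat_eq_vHat_of_mem_support {h : ℕ} (hh : h ∈ Finset.Icc 1 M.H)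
    (hφ : Measurable fun x : S × A => φ h x.1 x.2)
    (hπ : IsEnsemblePolicy M φ 1 β supp st ac rw k π) {s : S} {a : A}
    (ha : a ∈ ((π h).act s).support) :
    a ∈ allowedActions M supp h s ∧
      qHat M φ 1 β st ac rw k π h s a = vHat M φ 1 β st ac rw k π h s := by
  have : MeasurableSingletonClass A := ⟨measurableSet_singleton_of_measurableEq⟩
  have hallow : ∀ b ∈ ((π h).act s).support, b ∈ allowedActions M supp h s :=
    fun b hb hs => (hπ h hh).1 s hs hb
  refine ⟨hallow a ha, ?_⟩
  set p := (π h).act s with hp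
  set q := qHat M φ 1 β st ac rw k π h s with hq
  set v := vHat M φ 1 β st ac rw k π h s with hv
  have hqm : Measurable q := (measurable_qHat hφ).comp (measurable_prodMk_left (x := s))
  have hqi : Integrable q p.toMeasure :=
    (π h).integrable_act (f := qHat M φ 1 β st ac rw k π h) s hqm (qHat_nonneg h s) (qHat_le hh s)
  have hsupp : ∀ᵐ b ∂p.toMeasure, b ∈ p.support := by
    rw [ae_iff]
    exact (PMF.toMeasure_apply_eq_zero_iff p p.support_countable.measurableSet.compl).2
      disjoint_compl_right
  have h0 : 0 ≤ᵐ[p.toMeasure] fun b => v - q b := by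
    filter_upwards [hsupp] with b hb
    exact sub_nonneg.2 (qHat_le_vHat hπ hh (hallow b hb))
  have hint : ∫ b, (v - q b) ∂p.toMeasure = 0 := by
    rw [integral_sub (integrable_const v) hqi, integral_const, probReal_univ, one_smul, sub_eq_zero,
      hv, vHat_eq_avg hh]
    rfl
  rw [integral_eq_zero_iff_of_nonneg_ae h0 ((integrable_const v).sub hqi)] at hint
  by_contra hne
  have h1 : p.toMeasure {a} = 0 := by
    refine measure_mono_null ?_ (ae_iff.1 hint)
    rintro b rfl hb
    exact hne (sub_eq_zero.1 hb).symm
  rw [PMF.toMeasure_apply_singleton _ _ (measurableSet_singleton a)] at h1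
  exact ha h1

theorem exists_allowed_vHat_eq {h : ℕ} (hh : h ∈ Finset.Icc 1 M.H)
    (hφ : Measurable fun x : S × A => φ h x.1 x.2)
    (hπ : IsEnsemblePolicy M φ 1 β supp st ac rw k π) (s : S) :
    ∃ a ∈ allowedActions M supp h s,
      vHat M φ 1 β st ac rw k π h s = qHat M φ 1 β st ac rw k π h s a := by
  obtain ⟨a, ha⟩ := ((π h).act s).support_nonempty
  obtain ⟨h1, h2⟩ := qHat_eq_vHat_of_mem_support hh hφ hπ ha
  exact ⟨a, h1, h2.symm⟩

/-- The regression targets of the algorithm are greatest pessimistic values over the allowed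
actions: the bonus `β ‖φ‖_{Σ⁻¹}` is `√(φᵀ (β² Σ⁻¹) φ)`. -/
theorem isEnvelope_vHat (hφ : ∀ h ∈ Finset.Icc 1 M.H, Measurable fun x : S × A => φ h x.1 x.2)
    (hβ : 0 ≤ β k) (hπ : IsEnsemblePolicy M φ 1 β supp st ac rw k π) {h : ℕ}
    (hh : h ∈ Finset.Icc 1 M.H) :
    IsEnvelope M φ (allowedActions M supp (h + 1)) h (vHat M φ 1 β st ac rw k π (h + 1))
      (weight φ 1 st ac rw k (h + 1) (vHat M φ 1 β st ac rw k π (h + 1 + 1)))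
      (β k ^ 2 • (gram φ 1 st ac k (h + 1))⁻¹) := by
  rcases (Finset.mem_Icc.1 hh).2.eq_or_lt with h3 | h3
  · exact Or.inr ⟨h3, by rw [h3, vHat_succ_H]⟩
  · have hh' : h + 1 ∈ Finset.Icc 1 M.H := Finset.mem_Icc.2 ⟨by omega, h3⟩
    have e : ∀ s a, pessimisticValue M φ (h + 1)
        (weight φ 1 st ac rw k (h + 1) (vHat M φ 1 β st ac rw k π (h + 1 + 1)))
        (β k ^ 2 • (gram φ 1 st ac k (h + 1))⁻¹) s a
        = qHat M φ 1 β st ac rw k π (h + 1) s a := fun s a => by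
      rw [pessimisticValue, qHat, qHatOf, bonus, Matrix.smul_mulVec, dotProduct_smul, smul_eq_mul,
        Real.sqrt_mul (sq_nonneg _), Real.sqrt_sq hβ]
    simp only [IsEnvelope, e]
    exact Or.inl ⟨h3, fun s => ⟨fun a ha => qHat_le_vHat hπ hh' ha,
      exists_allowed_vHat_eq hh' (hφ _ hh') hπ s⟩⟩

section Pessimism

variable [SFinite ρ] {πstar : Policy S A}

/-- The computed values are pessimistic. -/
theorem IsAccurate.vHat_le_V
    (hφ : ∀ h ∈ Finset.Icc 1 M.H, Measurable fun x : S × A => φ h x.1 x.2)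
    (hπ : IsEnsemblePolicy M φ 1 β supp st ac rw k π)
    (hacc : IsAccurate M φ β st ac rw k π) (hopt : M.IsOptimal πstar) :
    ∀ h ∈ Finset.Icc 1 (M.H + 1), ∀ s, vHat M φ 1 β st ac rw k π h s ≤ M.V πstar h s := by
  refine MDP.backward_induction ?_ ?_
  · intro s; rw [vHat_succ_H, M.V_succ_H]
  · intro h hh ih s
    obtain ⟨a, -, ha⟩ := exists_allowed_vHat_eq hh (hφ h hh) hπ s
    rw [ha]
    refine (hacc.qHat_le_bellman hφ hh s a).trans (le_trans ?_ (M.Q_le_V_of_isOptimal hopt hh s a))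
    exact M.bellman_mono hh (M.measurable_V πstar (MDP.succ_mem_Icc hh))
      (isTarget_vHat hφ hh).nonneg ih (M.V_le πstar (MDP.succ_mem_Icc hh)) s a

theorem IsAccurate.qHat_le_Q
    (hφ : ∀ h ∈ Finset.Icc 1 M.H, Measurable fun x : S × A => φ h x.1 x.2)
    (hπ : IsEnsemblePolicy M φ 1 β supp st ac rw k π)
    (hacc : IsAccurate M φ β st ac rw k π) (hopt : M.IsOptimal πstar) {h : ℕ}
    (hh : h ∈ Finset.Icc 1 M.H) (s : S) (a : A) :
    qHat M φ 1 β st ac rw k π h s a ≤ M.Q πstar h s a :=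
  (hacc.qHat_le_bellman hφ hh s a).trans
    (M.bellman_mono hh (M.measurable_V πstar (MDP.succ_mem_Icc hh)) (isTarget_vHat hφ hh).nonneg
      (hacc.vHat_le_V hφ hπ hopt _ (MDP.succ_mem_Icc hh)) (M.V_le πstar (MDP.succ_mem_Icc hh)) s a)

variable {f : ℕ → S → A} (hf : ∀ h, Measurable (f h))

/-- Along the optimal policy the computed values fall short of the optimal ones by at most the
bonuses still to come. -/
theorem IsAccurate.V_sub_vHat_le
    (hφ : ∀ h ∈ Finset.Icc 1 M.H, Measurable fun x : S × A => φ h x.1 x.2) (hβ : 0 ≤ β k)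
    (hπ : IsEnsemblePolicy M φ 1 β supp st ac rw k π) (hacc : IsAccurate M φ β st ac rw k π)
    {b : ℝ} (hb : ∀ h ∈ Finset.Icc 1 M.H, ∀ᵐ s ∂(M.occupancy (detPolicy f hf) h),
      f h s ∈ allowedActions M supp h s ∧ 2 * bonus φ 1 β st ac k h s (f h s) ≤ b) :
    ∀ h ∈ Finset.Icc 1 (M.H + 1), ∀ᵐ s ∂(M.occupancy (detPolicy f hf) h),
      M.V (detPolicy f hf) h s - vHat M φ 1 β st ac rw k π h s ≤ ((M.H : ℝ) + 1 - h) * b := by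
  refine MDP.backward_induction ?_ ?_
  · refine Filter.Eventually.of_forall fun s => ?_
    rw [vHat_succ_H, M.V_succ_H]; simp
  · intro h hh ih
    have hnext : ∀ᵐ s ∂(M.occupancy (detPolicy f hf) h), ∀ᵐ s' ∂(M.transMeasure h s (f h s)),
        M.V (detPolicy f hf) (h + 1) s' - vHat M φ 1 β st ac rw k π (h + 1) s'
          ≤ ((M.H : ℝ) + 1 - (h + 1 : ℕ)) * b := by
      rcases (Finset.mem_Icc.1 hh).2.eq_or_lt with h3 | h3
      · refine Filter.Eventually.of_forall fun s => Filter.Eventually.of_forall fun s' => ?_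
        rw [h3, vHat_succ_H, M.V_succ_H]; simp
      · exact M.ae_transMeasure_of_ae_occupancy_succ hf hh
          (Finset.mem_Icc.2 ⟨by omega, h3⟩) ih
    filter_upwards [hb h hh, hnext] with s hs hs'
    have hpr := M.isProbabilityMeasure_transMeasure hh s (f h s)
    have hT := isTarget_vHat (β := β) (st := st) (ac := ac) (rw := rw) (k := k) (π := π) hφ hh
    have h1 := (hacc.bellman_sub_le_qHat hφ hβ hh s (f h s)).trans (qHat_le_vHat hπ hh hs.1)
    have h2 : M.bellman h (M.V (detPolicy f hf) (h + 1)) s (f h s)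
        - M.bellman h (vHat M φ 1 β st ac rw k π (h + 1)) s (f h s)
        ≤ ((M.H : ℝ) + 1 - (h + 1 : ℕ)) * b := by
      have i1 := M.integrable_transMeasure hh
        (M.measurable_V (detPolicy f hf) (MDP.succ_mem_Icc hh))
        (M.V_nonneg _ (MDP.succ_mem_Icc hh)) (M.V_le _ (MDP.succ_mem_Icc hh)) s (f h s)
      have i2 := M.integrable_transMeasure hh hT.meas hT.nonneg hT.le s (f h s)
      rw [MDP.bellman, MDP.bellman, add_sub_add_left_eq_sub, ← integral_sub i1 i2]
      refine (integral_mono_ae (i1.sub i2) (integrable_const _) hs').trans ?_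
      simp
    rw [M.V_detPolicy hf hh, MDP.Q]
    push_cast at h2
    linarith [hs.2]

/-- If the bonuses along the optimal policy are small compared to the minimal gap, the extracted
policy plays the optimal action almost everywhere: any other action loses at least the gap, but
its pessimistic value is at least that of the optimal action. -/
theorem IsAccurate.ae_act_eq_pure
    (hφ : ∀ h ∈ Finset.Icc 1 M.H, Measurable fun x : S × A => φ h x.1 x.2) (hβ : 0 ≤ β k)
    (hπ : IsEnsemblePolicy M φ 1 β supp st ac rw k π) (hacc : IsAccurate M φ β st ac rw k π)
    (hopt : M.IsOptimal (detPolicy f hf))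
    (huniq : ∀ h ∈ Finset.Icc 1 M.H, ∀ s, 0 < M.stateDens (detPolicy f hf) h s →
      ∃! a, M.gap (detPolicy f hf) h s a = 0)
    {b : ℝ} (hb : ∀ h ∈ Finset.Icc 1 M.H, ∀ᵐ s ∂(M.occupancy (detPolicy f hf) h),
      f h s ∈ allowedActions M supp h s ∧ 2 * bonus φ 1 β st ac k h s (f h s) ≤ b)
    (hb0 : 0 ≤ b) (hgap : M.H * b < M.gapMin (detPolicy f hf)) {h : ℕ}
    (hh : h ∈ Finset.Icc 1 M.H) :
    ∀ᵐ s ∂(M.occupancy (detPolicy f hf) h), (π h).act s = PMF.pure (f h s) := by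
  have hpos := M.ae_stateDens_pos (detPolicy f hf) hh
  filter_upwards [hpos, hacc.V_sub_vHat_le hf hφ hβ hπ hb h (MDP.mem_Icc_succ hh)] with s hs hV
  have hh1 : (1 : ℝ) ≤ h := by exact_mod_cast (Finset.mem_Icc.1 hh).1
  have hV' : M.V (detPolicy f hf) h s - vHat M φ 1 β st ac rw k π h s ≤ M.H * b :=
    hV.trans (mul_le_mul_of_nonneg_right (by linarith) hb0)
  have hsub : ((π h).act s).support ⊆ {f h s} := by
    intro a ha
    have h1 := (qHat_eq_vHat_of_mem_support hh (hφ h hh) hπ ha).2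
    have h2 := hacc.qHat_le_Q hφ hπ hopt hh s a
    have h3 : M.gap (detPolicy f hf) h s a = 0 := by
      by_contra hne
      have := M.gapMin_le_gap hopt hh hne
      rw [MDP.gap] at this
      linarith
    have h4 : M.gap (detPolicy f hf) h s (f h s) = 0 := by
      rw [MDP.gap, M.V_detPolicy hf hh, sub_self]
    exact (huniq h hh s hs).unique h3 h4
  have heq : ((π h).act s).support = {f h s} :=
    (Set.subset_singleton_iff_eq.1 hsub).resolve_left ((π h).act s).support_nonempty.ne_empty
  ext a
  rcases eq_or_ne a (f h s) with rfl | hne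
  · rw [((π h).act s).apply_eq_one_iff _ |>.2 heq, PMF.pure_apply, if_pos rfl]
  · rw [PMF.pure_apply, if_neg hne, PMF.apply_eq_zero_iff, heq]
    exact hne

end Pessimism

end ValueIteration

/-! ### Deterministic consequences of the concentration events -/

section Round

variable {S A Ω : Type*} [MeasurableSpace S] [MeasurableSpace A]
  [MeasurableEq A] {ρ : Measure S} {M : MDP S A ρ}
  {d : ℕ} {φ : ℕ → S → A → EuclideanSpace ℝ (Fin d)} {β : ℕ → ℝ} {supp : ℕ → S → Set A}
  {st : ℕ → ℕ → Ω → S} {ac : ℕ → ℕ → Ω → A} {rw : ℕ → ℕ → Ω → ℝ} {k : ℕ} {π : Policy S A} {ω : Ω}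

/-- If the data cover the feature covariance of the optimal policy, the features along the optimal
policy have a small norm in the inverse Gram matrix. -/
theorem ae_ridge_inv_quadratic_le [SFinite ρ] (hlin : M.IsLinear φ) {f : ℕ → S → A}
    (hf : ∀ h, Measurable (f h)) {h : ℕ} (hh : h ∈ Finset.Icc 1 M.H) {α ℓ : ℝ} (hα : 0 ≤ α)
    (hcov : ∀ x : EuclideanSpace ℝ (Fin d), ‖x‖ ≤ 1 →
      α * (x.ofLp ⬝ᵥ (M.featureCov φ (detPolicy f hf) h).mulVec x.ofLp) - ℓ
        ≤ ∑ t ∈ Finset.Ico 1 k, optTerm M φ f (detPolicy f hf) h x (st t h ω) (ac t h ω))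
    (hker : ∀ t ∈ Finset.Ico 1 k, 0 < M.stateDens (detPolicy f hf) h (st t h ω) →
      ∀ y : EuclideanSpace ℝ (Fin d), (M.featureCov φ (detPolicy f hf) h).mulVec y.ofLp = 0 →
        inner ℝ y (φ h (st t h ω) (f h (st t h ω))) = 0)
    (hℓ : 2 * ℓ ≤ α * minPosEigenvalue (M.featureCov φ (detPolicy f hf) h))
    (hαpos : 0 < α * minPosEigenvalue (M.featureCov φ (detPolicy f hf) h)) :
    ∀ᵐ s ∂(M.occupancy (detPolicy f hf) h),
      (φ h s (f h s)).ofLp ⬝ᵥ (gram φ 1 (fun t h => st t h ω) (fun t h => ac t h ω) k h)⁻¹.mulVec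
        (φ h s (f h s)).ofLp
        ≤ 2 / (α * minPosEigenvalue (M.featureCov φ (detPolicy f hf) h)) := by
  classical
  have hφ := hlin.measurable_feature hh
  have hφ1 := hlin.norm_feature_le hh
  filter_upwards [ae_inner_eq_zero_of_featureCov hf hh hφ hφ1] with s hs
  refine ridge_inv_quadratic_le (T := Finset.Ico 1 k)
    (J := (Finset.Ico 1 k).filter fun t =>
      0 < M.stateDens (detPolicy f hf) h (st t h ω) ∧ ac t h ω = f h (st t h ω))
    (Finset.filter_subset _ _) (fun t => φ h (st t h ω) (ac t h ω))
    (isHermitian_featureCov hf hh hφ hφ1) (featureCov_quadratic_nonneg hf hh hφ hφ1) hα ?_ ?_ hℓ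
    hαpos (hφ1 _ _) hs
  · intro x hx
    refine (hcov x hx).trans_eq ?_
    rw [Finset.sum_filter]
    refine Finset.sum_congr rfl fun t _ => ?_
    rw [optTerm]
  · intro t ht y hy
    obtain ⟨ht1, ht2, ht3⟩ := Finset.mem_filter.1 ht
    rw [ht3]
    exact hker t ht1 ht2 y hy

theorem minPosEigenvalue_featureCov_mem [SFinite ρ] (hlin : M.IsLinear φ) {f : ℕ → S → A}
    (hf : ∀ h, Measurable (f h)) {h : ℕ} (hh : h ∈ Finset.Icc 1 M.H) :
    0 < minPosEigenvalue (M.featureCov φ (detPolicy f hf) h) ∧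
      minPosEigenvalue (M.featureCov φ (detPolicy f hf) h) ≤ 1 := by
  have hφ := hlin.measurable_feature hh
  have hφ1 := hlin.norm_feature_le hh
  obtain ⟨h1, x, hx, hxe⟩ := minPosEigenvalue_pos_of_ne_zero (isHermitian_featureCov hf hh hφ hφ1)
    (featureCov_quadratic_nonneg hf hh hφ hφ1) (by
      intro h0
      have := M.isProbabilityMeasure_occupancy (detPolicy f hf) hh
      obtain ⟨s, hs⟩ := (ae_inner_eq_zero_of_featureCov hf hh hφ hφ1).exists
      have h2 := hs (φ h s (f h s)) (by rw [h0, Matrix.zero_mulVec])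
      exact hlin.feature_ne_zero hh s (f h s) (inner_self_eq_zero.1 h2))
  refine ⟨h1, ?_⟩
  rw [← hxe]
  exact (featureCov_quadratic_le hf hh hφ hφ1 x).trans_eq (by rw [hx, one_pow])

variable [MeasurableSingletonClass S]

/-- If the regression noise is small uniformly over all targets, the Bellman regressions of the round
are accurate up to the bonus. -/
theorem isAccurate_of_noise_le (hlin : M.IsLinear φ) (hd : 1 ≤ d) (hk : 1 ≤ k) {D : ℝ}
    (hD4 : 4 ≤ D) (hDk : (d : ℝ) * M.H * k ≤ D) (hL1 : 1 ≤ Real.log D)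
    (hβ : β k = 256 * (d * M.H * Real.log D))
    (hr : ∀ t ∈ Finset.Ico 1 k, ∀ h ∈ Finset.Icc 1 M.H, rw t h ω ∈ Set.Icc (0 : ℝ) 1)
    (hev : ∀ h ∈ Finset.Icc 1 M.H, ∀ (V : S → ℝ) (w : Fin d → ℝ) (L : Matrix (Fin d) (Fin d) ℝ),
      IsTarget M h V → IsEnvelope M φ (allowedActions M supp (h + 1)) h V w L →
      (∀ i, |w i| ≤ D ^ 12) → (∀ i j, |L i j| ≤ D ^ 12) →
      ∀ x : EuclideanSpace ℝ (Fin d), ‖x‖ ≤ 1 →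
        ∑ t ∈ Finset.Ico 1 k, inner ℝ x (φ h (st t h ω) (ac t h ω)) ^ 2 ≤ 1 →
        ∑ t ∈ Finset.Ico 1 k, inner ℝ x (φ h (st t h ω) (ac t h ω)) *
          noise M st ac rw h V t ω ≤ 106 * (d * M.H * Real.log D))
    (hπ : IsEnsemblePolicy M φ 1 β supp (fun t h => st t h ω) (fun t h => ac t h ω)
      (fun t h => rw t h ω) k π) :
    IsAccurate M φ β (fun t h => st t h ω) (fun t h => ac t h ω) (fun t h => rw t h ω) k π := by
  intro h hh s a
  have hH1 : (1 : ℝ) ≤ M.H := by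
    rw [Finset.mem_Icc] at hh; exact_mod_cast hh.1.trans hh.2
  have hdR : (1 : ℝ) ≤ d := by exact_mod_cast hd
  have hkR : (1 : ℝ) ≤ k := by exact_mod_cast hk
  have hdH : (1 : ℝ) ≤ d * M.H := by nlinarith
  have hdHD : (d : ℝ) * M.H ≤ D := le_trans (by nlinarith) hDk
  have hHkD : (M.H : ℝ) * k ≤ D := by
    refine le_trans ?_ hDk
    rw [mul_assoc]
    exact le_mul_of_one_le_left (by positivity) hdR
  have hβ0 : 0 ≤ β k := by rw [hβ]; positivity
  have hφ := fun h (hh : h ∈ Finset.Icc 1 M.H) => hlin.measurable_feature hh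
  have hT := isTarget_vHat (β := β) (st := fun t h => st t h ω) (ac := fun t h => ac t h ω)
    (rw := fun t h => rw t h ω) (k := k) (π := π) hφ hh
  have hD12 : 0 ≤ D ^ 12 := by positivity
  have hnoise : ∀ x : EuclideanSpace ℝ (Fin d), ‖x‖ ≤ 1 →
      ∑ t ∈ Finset.Ico 1 k, inner ℝ x (φ h (st t h ω) (ac t h ω)) ^ 2 ≤ 1 →
      ∑ t ∈ Finset.Ico 1 k, inner ℝ x (φ h (st t h ω) (ac t h ω)) * noise M st ac rw h
        (vHat M φ 1 β (fun t h => st t h ω) (fun t h => ac t h ω) (fun t h => rw t h ω) k π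
          (h + 1)) t ω ≤ 106 * (d * M.H * Real.log D) := by
    rcases (Finset.mem_Icc.1 hh).2.eq_or_lt with h3 | h3
    -- After the last step the target vanishes and does not depend on a weight.
    · refine hev h hh _ 0 0 hT (Or.inr ⟨h3, by rw [h3, vHat_succ_H]⟩) ?_ ?_
      · intro i; simpa using hD12
      · intro i j; simpa using hD12
    · have hh' : h + 1 ∈ Finset.Icc 1 M.H := Finset.mem_Icc.2 ⟨by omega, h3⟩
      refine hev h hh _ _ _ hT (isEnvelope_vHat hφ hβ0 hπ hh) ?_ ?_
      · intro i
        have hT' := isTarget_vHat (β := β) (st := fun t h => st t h ω)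
          (ac := fun t h => ac t h ω) (rw := fun t h => rw t h ω) (k := k) (π := π) hφ hh'
        have h1 := abs_ridge_inv_mulVec_sum_le (Finset.Ico 1 k)
          (fun t => φ (h + 1) (st t (h + 1) ω) (ac t (h + 1) ω))
          (c := fun t => rw t (h + 1) ω + vHat M φ 1 β (fun t h => st t h ω)
            (fun t h => ac t h ω) (fun t h => rw t h ω) k π (h + 1 + 1) (st t (h + 1 + 1) ω))
          (B := 1 + M.H) (fun t _ => hlin.norm_feature_le hh' _ _)
          (fun t ht => by
            have h2 := hr t ht _ hh'
            have h3 := hT'.nonneg (st t (h + 1 + 1) ω)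
            have h4 := hT'.le (st t (h + 1 + 1) ω)
            rw [abs_of_nonneg (by linarith [h2.1])]
            linarith [h2.2]) i
        refine (h1.trans ?_ : _)
        have h2 : ((Finset.Ico 1 k).card : ℝ) ≤ k := by
          rw [Nat.card_Ico]; exact_mod_cast Nat.sub_le k 1
        calc ((Finset.Ico 1 k).card : ℝ) * (1 + M.H) ≤ k * (1 + M.H) := by gcongr
          _ ≤ 2 * D := by nlinarith
          _ ≤ D ^ 11 * D := by
            have : (2 : ℝ) ≤ D ^ 11 := by
              calc (2 : ℝ) ≤ 4 ^ 11 := by norm_num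
                _ ≤ D ^ 11 := by gcongr
            gcongr
          _ = D ^ 12 := by ring
      · intro i j
        have h1 := abs_ridge_inv_apply_le (Finset.Ico 1 k)
          (fun t => φ (h + 1) (st t (h + 1) ω) (ac t (h + 1) ω)) i j
        have h2 : β k ≤ 256 * (D * D) := by
          rw [hβ]
          have : Real.log D ≤ D := (Real.log_le_sub_one_of_pos (by linarith)).trans (by linarith)
          gcongr
        change |β k ^ 2 * _| ≤ _
        rw [abs_mul, abs_of_nonneg (sq_nonneg _)]
        calc β k ^ 2 * |_| ≤ β k ^ 2 * 1 := mul_le_mul_of_nonneg_left h1 (sq_nonneg _)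
          _ ≤ (256 * (D * D)) ^ 2 := by rw [mul_one]; gcongr
          _ = 4 ^ 8 * D ^ 4 := by ring
          _ ≤ D ^ 8 * D ^ 4 := by gcongr
          _ = D ^ 12 := by ring
  obtain ⟨w, hw, hB⟩ := hlin.exists_bellman_eq hh hd hT.meas hT.nonneg hT.le
  have key := abs_ridge_prediction_sub_le (Finset.Ico 1 k)
    (fun t => φ h (st t h ω) (ac t h ω)) (w := w)
    (c := fun t => rw t h ω + vHat M φ 1 β (fun t h => st t h ω) (fun t h => ac t h ω)
      (fun t h => rw t h ω) k π (h + 1) (st t (h + 1) ω))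
    (fun t _ => by rw [noise, hB]; ring) hnoise hw (φ h s a)
  rw [hB]
  refine key.trans ?_
  -- The noise contributes `106 d H log D`, the regularization `2 d H`.
  rw [bonus, hβ]
  refine mul_le_mul_of_nonneg_right ?_ (Real.sqrt_nonneg _)
  nlinarith

/-- On the concentration events, the policy of a late enough round is optimal. -/
theorem subOpt_eq_zero_of_events [SFinite ρ] (hlin : M.IsLinear φ) {f : ℕ → S → A}
    (hf : ∀ h, Measurable (f h)) (hopt : M.IsOptimal (detPolicy f hf))
    (hgap : 0 < M.gapMin (detPolicy f hf))
    (huniq : ∀ h ∈ Finset.Icc 1 M.H, ∀ s, 0 < M.stateDens (detPolicy f hf) h s →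
      ∃! a, M.gap (detPolicy f hf) h s a = 0)
    (hsupp : ∀ h ∈ Finset.Icc 1 M.H, ∀ s, 0 < M.stateDens (detPolicy f hf) h s →
      f h s ∈ supp h s) (hd : 1 ≤ d) {D : ℝ} (hL1 : 1 ≤ Real.log D)
    (hβ : β k = 256 * (d * M.H * Real.log D))
    (hπ : IsEnsemblePolicy M φ 1 β supp (fun t h => st t h ω) (fun t h => ac t h ω)
      (fun t h => rw t h ω) k π)
    (hacc : IsAccurate M φ β (fun t h => st t h ω) (fun t h => ac t h ω) (fun t h => rw t h ω) k π)
    {α : ℕ → ℝ} (hα : ∀ h ∈ Finset.Icc 1 M.H, 0 ≤ α h)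
    (hcov : ∀ h ∈ Finset.Icc 1 M.H, ∀ x : EuclideanSpace ℝ (Fin d), ‖x‖ ≤ 1 →
      α h * (x.ofLp ⬝ᵥ (M.featureCov φ (detPolicy f hf) h).mulVec x.ofLp)
        - 51 * ((d : ℝ) ^ 2 * Real.log D)
        ≤ ∑ t ∈ Finset.Ico 1 k, optTerm M φ f (detPolicy f hf) h x (st t h ω) (ac t h ω))
    (hker : ∀ h ∈ Finset.Icc 1 M.H, ∀ t ∈ Finset.Ico 1 k,
      0 < M.stateDens (detPolicy f hf) h (st t h ω) →
      ∀ y : EuclideanSpace ℝ (Fin d), (M.featureCov φ (detPolicy f hf) h).mulVec y.ofLp = 0 →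
        inner ℝ y (φ h (st t h ω) (f h (st t h ω))) = 0)
    (hbig : ∀ h ∈ Finset.Icc 1 M.H, 32 * (256 * (d * M.H * Real.log D)) ^ 2 * (M.H : ℝ) ^ 2
      ≤ M.gapMin (detPolicy f hf) ^ 2 *
        (α h * minPosEigenvalue (M.featureCov φ (detPolicy f hf) h))) :
    M.subOpt (detPolicy f hf) π = 0 := by
  set Δ := M.gapMin (detPolicy f hf) with hΔ
  have hΔH : Δ ≤ M.H := M.gapMin_le_H hopt hgap
  have hH0 : (0 : ℝ) < M.H := hgap.trans_le hΔH
  have hH1 : (1 : ℝ) ≤ M.H := by exact_mod_cast (by exact_mod_cast hH0 : 0 < M.H)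
  have hdR : (1 : ℝ) ≤ d := by exact_mod_cast hd
  have hφ := fun h (hh : h ∈ Finset.Icc 1 M.H) => hlin.measurable_feature hh
  have hβ0 : 0 ≤ β k := by rw [hβ]; positivity
  -- With bonuses of at most `Δ / (4 H)` the accumulated loss is at most `Δ / 2`.
  refine subOpt_eq_zero_of_ae_act_eq_pure hf fun h hh =>
    hacc.ae_act_eq_pure (b := Δ / (2 * M.H)) hf hφ hβ0 hπ hopt huniq ?_ (by positivity) ?_ hh
  · intro h hh
    set l := minPosEigenvalue (M.featureCov φ (detPolicy f hf) h) with hl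
    have hb := hbig h hh
    have hαl : 0 < α h * l := by
      by_contra! hcon
      have h1 : 0 < 32 * (256 * (d * M.H * Real.log D)) ^ 2 * (M.H : ℝ) ^ 2 := by positivity
      have h2 : Δ ^ 2 * (α h * l) ≤ 0 := mul_nonpos_of_nonneg_of_nonpos (sq_nonneg _) hcon
      linarith
    have hℓ : 2 * (51 * ((d : ℝ) ^ 2 * Real.log D)) ≤ α h * l := by
      have h1 : Δ ^ 2 * (α h * l) ≤ (M.H : ℝ) ^ 2 * (α h * l) := by gcongr
      have h2 : 32 * (256 * (d * M.H * Real.log D)) ^ 2 ≤ α h * l := by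
        have := hb.trans h1
        rw [mul_comm] at this
        exact le_of_mul_le_mul_left this (by positivity)
      refine le_trans ?_ h2
      have h3 : Real.log D ≤ Real.log D ^ 2 := by nlinarith
      have h4 : (1 : ℝ) ≤ (M.H : ℝ) ^ 2 := one_le_pow₀ hH1
      calc 2 * (51 * ((d : ℝ) ^ 2 * Real.log D)) ≤ 2 * (51 * ((d : ℝ) ^ 2 * Real.log D ^ 2)) := by
            gcongr
        _ ≤ 2 * (51 * ((d : ℝ) ^ 2 * Real.log D ^ 2)) * (M.H : ℝ) ^ 2 :=
            le_mul_of_one_le_right (by positivity) h4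
        _ = 102 * (d * M.H * Real.log D) ^ 2 := by ring
        _ ≤ 32 * (256 * (d * M.H * Real.log D)) ^ 2 := by
            rw [mul_pow 256]; nlinarith [sq_nonneg ((d : ℝ) * M.H * Real.log D)]
    have hpos := M.ae_stateDens_pos (detPolicy f hf) hh
    filter_upwards [hpos, ae_ridge_inv_quadratic_le hlin hf hh (hα h hh) (hcov h hh) (hker h hh) hℓ
      hαl] with s hs hq
    refine ⟨fun _ => hsupp h hh s hs, ?_⟩
    rw [bonus, ← mul_assoc]
    have h1 : Real.sqrt ((φ h s (f h s)).ofLp ⬝ᵥ (gram φ 1 (fun t h => st t h ω)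
        (fun t h => ac t h ω) k h)⁻¹.mulVec (φ h s (f h s)).ofLp)
        ≤ Real.sqrt (2 / (α h * l)) := Real.sqrt_le_sqrt hq
    refine (mul_le_mul_of_nonneg_left h1 (by positivity)).trans ?_
    refine le_of_sq_le_sq ?_ (by positivity)
    rw [mul_pow, Real.sq_sqrt (by positivity), hβ, div_pow, le_div_iff₀ (by positivity),
      ← mul_div_assoc, div_mul_eq_mul_div, div_le_iff₀ hαl]
    linarith
  · rw [← mul_div_assoc, div_lt_iff₀ (by positivity)]
    nlinarith

end Round

/-! ### The threshold -/

/-- A sample size `k ≥ C X log²(e + Y)` satisfies `k ≥ 2²³ X log² D` with `D = d H k / δ`, although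
`D` depends on `k`: here `log D ≤ log Y + log k`, `X ≤ Y³`, and `log² (k / X)` is of lower order
than `k / X`. -/
theorem log_sq_mul_le_of_threshold_le {d H κs κp δ Δ l k : ℝ} (hd : 1 ≤ d) (hH : 1 ≤ H)
    (hκs : H ≤ κs) (hκp : 1 ≤ κp) (hδ : 0 < δ) (hδ1 : δ ≤ 1) (hΔ : 0 < Δ) (hΔH : Δ ≤ H)
    (hl : 0 < l) (hl1 : l ≤ 1)
    (hk : 2 ^ 60 * (d ^ 2 * H ^ 4 * κp / (Δ ^ 2 * l ^ 3)) *
      Real.log (Real.exp 1 + d * H * κs * κp / (δ * Δ * l)) ^ 2 ≤ k)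
    (hD : 0 ≤ Real.log (d * H * k / δ)) :
    2 ≤ k ∧ 2 ^ 23 * (d ^ 2 * H ^ 4 * κp / (Δ ^ 2 * l ^ 3)) * Real.log (d * H * k / δ) ^ 2 ≤ k := by
  have hd0 : 0 < d := by linarith
  have hH0 : 0 < H := by linarith
  have hκs0 : 0 < κs := by linarith
  have hκp0 : 0 < κp := by linarith
  set X := d ^ 2 * H ^ 4 * κp / (Δ ^ 2 * l ^ 3) with hX
  set Y := d * H * κs * κp / (δ * Δ * l) with hY
  set ℓ := Real.log (Real.exp 1 + Y) with hℓ
  have hX0 : 0 < X := by positivity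
  have hY0 : 0 < Y := by positivity
  have hℓ1 : 1 ≤ ℓ := by
    rw [hℓ, Real.le_log_iff_exp_le (by positivity)]; linarith
  have hYℓ : Real.log Y ≤ ℓ := Real.log_le_log hY0 (by linarith [Real.exp_pos 1])
  have lX : Real.log X = 2 * Real.log d + 4 * Real.log H + Real.log κp
      - (2 * Real.log Δ + 3 * Real.log l) := by
    rw [hX, Real.log_div (by positivity) (by positivity), Real.log_mul (by positivity)
      (by positivity), Real.log_mul (by positivity) (by positivity), Real.log_mul (by positivity)
      (by positivity), Real.log_pow, Real.log_pow, Real.log_pow, Real.log_pow]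
    push_cast; ring
  have lY : Real.log Y = Real.log d + Real.log H + Real.log κs + Real.log κp
      - (Real.log δ + Real.log Δ + Real.log l) := by
    rw [hY, Real.log_div (by positivity) (by positivity), Real.log_mul (by positivity)
      (by positivity), Real.log_mul (by positivity) (by positivity), Real.log_mul (by positivity)
      (by positivity), Real.log_mul (by positivity) (by positivity), Real.log_mul (by positivity)
      (by positivity)]
  have n1 := Real.log_nonneg hd
  have n2 := Real.log_nonneg hH
  have n3 := Real.log_nonneg hκp
  have n4 := Real.log_nonpos hδ.le hδ1
  have n5 := Real.log_nonpos hl.le hl1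
  have n6 := Real.log_le_log hH0 hκs
  have n7 := Real.log_le_log hΔ hΔH
  have hX1 : 1 ≤ X := by
    rw [← Real.log_nonneg_iff hX0, lX]; linarith
  have hk0 : 0 < k := lt_of_lt_of_le (by positivity) hk
  have lD : Real.log (d * H * k / δ) = Real.log d + Real.log H + Real.log k - Real.log δ := by
    rw [Real.log_div (by positivity) (by positivity), Real.log_mul (by positivity)
      (by positivity), Real.log_mul (by positivity) (by positivity)]
  -- It suffices that `2²³ log² D ≤ j` for `j = k / X`, where `log D ≤ log Y + log X + log j`.
  set j := k / X with hj
  have hkj : k = X * j := by rw [hj, mul_div_cancel₀ _ hX0.ne']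
  have hjℓ : 2 ^ 60 * ℓ ^ 2 ≤ j := by
    rw [hj, le_div_iff₀ hX0]; linarith
  have hj1 : (2 : ℝ) ^ 60 ≤ j := le_trans (le_mul_of_one_le_right (by positivity)
    (one_le_pow₀ hℓ1)) hjℓ
  have hj0 : 0 < j := lt_of_lt_of_le (by positivity) hj1
  have lk : Real.log k = Real.log X + Real.log j := by
    rw [hkj, Real.log_mul hX0.ne' hj0.ne']
  have lj : Real.log j ≤ 4 * Real.sqrt (Real.sqrt j) := by
    have h1 : Real.log j = 4 * Real.log (Real.sqrt (Real.sqrt j)) := by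
      rw [Real.log_sqrt (Real.sqrt_nonneg _), Real.log_sqrt hj0.le]; ring
    have h2 := Real.log_le_sub_one_of_pos (x := Real.sqrt (Real.sqrt j))
      (Real.sqrt_pos.2 (Real.sqrt_pos.2 hj0))
    linarith
  have hlogD : Real.log (d * H * k / δ) ≤ 4 * ℓ + 4 * Real.sqrt (Real.sqrt j) := by
    rw [lD, lk]; linarith
  have hsq : Real.log (d * H * k / δ) ^ 2 ≤ 32 * ℓ ^ 2 + 32 * Real.sqrt j := by
    refine (pow_le_pow_left₀ hD hlogD 2).trans ?_
    have := Real.sq_sqrt (Real.sqrt_nonneg j)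
    nlinarith [sq_nonneg (ℓ - Real.sqrt (Real.sqrt j))]
  -- `2²³ · 32 ℓ²` and `2²³ · 32 √j` are each at most `j / 2`, as `2⁶⁰ ≤ 2⁶⁰ ℓ² ≤ j`.
  have hsj : (2 : ℝ) ^ 30 ≤ Real.sqrt j := Real.le_sqrt_of_sq_le (by
    rw [← pow_mul]; exact hj1)
  have hsj2 : (2 : ℝ) ^ 30 * Real.sqrt j ≤ j := by
    calc (2 : ℝ) ^ 30 * Real.sqrt j ≤ Real.sqrt j * Real.sqrt j := by gcongr
      _ = j := Real.mul_self_sqrt hj0.le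
  constructor
  · rw [hkj]
    refine le_trans ?_ (le_mul_of_one_le_left hj0.le hX1)
    norm_num at hj1 ⊢; linarith
  · have h1 : 2 ^ 23 * Real.log (d * H * k / δ) ^ 2 ≤ j := by
      norm_num at hjℓ hsj2 ⊢
      linarith
    calc 2 ^ 23 * X * Real.log (d * H * k / δ) ^ 2
        = X * (2 ^ 23 * Real.log (d * H * k / δ) ^ 2) := by ring
      _ ≤ X * j := by gcongr
      _ = k := hkj.symm

theorem kTilde_le_kStar (C : ℝ) (p d H : ℕ) (κ lamPlus : ℕ → ℝ) (Δ δ : ℝ) {h : ℕ}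
    (hh : h ∈ Finset.Icc 1 H) :
    kTilde C p d H κ lamPlus Δ δ h ≤ kStar C p d H κ lamPlus Δ δ :=
  (le_max_right _ _).trans
    (le_ciSup (f := fun h : Finset.Icc 1 H =>
      max (kBar C p d H κ lamPlus Δ δ h) (kTilde C p d H κ lamPlus Δ δ h))
      (Set.finite_range _).bddAbove ⟨h, hh⟩)

theorem le_kappaSum {H : ℕ} {κ : ℕ → ℝ} (hκ : ∀ h ∈ Finset.Icc 1 H, 1 ≤ κ h) :
    (H : ℝ) ≤ kappaSum H κ := by
  have := Finset.card_nsmul_le_sum (Finset.Icc 1 H) κ 1 hκ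
  simpa [kappaSum] using this

theorem le_kappaProd {H : ℕ} {κ : ℕ → ℝ} (hκ : ∀ h ∈ Finset.Icc 1 H, 1 ≤ κ h) {h : ℕ}
    (hh : h ∈ Finset.Icc 1 H) : κ h ≤ kappaProd κ h := by
  have hh' := Finset.mem_Icc.1 hh
  have hmem : h ∈ Finset.Icc 1 h := Finset.mem_Icc.2 ⟨hh'.1, le_rfl⟩
  have hone : ∀ i ∈ Finset.Icc 1 h, 1 ≤ κ i := fun i hi =>
    hκ i (Finset.mem_Icc.2 ⟨(Finset.mem_Icc.1 hi).1, (Finset.mem_Icc.1 hi).2.trans hh'.2⟩)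
  rw [kappaProd, ← Finset.mul_prod_erase _ _ hmem]
  refine le_mul_of_one_le_right (by linarith [hκ h hh]) ?_
  exact Finset.one_le_prod fun i hi => hone i (Finset.mem_of_mem_erase hi)

section Kappa

variable {S A Ω : Type*} [MeasurableSpace S] [MeasurableSpace A] {ρ : Measure S} {M : MDP S A ρ}
  {K : ℕ} {μ : ℕ → Ω → Policy S A} {h : ℕ}

theorem invKappa_le {t : ℕ} (ht : t ∈ Finset.Icc 1 K) (ω : Ω) {s : S} {a : A}
    (hpos : 0 < M.saDens (μ t ω) h s a) : invKappa M K μ h ≤ M.saDens (μ t ω) h s a :=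
  sInf_le ⟨hpos, t, ht, ω, s, a, rfl⟩

theorem kappa_eq_inv : kappa M K μ h = ((invKappa M K μ h).toReal)⁻¹ := ENNReal.toReal_inv _

theorem one_le_kappa (hpos : 0 < invKappa M K μ h) (hle : invKappa M K μ h ≤ 1) :
    1 ≤ kappa M K μ h := by
  have h1 : (invKappa M K μ h).toReal ≤ 1 := ENNReal.toReal_le_of_le_ofReal zero_le_one (by simpa)
  have h2 : 0 < (invKappa M K μ h).toReal :=
    ENNReal.toReal_pos hpos.ne' (ne_top_of_le_ne_top ENNReal.one_ne_top hle)
  rw [kappa_eq_inv]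
  exact (one_le_inv₀ h2).2 h1

end Kappa

/-! ### The good event -/

section GoodEvent

variable {S A Ω : Type*} [MeasurableSpace S] [MeasurableSpace A] [MeasurableEq A]
  [MeasurableSpace Ω] {P : Measure Ω} [IsProbabilityMeasure P] {ρ : Measure S} [SFinite ρ]
  {M : MDP S A ρ} {d : ℕ} {φ : ℕ → S → A → EuclideanSpace ℝ (Fin d)} {K : ℕ}
  {st : ℕ → ℕ → Ω → S} {ac : ℕ → ℕ → Ω → A} {rw : ℕ → ℕ → Ω → ℝ} {μ : ℕ → Ω → Policy S A}
  {f : ℕ → S → A}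

/-- The conclusions of the two concentration results at the step `h` of the round `k`. -/
def IsConcentrated (M : MDP S A ρ) (φ : ℕ → S → A → EuclideanSpace ℝ (Fin d))
    (st : ℕ → ℕ → Ω → S) (ac : ℕ → ℕ → Ω → A) (rw : ℕ → ℕ → Ω → ℝ) (f : ℕ → S → A)
    (hf : ∀ h, Measurable (f h)) (G : ℕ → S → Set A) (c : ℝ) (D : ℝ) (k h : ℕ) (ω : Ω) : Prop :=
  ((∀ t ∈ Finset.Ico 1 k, rw t h ω ∈ Set.Icc (0 : ℝ) 1) →
    ∀ (V : S → ℝ) (w : Fin d → ℝ) (L : Matrix (Fin d) (Fin d) ℝ), IsTarget M h V →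
      IsEnvelope M φ (G (h + 1)) h V w L → (∀ i, |w i| ≤ D ^ 12) → (∀ i j, |L i j| ≤ D ^ 12) →
      ∀ x : EuclideanSpace ℝ (Fin d), ‖x‖ ≤ 1 →
        ∑ t ∈ Finset.Ico 1 k, inner ℝ x (φ h (st t h ω) (ac t h ω)) ^ 2 ≤ 1 →
        ∑ t ∈ Finset.Ico 1 k, inner ℝ x (φ h (st t h ω) (ac t h ω)) *
          noise M st ac rw h V t ω ≤ 106 * (d * M.H * Real.log D)) ∧
  ∀ x : EuclideanSpace ℝ (Fin d), ‖x‖ ≤ 1 →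
    ((k : ℝ) - 1) * (c / 2) * (x.ofLp ⬝ᵥ (M.featureCov φ (detPolicy f hf) h).mulVec x.ofLp)
      - 51 * ((d : ℝ) ^ 2 * Real.log D)
      ≤ ∑ t ∈ Finset.Ico 1 k, optTerm M φ f (detPolicy f hf) h x (st t h ω) (ac t h ω)

theorem exists_concentrated (hlin : M.IsLinear φ) (hdata : IsAdaptiveData P M K st ac rw μ)
    (hf : ∀ h, Measurable (f h)) (G : ℕ → S → Set A) {h k : ℕ} (hh : h ∈ Finset.Icc 1 M.H)
    (hk : k ∈ Finset.Icc 1 (K + 1)) {c : ENNReal} (hc1 : c ≤ 1)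
    (h1 : ∀ s, M.stateDens (detPolicy f hf) h s ≤ 1)
    (hc : ∀ t ∈ Finset.Icc 1 K, ∀ ω, ∀ s, 0 < M.stateDens (detPolicy f hf) h s →
      c ≤ M.saDens (μ t ω) h s (f h s)) {D : ℝ} (hD4 : 4 ≤ D)
    (hd1 : 1 ≤ d) (hDk : (d : ℝ) * k ≤ D) (hL1 : 1 ≤ Real.log D) :
    ∃ B : Set Ω, P B ≤ ENNReal.ofReal (2 * (D ^ 3)⁻¹) ∧
      ∀ ω ∉ B, IsConcentrated M φ st ac rw f hf G c.toReal D k h ω := by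
  have hφ := hlin.measurable_feature hh
  obtain ⟨B₁, hB₁, hP₁⟩ := exists_regression_event hdata hh hk hφ
    (fun h hh => hlin.norm_feature_le hh) (G (h + 1)) hD4 hd1 hDk hL1
  obtain ⟨B₂, hB₂, hP₂⟩ := exists_coverage_event hdata hf hh hk hφ (hlin.norm_feature_le hh) hc1 h1
    hc hD4 hd1 hDk hL1
  have hD0 : 0 ≤ (D ^ 3)⁻¹ := by positivity
  refine ⟨B₁ ∪ B₂, ?_, fun ω hω => ⟨hP₁ ω fun h => hω (Or.inl h), hP₂ ω fun h => hω (Or.inr h)⟩⟩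
  refine (measure_union_le _ _).trans ((add_le_add hB₁ hB₂).trans_eq ?_)
  rw [← ENNReal.ofReal_add hD0 hD0, two_mul]

/-- A union bound over the rounds and steps: the failure probabilities `2 D⁻³` with `D = d H k / δ`
sum up to at most `4 δ`. -/
theorem exists_good_event (hlin : M.IsLinear φ) (hdata : IsAdaptiveData P M K st ac rw μ)
    (hf : ∀ h, Measurable (f h)) (G : ℕ → S → Set A) (hH : 1 ≤ M.H) (hd : 1 ≤ d)
    {c : ℕ → ENNReal} (hc1 : ∀ h ∈ Finset.Icc 1 M.H, c h ≤ 1)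
    (h1 : ∀ h ∈ Finset.Icc 1 M.H, ∀ s, M.stateDens (detPolicy f hf) h s ≤ 1)
    (hc : ∀ h ∈ Finset.Icc 1 M.H, ∀ t ∈ Finset.Icc 1 K, ∀ ω, ∀ s,
      0 < M.stateDens (detPolicy f hf) h s → c h ≤ M.saDens (μ t ω) h s (f h s))
    {δ : ℝ} (hδ : 0 < δ) (hδ4 : δ ≤ 1 / 4) :
    ∃ E : Set Ω, MeasurableSet E ∧ ENNReal.ofReal (1 - 4 * δ) ≤ P E ∧ ∀ ω ∈ E,
      (∀ k ∈ Finset.Icc 1 (K + 1), ∀ h ∈ Finset.Icc 1 M.H,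
        IsConcentrated M φ st ac rw f hf G (c h).toReal (d * M.H * k / δ) k h ω) ∧
      ∀ t ∈ Finset.Icc 1 K, ∀ h ∈ Finset.Icc 1 M.H, rw t h ω ∈ Set.Icc (0 : ℝ) 1 ∧
        (0 < M.stateDens (detPolicy f hf) h (st t h ω) → ∀ y : EuclideanSpace ℝ (Fin d),
          (M.featureCov φ (detPolicy f hf) h).mulVec y.ofLp = 0 →
            inner ℝ y (φ h (st t h ω) (f h (st t h ω))) = 0) := by
  have hHR : (1 : ℝ) ≤ M.H := by exact_mod_cast hH
  have hdR : (1 : ℝ) ≤ d := by exact_mod_cast hd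
  have hlog4 : 1 ≤ Real.log 4 := by
    rw [Real.le_log_iff_exp_le (by norm_num)]
    linarith [Real.exp_one_lt_d9]
  have hD : ∀ k ∈ Finset.Icc 1 (K + 1), (d : ℝ) * k ≤ d * M.H * k / δ ∧
      (M.H : ℝ) * k / δ ≤ d * M.H * k / δ ∧ 4 * (k : ℝ) ≤ d * M.H * k / δ ∧ (1 : ℝ) ≤ k := by
    intro k hk
    have hk1 : (1 : ℝ) ≤ k := by exact_mod_cast (Finset.mem_Icc.1 hk).1
    have a1 : (k : ℝ) ≤ M.H * k := le_mul_of_one_le_left (by positivity) hHR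
    have a2 : (M.H : ℝ) * k ≤ d * M.H * k := by
      rw [mul_assoc]; exact le_mul_of_one_le_left (by positivity) hdR
    have a3 : (d : ℝ) * k ≤ d * M.H * k := by
      rw [mul_assoc]; exact mul_le_mul_of_nonneg_left a1 (by positivity)
    refine ⟨?_, by gcongr, ?_, hk1⟩
    · rw [le_div_iff₀ hδ]
      refine le_trans (mul_le_of_le_one_right (by positivity) (by linarith)) a3
    · rw [le_div_iff₀ hδ]
      nlinarith
  have hex : ∀ k h, ∃ B : Set Ω, k ∈ Finset.Icc 1 (K + 1) → h ∈ Finset.Icc 1 M.H →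
      P B ≤ ENNReal.ofReal (2 * ((d * M.H * k / δ : ℝ) ^ 3)⁻¹) ∧
      ∀ ω ∉ B, IsConcentrated M φ st ac rw f hf G (c h).toReal (d * M.H * k / δ) k h ω := by
    intro k h
    by_cases hk : k ∈ Finset.Icc 1 (K + 1)
    · by_cases hh : h ∈ Finset.Icc 1 M.H
      · obtain ⟨e1, -, e3, e4⟩ := hD k hk
        have hD4 : (4 : ℝ) ≤ d * M.H * k / δ := by linarith
        obtain ⟨B, hB⟩ := exists_concentrated hlin hdata hf G hh hk (hc1 h hh) (h1 h hh) (hc h hh)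
          hD4 hd e1 (hlog4.trans (Real.log_le_log (by norm_num) hD4))
        exact ⟨B, fun _ _ => hB⟩
      · exact ⟨∅, fun _ h' => absurd h' hh⟩
    · exact ⟨∅, fun h' => absurd h' hk⟩
  choose B hB using hex
  set U : Set Ω := ⋃ k ∈ Finset.Icc 1 (K + 1), ⋃ h ∈ Finset.Icc 1 M.H, B k h with hU
  have hPU : P U ≤ ENNReal.ofReal (4 * δ) := by
    have hone : ∀ k ∈ Finset.Icc 1 (K + 1), P (⋃ h ∈ Finset.Icc 1 M.H, B k h)
        ≤ ENNReal.ofReal (2 * δ * ((k : ℝ) ^ 2)⁻¹) := by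
      intro k hk
      obtain ⟨-, e2, e3, e4⟩ := hD k hk
      refine (measure_biUnion_finset_le _ _).trans
        ((Finset.sum_le_sum fun h hh => (hB k h hk hh).1).trans ?_)
      rw [Finset.sum_const, Nat.card_Icc, Nat.add_sub_cancel, nsmul_eq_mul,
        ← ENNReal.ofReal_natCast, ← ENNReal.ofReal_mul (by positivity)]
      refine ENNReal.ofReal_le_ofReal ?_
      set D : ℝ := d * M.H * k / δ with hDdef
      have hD1 : (k : ℝ) ≤ D := by linarith
      have hD0 : 0 < D := by linarith
      have h3 : M.H * (k : ℝ) ^ 2 / δ ≤ D ^ 3 := by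
        calc M.H * (k : ℝ) ^ 2 / δ = (M.H * k / δ) * k * 1 := by ring
          _ ≤ D * D * D := by
            gcongr
            linarith
          _ = D ^ 3 := by ring
      have hHk : 0 < M.H * (k : ℝ) ^ 2 / δ := by positivity
      calc (M.H : ℝ) * (2 * (D ^ 3)⁻¹) ≤ M.H * (2 * (M.H * (k : ℝ) ^ 2 / δ)⁻¹) := by gcongr
        _ = 2 * δ * ((k : ℝ) ^ 2)⁻¹ := by field_simp
    refine (measure_biUnion_finset_le _ _).trans ((Finset.sum_le_sum hone).trans ?_)
    rw [← ENNReal.ofReal_sum_of_nonneg fun k _ => by positivity, ← Finset.mul_sum]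
    refine ENNReal.ofReal_le_ofReal ?_
    have hs := sum_Ioo_inv_sq_le (α := ℝ) 0 (K + 2)
    have he : Finset.Ioo 0 (K + 2) = Finset.Icc 1 (K + 1) := by
      ext i; simp only [Finset.mem_Ioo, Finset.mem_Icc]; omega
    rw [he] at hs
    have h2 : ∑ k ∈ Finset.Icc 1 (K + 1), ((k : ℝ) ^ 2)⁻¹ ≤ 2 := by
      refine hs.trans ?_
      norm_num
    nlinarith
  have hae : ∀ᵐ ω ∂P, ∀ t ∈ Finset.Icc 1 K, ∀ h ∈ Finset.Icc 1 M.H,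
      rw t h ω ∈ Set.Icc (0 : ℝ) 1 ∧
        (0 < M.stateDens (detPolicy f hf) h (st t h ω) → ∀ y : EuclideanSpace ℝ (Fin d),
          (M.featureCov φ (detPolicy f hf) h).mulVec y.ofLp = 0 →
            inner ℝ y (φ h (st t h ω) (f h (st t h ω))) = 0) := by
    refine (Filter.eventually_all_finset _).2 fun t ht =>
      (Filter.eventually_all_finset _).2 fun h hh => ?_
    exact (hdata.reward_mem t ht h hh).and (ae_data_inner_eq_zero hdata hf ht hh
      (hlin.measurable_feature hh) (hlin.norm_feature_le hh))
  set N : Set Ω := {ω | ¬ ∀ t ∈ Finset.Icc 1 K, ∀ h ∈ Finset.Icc 1 M.H,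
      rw t h ω ∈ Set.Icc (0 : ℝ) 1 ∧
        (0 < M.stateDens (detPolicy f hf) h (st t h ω) → ∀ y : EuclideanSpace ℝ (Fin d),
          (M.featureCov φ (detPolicy f hf) h).mulVec y.ofLp = 0 →
            inner ℝ y (φ h (st t h ω) (f h (st t h ω))) = 0)} with hN
  have hbad : P (toMeasurable P (U ∪ N)) ≤ ENNReal.ofReal (4 * δ) := by
    rw [measure_toMeasurable]
    refine (measure_union_le _ _).trans ?_
    rw [ae_iff.1 hae, add_zero]
    exact hPU
  refine ⟨(toMeasurable P (U ∪ N))ᶜ, (measurableSet_toMeasurable _ _).compl, ?_, fun ω hω => ?_⟩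
  · rw [prob_compl_eq_one_sub (measurableSet_toMeasurable _ _), ENNReal.ofReal_sub _ (by positivity),
      ENNReal.ofReal_one]
    exact tsub_le_tsub_left hbad 1
  · have hω' : ω ∉ U ∪ N := fun h => hω (subset_toMeasurable _ _ h)
    refine ⟨fun k hk h hh => (hB k h hk hh).2 ω fun hmem => hω' (Or.inl ?_), ?_⟩
    · exact Set.mem_biUnion (x := k) hk (Set.mem_biUnion (x := h) hh hmem)
    · by_contra hcon
      exact hω' (Or.inr hcon)

end GoodEvent

end BCPVI

theorem theorem4 :
    ∃ c₁ : ℝ, 0 < c₁ ∧ ∃ C : ℝ, 0 < C ∧ ∃ p : ℕ,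
    ∀ (S A Ω : Type*) [MeasurableSpace S] [MeasurableSingletonClass S]
      [MeasurableSpace A] [MeasurableEq A] [MeasurableSpace Ω]
      (P : Measure Ω) [IsProbabilityMeasure P] (ρ : Measure S) [SigmaFinite ρ]
      (M : MDP S A ρ) (d : ℕ) (φ : ℕ → S → A → EuclideanSpace ℝ (Fin d)) (K : ℕ)
      (st : ℕ → ℕ → Ω → S) (ac : ℕ → ℕ → Ω → A) (rw : ℕ → ℕ → Ω → ℝ) (μ : ℕ → Ω → Policy S A)
      (f : ℕ → S → A) (hf : ∀ h, Measurable (f h)) (πstar : Policy S A) (δ : ℝ),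
      -- linear MDP, visitation densities bounded by `1`, adaptively collected data
      M.IsLinear φ →
      (∀ π : Policy S A, ∀ h ∈ Finset.Icc 1 M.H, ∀ s a, M.saDens π h s a ≤ 1) →
      1 ≤ K →
      IsAdaptiveData P M K st ac rw μ →
      0 < δ → δ ≤ 1 →
      -- `πstar` is a deterministic optimal policy
      πstar = detPolicy f hf →
      M.IsOptimal πstar →
      -- optimal-policy concentrability
      (∀ h ∈ Finset.Icc 1 M.H, ∀ s a, 0 < M.saDens πstar h s a →
        ∀ t ∈ Finset.Icc 1 K, ∀ ω, 0 < M.saDens (μ t ω) h s a) →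
      -- positive behaviour densities are bounded away from zero
      (∀ h ∈ Finset.Icc 1 M.H, 0 < invKappa M K μ h) →
      -- positive minimal gap
      0 < M.gapMin πstar →
      -- unique optimal actions
      (∀ h ∈ Finset.Icc 1 M.H, ∀ s, 0 < M.stateDens πstar h s →
        ∃! a, M.gap πstar h s a = 0) →
      -- spanning features
      (∀ h ∈ Finset.Icc 1 M.H,
        Submodule.span ℝ ((fun s => φ h s (f h s)) '' behaviourStates M K μ h) ≤
          Submodule.span ℝ ((fun s => φ h s (f h s)) '' {s | 0 < M.stateDens πstar h s})) →
      -- with probability at least `1 - 4 δ`, all `π̂^k` with `k ≥ k*` have zero sub-optimality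
      ∃ E : Set Ω, MeasurableSet E ∧ ENNReal.ofReal (1 - 4 * δ) ≤ P E ∧
        ∀ ω ∈ E, ∀ k ∈ Finset.Icc 1 (K + 1),
          kStar C p d M.H (kappa M K μ)
            (fun h => minPosEigenvalue (M.featureCov φ πstar h)) (M.gapMin πstar) δ ≤ k →
          ∀ π : Policy S A,
            IsEnsemblePolicy M φ 1
              (fun k => c₁ * (d * M.H * Real.log (d * M.H * k / δ)))
              (behaviourSupp K μ)
              (fun t h => st t h ω) (fun t h => ac t h ω) (fun t h => rw t h ω) k π →
            M.subOpt πstar π = 0 := by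
  refine ⟨256, by norm_num, 2 ^ 60, by norm_num, 2, ?_⟩
  intro S A Ω _ _ _ _ _ P _ ρ _ M d φ K st ac rw μ f hf πstar δ hlin hdens hK hdata hδ hδ1 hπs hopt
    hconc hinv hgap huniq _
  subst hπs
  -- For `δ > 1 / 4` the claimed probability is `ENNReal.ofReal` of a negative number.
  rcases lt_or_ge (1 / 4) δ with hδ4 | hδ4
  · exact ⟨∅, MeasurableSet.empty, by rw [ENNReal.ofReal_of_nonpos (by linarith)]; exact zero_le,
      fun ω hω => absurd hω (Set.notMem_empty ω)⟩
  have hΔH := M.gapMin_le_H hopt hgap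
  have hH : 1 ≤ M.H := by exact_mod_cast hgap.trans_le hΔH
  have hHR : (1 : ℝ) ≤ M.H := by exact_mod_cast hH
  obtain ⟨ω₀⟩ : Nonempty Ω := nonempty_of_isProbabilityMeasure P
  have h1K : 1 ∈ Finset.Icc 1 K := Finset.mem_Icc.2 ⟨le_rfl, hK⟩
  have hsa : ∀ h s, M.saDens (detPolicy f hf) h s (f h s) = M.stateDens (detPolicy f hf) h s := by
    intro h s
    simp [MDP.saDens, detPolicy]
  have hdens1 : ∀ h ∈ Finset.Icc 1 M.H, ∀ s, M.stateDens (detPolicy f hf) h s ≤ 1 :=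
    fun h hh s => hsa h s ▸ hdens (detPolicy f hf) h hh s (f h s)
  have hμ : ∀ h ∈ Finset.Icc 1 M.H, ∀ s, 0 < M.stateDens (detPolicy f hf) h s →
      ∀ t ∈ Finset.Icc 1 K, ∀ ω, 0 < M.saDens (μ t ω) h s (f h s) :=
    fun h hh s hs => hconc h hh s (f h s) (hsa h s ▸ hs)
  -- In particular the state space is nonempty and the infimum `κ_h⁻¹` is over a nonempty set.
  have hvisit : ∀ h ∈ Finset.Icc 1 M.H, ∃ s, 0 < M.stateDens (detPolicy f hf) h s := by
    intro h hh
    have := M.isProbabilityMeasure_occupancy (detPolicy f hf) hh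
    exact (M.ae_stateDens_pos (detPolicy f hf) hh).exists
  have hc1 : ∀ h ∈ Finset.Icc 1 M.H, invKappa M K μ h ≤ 1 := by
    intro h hh
    obtain ⟨s, hs⟩ := hvisit h hh
    exact (invKappa_le h1K ω₀ (hμ h hh s hs 1 h1K ω₀)).trans (hdens _ h hh s _)
  have hκ : ∀ h ∈ Finset.Icc 1 M.H, 1 ≤ kappa M K μ h :=
    fun h hh => one_le_kappa (hinv h hh) (hc1 h hh)
  have hd : 1 ≤ d := by
    have h1H : 1 ∈ Finset.Icc 1 M.H := Finset.mem_Icc.2 ⟨le_rfl, hH⟩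
    obtain ⟨s, -⟩ := hvisit 1 h1H
    exact hlin.dim_pos h1H s (f 1 s)
  have hdR : (1 : ℝ) ≤ d := by exact_mod_cast hd
  obtain ⟨E, hEm, hPE, hE⟩ := exists_good_event hlin hdata hf
    (allowedActions M (behaviourSupp K μ)) hH hd hc1 hdens1
    (fun h hh t ht ω s hs => invKappa_le ht ω (hμ h hh s hs t ht ω)) hδ hδ4
  refine ⟨E, hEm, hPE, fun ω hω k hk hkstar π hπ => ?_⟩
  obtain ⟨hev, hdat⟩ := hE ω hω
  have hk' := Finset.mem_Icc.1 hk
  have hkR : (1 : ℝ) ≤ k := by exact_mod_cast hk'.1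
  have hdHk : (d : ℝ) * M.H * k ≤ d * M.H * k / δ :=
    le_div_self (by positivity) hδ hδ1
  have hD4 : (4 : ℝ) ≤ d * M.H * k / δ := by
    rw [le_div_iff₀ hδ]
    have h1 : (1 : ℝ) ≤ d * M.H := by nlinarith
    have h2 : (1 : ℝ) ≤ d * M.H * k := by nlinarith
    linarith
  have hL1 : 1 ≤ Real.log (d * M.H * k / δ) := by
    rw [Real.le_log_iff_exp_le (by linarith)]
    linarith [Real.exp_one_lt_d9]
  have hsub : ∀ t ∈ Finset.Ico 1 k, t ∈ Finset.Icc 1 K := by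
    intro t ht
    rw [Finset.mem_Ico] at ht
    exact Finset.mem_Icc.2 ⟨ht.1, by omega⟩
  have hacc := isAccurate_of_noise_le hlin hd hk'.1 hD4 hdHk hL1 rfl
    (fun t ht h hh => (hdat t (hsub t ht) h hh).1)
    (fun h hh => (hev k hk h hh).1 fun t ht => (hdat t (hsub t ht) h hh).1) hπ
  refine subOpt_eq_zero_of_events hlin hf hopt hgap huniq ?_ hd hL1 rfl hπ hacc
    (α := fun h => ((k : ℝ) - 1) * ((invKappa M K μ h).toReal / 2))
    (fun h hh => mul_nonneg (by linarith) (by positivity)) (fun h hh => (hev k hk h hh).2)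
    (fun h hh t ht => (hdat t (hsub t ht) h hh).2) ?_
  · intro h hh s hs
    refine ⟨1, h1K, ω₀, fun h0 => ?_⟩
    have := hμ h hh s hs 1 h1K ω₀
    rw [MDP.saDens, h0, mul_zero] at this
    exact lt_irrefl _ this
  · intro h hh
    obtain ⟨hl, hl1⟩ := minPosEigenvalue_featureCov_mem hlin hf hh
    set l := minPosEigenvalue (M.featureCov φ (detPolicy f hf) h) with hldef
    set Δ := M.gapMin (detPolicy f hf) with hΔ
    have hp := (hκ h hh).trans (le_kappaProd hκ hh)
    obtain ⟨hk2, hkX⟩ := log_sq_mul_le_of_threshold_le hdR hHR (le_kappaSum hκ) hp hδ hδ1 hgap hΔH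
      hl hl1 ((kTilde_le_kStar _ _ _ _ _ _ _ _ hh).trans hkstar) (zero_le_one.trans hL1)
    set L := Real.log (d * M.H * k / δ) with hLdef
    have hc0 : 0 < (invKappa M K μ h).toReal := ENNReal.toReal_pos (hinv h hh).ne'
      (ne_top_of_le_ne_top ENNReal.one_ne_top (hc1 h hh))
    have hcκ : (invKappa M K μ h).toReal = (kappa M K μ h)⁻¹ := by rw [kappa_eq_inv, inv_inv]
    have hκ0 : 0 < kappa M K μ h := by linarith [hκ h hh]
    have h1 : (d : ℝ) ^ 2 * M.H ^ 4 * kappa M K μ h / (Δ ^ 2 * l)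
        ≤ d ^ 2 * M.H ^ 4 * kappaProd (kappa M K μ) h / (Δ ^ 2 * l ^ 3) := by
      have h2 : l ^ 3 ≤ l := by simpa using pow_le_pow_of_le_one hl.le hl1 (by norm_num : 1 ≤ 3)
      have h3 := le_kappaProd hκ hh
      gcongr
    have h4 : 2 ^ 23 * (d ^ 2 * M.H ^ 4 * kappa M K μ h / (Δ ^ 2 * l)) * L ^ 2 ≤ k :=
      le_trans (by gcongr) hkX
    have h5 : 2 ^ 23 * (d ^ 2 * M.H ^ 4 * L ^ 2) * kappa M K μ h ≤ k * (Δ ^ 2 * l) := by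
      rw [← mul_div_assoc, div_mul_eq_mul_div, div_le_iff₀ (by positivity)] at h4
      linarith
    have h6 : (k : ℝ) / 2 ≤ k - 1 := by linarith
    calc 32 * (256 * (d * M.H * L)) ^ 2 * (M.H : ℝ) ^ 2
        = 2 ^ 23 * (d ^ 2 * M.H ^ 4 * L ^ 2) * kappa M K μ h / (4 * kappa M K μ h) := by
          field_simp; ring
      _ ≤ k * (Δ ^ 2 * l) / (4 * kappa M K μ h) := by gcongr
      _ = Δ ^ 2 * ((k / 2) * ((kappa M K μ h)⁻¹ / 2) * l) := by field_simp; ring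
      _ ≤ Δ ^ 2 * ((k - 1) * ((kappa M K μ h)⁻¹ / 2) * l) := by gcongr
      _ = _ := by rw [← hcκ]
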